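/- Let $(A,\Delta)$ be an algebraic quantum group over $\mathbb C$: a regular multiplier Hopf algebra with a fixed non-zero left integral $\varphi$. (So $A$ is an algebra with non-degenerate product, not necessarily unital; $\Delta:A\to M(A\otimes A)$ is a coassociative homomorphism into the multiplier algebra; the maps sending $a\otimes b$ to $\Delta(a)(1\otimes b)$, $(a\otimes 1)\Delta(b)$, $\Delta(a)(b\otimes 1)$ and $(1\otimes a)\Delta(b)$ are bijections of $A\otimes A$ onto itself; and $(\iota\otimes\varphi)\Delta(a)=\varphi(a)1$ for all $a$.) Let $B=\widehat A=\{\varphi(\,\cdot\,c): c\in A\}$ be its dual, with pairing $\langle a,b\rangle=b(a)$, product $\langle a,bb'\rangle=\langle\Delta(a),b\otimes b'\rangle$, coproduct $\langle a\otimes a',\Delta(b)\rangle=\langle aa',b\rangle$, and let $B$ act on $A$ from the left by $b\triangleright x=(\iota\otimes\langle\,\cdot\,,b\rangle)\Delta(x)$. Let $AB$ be the Heisenberg algebra: the space $A\otimes B$ with the product $$(a\otimes b)(a'\otimes b')=\sum \langle a'_{(2)},b_{(1)}\rangle\, aa'_{(1)}\otimes b_{(2)}b'.$$ There is a unique $V\in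 M(B\otimes A)$ with $\langle V,a\otimes b\rangle=\langle a,b\rangle$ for all $a\in A$, $b\in B$, where the pairing of $B\otimes A$ with $A\otimes B$, given by $\langle b\otimes a,a'\otimes b'\rangle=\langle a',b\rangle\langle a,b'\rangle$, is extended to $M(B\otimes A)\times(A\otimes B)$ by $\langle m,c\triangleright d\rangle=\langle mc,d\rangle$ for $c\in B\otimes A$, $d\in A\otimes B$; here $(b\otimes a)\triangleright(a'\otimes b')=(b\triangleright a')\otimes(a\triangleright b')$ and $\langle a'',a\triangleright b'\rangle=\langle a''a,b'\rangle$. The action $(b\otimes a)\triangleright(x\otimes x')=(b\triangleright x)\otimes ax'$ of $B\otimes A$ on $A\otimes A$ extends uniquely to a unital action of $M(B\otimes A)$, and under this action $V$ acts as the canonical map: $$V\triangleright(x\otimes x')=T(x\otimes x')=\Delta(x)(1\otimes x')\qquad (x,x'\in A).$$ Moreover the homomorphisms $b\otimes a\mapsto b\otimes j_A(a)\otimes 1$, $b\otimes a\mapsto b\otimes 1\otimes a$ and $b\otimes a\mapsto 1\otimes j_B(b)\otimes a$ from $B\otimes A$ to $M(B\otimes AB\otimes A)$ extend uniquely to unital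 homomorphisms on $M(B\otimes A)$, where $j_A:A\to M(AB)$ and $j_B:B\to M(AB)$ are the embeddings with $j_A(a)j_B(b)=a\otimes b$; that is, $j_A(a)(a'\otimes b')=aa'\otimes b'$ and $j_B(b)(a'\otimes b')=\sum\langle a'_{(2)},b_{(1)}\rangle\,a'_{(1)}\otimes b_{(2)}b'$. Writing $V_{12}$, $V_{13}$, $V_{23}$ for the images of $V$, the pentagon equation holds in $M(B\otimes AB\otimes A)$: $$V_{12}V_{13}V_{23}=V_{23}V_{12}.$$ -/

import Mathlib

open scoped TensorProduct

noncomputable section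

/-! ## Multiplier algebras -/

section Multipliers

variable (A : Type*) [NonUnitalRing A] [Module ℂ A] [IsScalarTower ℂ A A] [SMulCommClass ℂ A A]

/-- The pairs `(L, R)` making up the multiplier algebra of `A`: pairs `m = (L, R)` of linear maps on `A` with
`a (L b) = (R a) b`; one thinks of `L b` as `m b` and of `R a` as `a m`. The product is
`(L, R) (L', R') = (L ∘ L', R' ∘ R)` and the unit is `(id, id)`. -/
def multiplierSubalgebra : Subalgebra ℂ (Module.End ℂ A × (Module.End ℂ A)ᵐᵒᵖ) where
  carrier := {m | ∀ a b : A, a * m.1 b = m.2.unop a * b}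
  mul_mem' := by
    intro m n hm hn a b
    simp only [Set.mem_ofPred_eq] at hm hn
    simp [hm, hn]
  add_mem' := by
    intro m n hm hn a b
    simp only [Set.mem_ofPred_eq] at hm hn
    simp [hm, hn, mul_add, add_mul]
  algebraMap_mem' := by
    intro r a b
    simp [Algebra.algebraMap_eq_smul_one, mul_smul_comm, smul_mul_assoc]

/-- The multiplier algebra `M(A)`. -/
def Multiplier : Type _ := ↥(multiplierSubalgebra A)

instance : Ring (Multiplier A) := inferInstanceAs (Ring ↥(multiplierSubalgebra A))

instance : Algebra ℂ (Multiplier A) := inferInstanceAs (Algebra ℂ ↥(multiplierSubalgebra A))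

/-- The product of `A` is non-degenerate. -/
def IsNondegenerateProduct : Prop :=
  (∀ a : A, (∀ b, a * b = 0) → a = 0) ∧ (∀ a : A, (∀ b, b * a = 0) → a = 0)

variable {A}

namespace Multiplier

/-- `m.lmul b` is `m b`. -/
def lmul (m : Multiplier A) : A →ₗ[ℂ] A := m.1.1

/-- `m.rmul a` is `a m`. -/
def rmul (m : Multiplier A) : A →ₗ[ℂ] A := m.1.2.unop

lemma compat (m : Multiplier A) (a b : A) : a * m.lmul b = m.rmul a * b := m.2 a b

lemma ext' {m n : Multiplier A} (h : m.lmul = n.lmul) (h' : m.rmul = n.rmul) : m = n :=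
  Subtype.ext (Prod.ext h (MulOpposite.unop_injective h'))

/-- The multiplier with given left and right multiplications. -/
def mk' (L R : A →ₗ[ℂ] A) (h : ∀ a b, a * L b = R a * b) : Multiplier A :=
  ⟨(L, MulOpposite.op R), h⟩

/-- The embedding of `A` in `M(A)`. -/
def of (a : A) : Multiplier A :=
  mk' (LinearMap.mulLeft ℂ a) (LinearMap.mulRight ℂ a) (fun b c => by simp [mul_assoc])

@[simp] lemma lmul_mk' (L R : A →ₗ[ℂ] A) (h) : (mk' L R h).lmul = L := rfl
@[simp] lemma rmul_mk' (L R : A →ₗ[ℂ] A) (h) : (mk' L R h).rmul = R := rfl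
@[simp] lemma lmul_of (a b : A) : (of a).lmul b = a * b := rfl
@[simp] lemma rmul_of (a b : A) : (of a).rmul b = b * a := rfl
@[simp] lemma lmul_mul (m n : Multiplier A) (a : A) : (m * n).lmul a = m.lmul (n.lmul a) := rfl
@[simp] lemma rmul_mul (m n : Multiplier A) (a : A) : (m * n).rmul a = n.rmul (m.rmul a) := rfl
@[simp] lemma lmul_one (a : A) : (1 : Multiplier A).lmul a = a := rfl
@[simp] lemma rmul_one (a : A) : (1 : Multiplier A).rmul a = a := rfl

@[simp] lemma lmul_add (m n : Multiplier A) (a : A) : (m + n).lmul a = m.lmul a + n.lmul a := rfl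
@[simp] lemma rmul_add (m n : Multiplier A) (a : A) : (m + n).rmul a = m.rmul a + n.rmul a := rfl
@[simp] lemma lmul_smul (r : ℂ) (m : Multiplier A) (a : A) : (r • m).lmul a = r • m.lmul a := rfl
@[simp] lemma rmul_smul (r : ℂ) (m : Multiplier A) (a : A) : (r • m).rmul a = r • m.rmul a := rfl

variable {C : Type*} [NonUnitalRing C] [Module ℂ C] [IsScalarTower ℂ C C] [SMulCommClass ℂ C C]

/-- For `m ∈ M(A)` and `n ∈ M(C)` the multiplier `m ⊗ n ∈ M(A ⊗ C)`. -/
def tmul (m : Multiplier A) (n : Multiplier C) : Multiplier (A ⊗[ℂ] C) :=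
  mk' (TensorProduct.map m.lmul n.lmul) (TensorProduct.map m.rmul n.rmul) (by
    intro x y
    induction x with
    | zero => simp
    | add x x' hx hx' => simp [add_mul, hx, hx']
    | tmul a c =>
      induction y with
      | zero => simp
      | add y y' hy hy' => simp only [mul_add, map_add, hy, hy']
      | tmul a' c' => simp [compat])

@[simp] lemma lmul_tmul (m : Multiplier A) (n : Multiplier C) (x : A ⊗[ℂ] C) :
    (tmul m n).lmul x = TensorProduct.map m.lmul n.lmul x := rfl

end Multiplier

end Multipliers

/-! ## Algebraic quantum groups -/

/-- A regular multiplier Hopf algebra over `ℂ`, with a fixed left integral `φ`.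
The maps `T₁, T₂, T₃, T₄` are determined by the coproduct (`A ⊗ A` embeds in `M(A ⊗ A)`); giving
them as linear equivalences of `A ⊗ A` expresses that `Δ(a)(1 ⊗ b)`, `(a ⊗ 1)Δ(b)`,
`Δ(a)(b ⊗ 1)` and `(1 ⊗ a)Δ(b)` lie in `A ⊗ A` and that the four induced maps of `A ⊗ A` are
bijective: `T₁` and `T₂` for a multiplier Hopf algebra, `T₃` and `T₄` for regularity. -/
structure AlgebraicQuantumGroup (A : Type*) [NonUnitalRing A] [Module ℂ A] [IsScalarTower ℂ A A]
    [SMulCommClass ℂ A A] where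
  nondegenerate : IsNondegenerateProduct A
  /-- the coproduct, an algebra homomorphism `A → M(A ⊗ A)` -/
  Δ : A →ₙₐ[ℂ] Multiplier (A ⊗[ℂ] A)
  /-- the canonical map `a ⊗ b ↦ Δ(a)(1 ⊗ b)` -/
  T₁ : (A ⊗[ℂ] A) ≃ₗ[ℂ] (A ⊗[ℂ] A)
  T₁_spec : ∀ a b, Δ a * Multiplier.tmul 1 (.of b) = .of (T₁ (a ⊗ₜ b))
  /-- `a ⊗ b ↦ (a ⊗ 1)Δ(b)` -/
  T₂ : (A ⊗[ℂ] A) ≃ₗ[ℂ] (A ⊗[ℂ] A)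
  T₂_spec : ∀ a b, Multiplier.tmul (.of a) 1 * Δ b = .of (T₂ (a ⊗ₜ b))
  /-- `a ⊗ b ↦ Δ(a)(b ⊗ 1)` -/
  T₃ : (A ⊗[ℂ] A) ≃ₗ[ℂ] (A ⊗[ℂ] A)
  T₃_spec : ∀ a b, Δ a * Multiplier.tmul (.of b) 1 = .of (T₃ (a ⊗ₜ b))
  /-- `a ⊗ b ↦ (1 ⊗ a)Δ(b)` -/
  T₄ : (A ⊗[ℂ] A) ≃ₗ[ℂ] (A ⊗[ℂ] A)
  T₄_spec : ∀ a b, Multiplier.tmul 1 (.of a) * Δ b = .of (T₄ (a ⊗ₜ b))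
  /-- coassociativity:
  `(a ⊗ 1 ⊗ 1) (Δ ⊗ ι)(Δ(b)(1 ⊗ c)) = (ι ⊗ Δ)((a ⊗ 1)Δ(b)) (1 ⊗ 1 ⊗ c)` in `A ⊗ A ⊗ A` -/
  coassoc : ∀ a b c : A,
    TensorProduct.assoc ℂ A A A
        (T₂.toLinearMap.rTensor A ((TensorProduct.assoc ℂ A A A).symm (a ⊗ₜ T₁ (b ⊗ₜ c)))) =
      T₁.toLinearMap.lTensor A (TensorProduct.assoc ℂ A A A (T₂ (a ⊗ₜ b) ⊗ₜ c))
  /-- the left integral -/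
  φ : A →ₗ[ℂ] ℂ
  φ_ne_zero : φ ≠ 0
  /-- left invariance `(ι ⊗ φ)Δ(a) = φ(a) 1`, that is
  `(ι ⊗ φ)(Δ(a)(b ⊗ 1)) = φ(a) b` for all `b` -/
  left_invariant : ∀ a b, TensorProduct.rid ℂ A (φ.lTensor A (T₃ (a ⊗ₜ b))) = φ a • b

/-! ### Facts from linear algebra -/

section LinearAlgebra

variable {X Y Z : Type*} [AddCommGroup X] [Module ℂ X] [AddCommGroup Y] [Module ℂ Y]
  [AddCommGroup Z] [Module ℂ Z]

/-- Jointly injective linear maps remain jointly injective after tensoring. -/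
lemma rTensor_jointly_injective {ι : Type*} (f : ι → X →ₗ[ℂ] Z)
    (hf : ∀ x, (∀ i, f i x = 0) → x = 0) (t : X ⊗[ℂ] Y)
    (ht : ∀ i, (f i).rTensor Y t = 0) : t = 0 := by
  classical
  let b := Module.Basis.ofVectorSpace ℂ Y
  apply (TensorProduct.equivFinsuppOfBasisRight b).injective
  rw [map_zero]
  ext k
  apply hf
  intro i
  have key : ∀ s : X ⊗[ℂ] Y, f i (TensorProduct.equivFinsuppOfBasisRight b s k)
      = TensorProduct.equivFinsuppOfBasisRight b ((f i).rTensor Y s) k := by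
    intro s
    induction s with
    | zero => simp
    | add x y hx hy => simp [hx, hy]
    | tmul x y => simp
  rw [key, ht]; simp

lemma lTensor_jointly_injective {ι : Type*} (f : ι → X →ₗ[ℂ] Z)
    (hf : ∀ x, (∀ i, f i x = 0) → x = 0) (t : Y ⊗[ℂ] X)
    (ht : ∀ i, (f i).lTensor Y t = 0) : t = 0 := by
  apply (TensorProduct.comm ℂ Y X).injective
  rw [map_zero]
  apply rTensor_jointly_injective f hf
  intro i
  have key : ∀ s : Y ⊗[ℂ] X, (f i).rTensor Y (TensorProduct.comm ℂ Y X s)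
      = TensorProduct.comm ℂ Y Z ((f i).lTensor Y s) := by
    intro s
    induction s with
    | zero => simp
    | add x y hx hy => simp [hx, hy]
    | tmul x y => simp
  rw [key, ht]; simp

end LinearAlgebra

section Nondegenerate

variable {A : Type*} [NonUnitalRing A] [Module ℂ A] [IsScalarTower ℂ A A] [SMulCommClass ℂ A A]
variable {C : Type*} [NonUnitalRing C] [Module ℂ C] [IsScalarTower ℂ C C] [SMulCommClass ℂ C C]

lemma tensor_mul_eq (a : A) (c : C) (t : A ⊗[ℂ] C) :
    t * (a ⊗ₜ c) = (LinearMap.mulRight ℂ c).lTensor A ((LinearMap.mulRight ℂ a).rTensor C t) := by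
  induction t with
  | zero => simp
  | add x y hx hy => simp only [add_mul, map_add, hx, hy]
  | tmul x y => simp

lemma mul_tensor_eq (a : A) (c : C) (t : A ⊗[ℂ] C) :
    (a ⊗ₜ c) * t = (LinearMap.mulLeft ℂ c).lTensor A ((LinearMap.mulLeft ℂ a).rTensor C t) := by
  induction t with
  | zero => simp
  | add x y hx hy => simp only [mul_add, map_add, hx, hy]
  | tmul x y => simp

lemma IsNondegenerateProduct.tensor (hA : IsNondegenerateProduct A)
    (hC : IsNondegenerateProduct C) : IsNondegenerateProduct (A ⊗[ℂ] C) := by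
  constructor
  · intro t ht
    apply rTensor_jointly_injective (fun a : A => LinearMap.mulRight ℂ a)
      (fun x hx => hA.1 x hx)
    intro a
    apply lTensor_jointly_injective (fun c : C => LinearMap.mulRight ℂ c)
      (fun x hx => hC.1 x hx)
    intro c
    rw [← tensor_mul_eq, ht]
  · intro t ht
    apply rTensor_jointly_injective (fun a : A => LinearMap.mulLeft ℂ a)
      (fun x hx => hA.2 x hx)
    intro a
    apply lTensor_jointly_injective (fun c : C => LinearMap.mulLeft ℂ c)
      (fun x hx => hC.2 x hx)
    intro c
    rw [← mul_tensor_eq, ht]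

namespace Multiplier

lemma lmul_mul_right (hA : IsNondegenerateProduct A) (m : Multiplier A) (a b : A) :
    m.lmul (a * b) = m.lmul a * b := by
  rw [← sub_eq_zero]
  apply hA.2
  intro c
  rw [mul_sub, compat, ← mul_assoc, ← mul_assoc, compat, sub_self]

lemma of_injective (hA : IsNondegenerateProduct A) : Function.Injective (of : A → Multiplier A) := by
  intro a b h
  rw [← sub_eq_zero]
  apply hA.1
  intro c
  have := congrArg (fun m => m.lmul c) h
  simp only [lmul_of] at this
  rw [sub_mul, this, sub_self]

lemma mul_of (hA : IsNondegenerateProduct A) (m : Multiplier A) (a : A) :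
    m * of a = of (m.lmul a) := by
  apply ext'
  · ext b; simp [lmul_mul_right hA]
  · ext b; simp [compat]

end Multiplier

end Nondegenerate

namespace AlgebraicQuantumGroup

variable {A : Type*} [NonUnitalRing A] [Module ℂ A] [IsScalarTower ℂ A A] [SMulCommClass ℂ A A]
variable (G : AlgebraicQuantumGroup A)

open Multiplier

/-- The slice map `ι ⊗ φ : A ⊗ A → A`. -/
def slice : A ⊗[ℂ] A →ₗ[ℂ] A := (TensorProduct.rid ℂ A).toLinearMap ∘ₗ G.φ.lTensor A

@[simp] lemma slice_tmul (a b : A) : G.slice (a ⊗ₜ b) = G.φ b • a := by simp [slice]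

lemma nondegenerate₂ (G : AlgebraicQuantumGroup A) : IsNondegenerateProduct (A ⊗[ℂ] A) := G.nondegenerate.tensor G.nondegenerate

lemma slice_T₃ (a b : A) : G.slice (G.T₃ (a ⊗ₜ b)) = G.φ a • b := G.left_invariant a b

lemma T₁_mulRight (a c d : A) :
    (LinearMap.mulRight ℂ c).rTensor A (G.T₁ (a ⊗ₜ d)) = (G.Δ a).lmul (c ⊗ₜ d) := by
  apply of_injective G.nondegenerate₂
  rw [← mul_of G.nondegenerate₂]
  have h : (of (c ⊗ₜ[ℂ] d) : Multiplier (A ⊗[ℂ] A)) = tmul 1 (of d) * tmul (of c) 1 := by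
    apply ext'
    · ext x y; simp
    · ext x y; simp [tmul]
  rw [h, ← mul_assoc, G.T₁_spec]
  apply ext'
  · ext x y
    simp only [TensorProduct.AlgebraTensorModule.curry_apply, LinearMap.restrictScalars_self,
      TensorProduct.curry_apply, lmul_of, lmul_mul, lmul_tmul]
    generalize G.T₁ (a ⊗ₜ d) = t
    induction t with
    | zero => simp
    | add x y hx hy => simp only [map_add, add_mul, hx, hy]
    | tmul u v => simp [mul_assoc]
  · ext x y
    simp only [TensorProduct.AlgebraTensorModule.curry_apply, LinearMap.restrictScalars_self,
      TensorProduct.curry_apply, rmul_of, rmul_mul, tmul, rmul_mk']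
    generalize G.T₁ (a ⊗ₜ d) = t
    induction t with
    | zero => simp
    | add x y hx hy => simp only [map_add, mul_add, hx, hy]
    | tmul u v => simp [mul_assoc]

lemma T₁_mul (a b c : A) : G.T₁ ((a * b) ⊗ₜ c) = (G.Δ a).lmul (G.T₁ (b ⊗ₜ c)) := by
  apply of_injective G.nondegenerate₂
  rw [← mul_of G.nondegenerate₂, ← G.T₁_spec, ← G.T₁_spec, map_mul, mul_assoc]

lemma T₃_mul (a b c : A) : G.T₃ ((a * b) ⊗ₜ c) = (G.Δ a).lmul (G.T₃ (b ⊗ₜ c)) := by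
  apply of_injective G.nondegenerate₂
  rw [← mul_of G.nondegenerate₂, ← G.T₃_spec, ← G.T₃_spec, map_mul, mul_assoc]

lemma T₂_mul (a b : A) (t : A ⊗[ℂ] A) :
    G.T₂ (a ⊗ₜ b) * t = (LinearMap.mulLeft ℂ a).rTensor A ((G.Δ b).lmul t) := by
  have := congrArg (fun m => m.lmul t) (G.T₂_spec a b)
  simp only [lmul_mul, lmul_of, lmul_tmul] at this
  rw [← this]
  rfl

lemma T₂_T₁ (a b c : A) :
    (LinearMap.mulRight ℂ c).lTensor A (G.T₂ (a ⊗ₜ b)) =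
      (LinearMap.mulLeft ℂ a).rTensor A (G.T₁ (b ⊗ₜ c)) := by
  rw [← sub_eq_zero]
  apply G.nondegenerate₂.1
  intro t
  rw [sub_mul, sub_eq_zero]
  have h1 : ∀ s : A ⊗[ℂ] A, (LinearMap.mulRight ℂ c).lTensor A s * t
      = s * (LinearMap.mulLeft ℂ c).lTensor A t := by
    intro s
    induction s with
    | zero => simp
    | add x y hx hy => simp only [map_add, add_mul, hx, hy]
    | tmul u v =>
      induction t with
      | zero => simp
      | add x y hx hy => simp only [map_add, mul_add, hx, hy]
      | tmul u v => simp [mul_assoc]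
  have h2 : ∀ s : A ⊗[ℂ] A, (LinearMap.mulLeft ℂ a).rTensor A s * t
      = (LinearMap.mulLeft ℂ a).rTensor A (s * t) := by
    intro s
    clear h1
    induction s with
    | zero => simp
    | add x y hx hy => simp only [map_add, add_mul, hx, hy]
    | tmul u v =>
      induction t with
      | zero => simp
      | add x y hx hy => simp only [map_add, mul_add, hx, hy]
      | tmul u v => simp [mul_assoc]
  rw [h1, h2, T₂_mul]
  have := congrArg (fun m => m.lmul t) (G.T₁_spec b c)
  simp only [lmul_mul, lmul_of, lmul_tmul] at this
  rw [← this]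
  rfl

lemma T₃_mulRight (a c d : A) :
    (LinearMap.mulRight ℂ d).lTensor A (G.T₃ (a ⊗ₜ c)) = (G.Δ a).lmul (c ⊗ₜ d) := by
  apply of_injective G.nondegenerate₂
  rw [← mul_of G.nondegenerate₂]
  have h : (of (c ⊗ₜ[ℂ] d) : Multiplier (A ⊗[ℂ] A)) = tmul (of c) 1 * tmul 1 (of d) := by
    apply ext'
    · ext x y; simp
    · ext x y; simp [tmul]
  rw [h, ← mul_assoc, G.T₃_spec]
  apply ext'
  · ext x y
    simp only [TensorProduct.AlgebraTensorModule.curry_apply, LinearMap.restrictScalars_self,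
      TensorProduct.curry_apply, lmul_of, lmul_mul, lmul_tmul]
    generalize G.T₃ (a ⊗ₜ c) = t
    induction t with
    | zero => simp
    | add x y hx hy => simp only [map_add, add_mul, hx, hy]
    | tmul u v => simp [mul_assoc]
  · ext x y
    simp only [TensorProduct.AlgebraTensorModule.curry_apply, LinearMap.restrictScalars_self,
      TensorProduct.curry_apply, rmul_of, rmul_mul, tmul, rmul_mk']
    generalize G.T₃ (a ⊗ₜ c) = t
    induction t with
    | zero => simp
    | add x y hx hy => simp only [map_add, mul_add, hx, hy]
    | tmul u v => simp [mul_assoc]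

lemma slice_mul (t : A ⊗[ℂ] A) (c : A) :
    G.slice t * c = G.slice ((LinearMap.mulRight ℂ c).rTensor A t) := by
  induction t with
  | zero => simp
  | add x y hx hy => simp only [map_add, add_mul, hx, hy]
  | tmul u v => simp [smul_mul_assoc]

lemma mul_slice (t : A ⊗[ℂ] A) (c : A) :
    c * G.slice t = G.slice ((LinearMap.mulLeft ℂ c).rTensor A t) := by
  induction t with
  | zero => simp
  | add x y hx hy => simp only [map_add, mul_add, hx, hy]
  | tmul u v => simp [mul_smul_comm]

/-! ### The dual and its action on `A` -/

/-- The map sending `c` to the functional `φ( · c)`. -/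
def dualMap : A →ₗ[ℂ] Module.Dual ℂ A := (LinearMap.mul ℂ A).flip.compr₂ G.φ

@[simp] lemma dualMap_apply (c a : A) : G.dualMap c a = G.φ (a * c) := rfl

/-- The dual `B` of `A`: the space of functionals `φ( · c)` with `c ∈ A`. -/
def Dual : Type _ := ↥(LinearMap.range G.dualMap)

instance : AddCommGroup G.Dual := inferInstanceAs (AddCommGroup ↥(LinearMap.range G.dualMap))

instance : Module ℂ G.Dual := inferInstanceAs (Module ℂ ↥(LinearMap.range G.dualMap))

/-- An element of `B` as a functional on `A`: `eval b a = ⟨a, b⟩`. -/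
def eval : G.Dual →ₗ[ℂ] Module.Dual ℂ A := (LinearMap.range G.dualMap).subtype

/-- The element `φ( · c)` of `B`. -/
def toDual : A →ₗ[ℂ] G.Dual := G.dualMap.rangeRestrict

@[simp] lemma eval_toDual (c a : A) : G.eval (G.toDual c) a = G.φ (a * c) := rfl

lemma eval_injective : Function.Injective G.eval := Subtype.val_injective

lemma toDual_surjective : Function.Surjective G.toDual := LinearMap.surjective_rangeRestrict _

/-- `c` and `x` are sent to `(ι ⊗ φ)(Δ(x)(1 ⊗ c))`. -/
def sliceAct : A →ₗ[ℂ] Module.End ℂ A :=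
  (TensorProduct.mk ℂ A A).flip.compr₂ (G.slice ∘ₗ G.T₁.toLinearMap)

lemma sliceAct_apply (c x : A) : G.sliceAct c x = G.slice (G.T₁ (x ⊗ₜ c)) := rfl

lemma sliceAct_mul (c x y : A) :
    G.sliceAct c x * y = TensorProduct.rid ℂ A ((G.dualMap c).lTensor A (G.T₃ (x ⊗ₜ y))) := by
  rw [sliceAct_apply, slice_mul, T₁_mulRight, ← T₃_mulRight]
  generalize G.T₃ (x ⊗ₜ y) = t
  induction t with
  | zero => simp
  | add x y hx hy => simp only [map_add, hx, hy]
  | tmul u v => simp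

lemma ker_le_sliceAct : LinearMap.ker G.dualMap ≤ LinearMap.ker G.sliceAct := by
  intro c hc
  rw [LinearMap.mem_ker] at hc ⊢
  ext x
  apply G.nondegenerate.1
  intro y
  rw [sliceAct_mul, hc]
  simp

/-- The left action of `B` on `A`: `b ▷ x = (ι ⊗ ⟨ · , b⟩)Δ(x)`, which for `b = φ( · c)` is
`(ι ⊗ φ)(Δ(x)(1 ⊗ c))`. -/
def act : G.Dual →ₗ[ℂ] Module.End ℂ A :=
  (LinearMap.ker G.dualMap).liftQ G.sliceAct G.ker_le_sliceAct ∘ₗ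
    G.dualMap.quotKerEquivRange.symm.toLinearMap

lemma act_toDual (c x : A) : G.act (G.toDual c) x = G.slice (G.T₁ (x ⊗ₜ c)) := by
  have : G.dualMap.quotKerEquivRange.symm (G.toDual c) = Submodule.Quotient.mk c := by
    exact (LinearEquiv.symm_apply_eq _).2 rfl
  change (LinearMap.ker G.dualMap).liftQ G.sliceAct G.ker_le_sliceAct
    (G.dualMap.quotKerEquivRange.symm (G.toDual c)) x = _
  rw [this]; rfl

lemma act_toDual' (c x : A) : G.act (G.toDual c) x = G.sliceAct c x := G.act_toDual c x

/-- `(b ▷ x) y = (ι ⊗ ⟨ · , b⟩)(Δ(x)(y ⊗ 1))`. -/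
lemma act_mul_right (b : G.Dual) (x y : A) :
    G.act b x * y = TensorProduct.rid ℂ A ((G.eval b).lTensor A (G.T₃ (x ⊗ₜ y))) := by
  obtain ⟨c, rfl⟩ := G.toDual_surjective b
  rw [act_toDual']; exact G.sliceAct_mul c x y

/-- `⟨a, b b'⟩ = ⟨b' ▷ a, b⟩ = ⟨Δ(a), b ⊗ b'⟩` for `b = φ( · c)` and `b' = φ( · d)`. -/
lemma eval_act_toDual (a c d : A) : G.eval (G.toDual c) (G.act (G.toDual d) a) =
    G.φ (G.slice ((G.Δ a).lmul (c ⊗ₜ d))) := by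
  rw [eval_toDual, act_toDual, slice_mul, T₁_mulRight]

lemma eval_act_eq (a c d : A) : G.eval (G.toDual c) (G.act (G.toDual d) a) =
    G.eval (G.toDual (G.slice (G.T₃.symm (c ⊗ₜ d)))) a := by
  rw [eval_act_toDual]
  obtain ⟨t, ht⟩ := G.T₃.surjective (c ⊗ₜ d)
  rw [← ht, LinearEquiv.symm_apply_apply]
  clear ht
  induction t with
  | zero => simp
  | add x y hx hy => simp only [map_add, LinearMap.add_apply, hx, hy]
  | tmul p q => rw [← T₃_mul, slice_T₃]; simp [mul_comm]

lemma mul_mem_range (b b' : G.Dual) :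
    G.eval b ∘ₗ G.act b' ∈ LinearMap.range G.dualMap := by
  obtain ⟨c, rfl⟩ := G.toDual_surjective b
  obtain ⟨d, rfl⟩ := G.toDual_surjective b'
  refine ⟨G.slice (G.T₃.symm (c ⊗ₜ d)), ?_⟩
  ext a
  exact (G.eval_act_eq a c d).symm

/-- The product of `B`, dual to the coproduct of `A`:
`⟨a, b b'⟩ = ⟨Δ(a), b ⊗ b'⟩ = ⟨(ι ⊗ ⟨ · , b'⟩)Δ(a), b⟩`. -/
instance : Mul G.Dual := ⟨fun b b' => ⟨G.eval b ∘ₗ G.act b', G.mul_mem_range b b'⟩⟩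

@[simp] lemma eval_mul (b b' : G.Dual) (a : A) : G.eval (b * b') a = G.eval b (G.act b' a) := rfl

lemma toDual_mul (c d : A) :
    G.toDual c * G.toDual d = G.toDual (G.slice (G.T₃.symm (c ⊗ₜ d))) := by
  apply G.eval_injective
  ext a
  rw [eval_mul, eval_act_eq]

/-- `s` and `x` are sent to `(ι ⊗ φ)(Δ(x) s)`. -/
def sliceΔ (s : A ⊗[ℂ] A) : A →ₗ[ℂ] A where
  toFun x := G.slice ((G.Δ x).lmul s)
  map_add' x y := by
    rw [map_add G.Δ x y]; exact map_add G.slice _ _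
  map_smul' r x := by
    rw [map_smul G.Δ r x]; exact map_smul G.slice r _

lemma sliceΔ_apply (s : A ⊗[ℂ] A) (x : A) : G.sliceΔ s x = G.slice ((G.Δ x).lmul s) := rfl

lemma sliceΔ_add (s t : A ⊗[ℂ] A) : G.sliceΔ (s + t) = G.sliceΔ s + G.sliceΔ t := by
  ext x; simp [sliceΔ_apply]

lemma sliceΔ_zero : G.sliceΔ 0 = 0 := by
  ext x; simp [sliceΔ_apply]

/-- `c ⊗ d ↦ Δ(d ▷ x)(c ⊗ 1)`, up to the identification of `d` with `φ( · d)`. -/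
def iter (x : A) : A ⊗[ℂ] A →ₗ[ℂ] A ⊗[ℂ] A :=
  G.T₁.toLinearMap ∘ₗ (G.sliceAct.flip x).rTensor A ∘ₗ (TensorProduct.comm ℂ A A).toLinearMap

lemma iter_tmul (x c d : A) : G.iter x (c ⊗ₜ d) = G.T₁ (G.sliceAct d x ⊗ₜ c) := rfl

lemma T₂_slice (y : A) (v : A ⊗[ℂ] A) : G.T₂ (y ⊗ₜ G.slice v) =
    G.slice.lTensor A (TensorProduct.assoc ℂ A A A
      (G.T₂.toLinearMap.rTensor A ((TensorProduct.assoc ℂ A A A).symm (y ⊗ₜ v)))) := by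
  induction v with
  | zero => simp
  | add u v hu hv => simp only [map_add, TensorProduct.tmul_add, hu, hv]
  | tmul u v =>
    simp only [slice_tmul, TensorProduct.tmul_smul, map_smul, TensorProduct.assoc_symm_tmul,
      LinearMap.rTensor_tmul, LinearEquiv.coe_coe]
    generalize G.T₂ (y ⊗ₜ u) = t
    induction t with
    | zero => simp
    | add u v hu hv => simp only [map_add, TensorProduct.add_tmul, smul_add, hu, hv]
    | tmul a b => simp

lemma mulLeft_iter (x y : A) (s : A ⊗[ℂ] A) :
    (LinearMap.mulLeft ℂ y).rTensor A (G.iter x s) =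
      (G.sliceΔ s).lTensor A (G.T₂ (y ⊗ₜ x)) := by
  induction s with
  | zero => simp [sliceΔ_zero]
  | add u v hu hv =>
    simp only [map_add, sliceΔ_add, LinearMap.lTensor_add, LinearMap.add_apply, hu, hv]
  | tmul c d =>
    rw [iter_tmul, ← T₂_T₁, sliceAct_apply, T₂_slice, G.coassoc]
    generalize G.T₂ (y ⊗ₜ x) = w
    induction w with
    | zero => simp
    | add u v hu hv => simp only [map_add, TensorProduct.add_tmul, hu, hv]
    | tmul r s =>
      simp only [TensorProduct.assoc_tmul, LinearMap.lTensor_tmul, LinearEquiv.coe_coe,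
        LinearMap.mulRight_apply, sliceΔ_apply]
      rw [slice_mul, T₁_mulRight]

lemma iter_T₃ (x : A) (t : A ⊗[ℂ] A) :
    G.iter x (G.T₃ t) = (G.sliceAct.flip x).rTensor A t := by
  induction t with
  | zero => simp
  | add u v hu hv => simp only [map_add, hu, hv]
  | tmul p q =>
    rw [← sub_eq_zero]
    apply rTensor_jointly_injective (fun a : A => LinearMap.mulLeft ℂ a)
      (fun x hx => G.nondegenerate.2 x hx)
    intro y
    rw [map_sub, sub_eq_zero, mulLeft_iter, LinearMap.rTensor_tmul, LinearMap.rTensor_tmul,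
      LinearMap.mulLeft_apply, LinearMap.flip_apply, sliceAct_apply, mul_slice, ← T₂_T₁]
    generalize G.T₂ (y ⊗ₜ x) = w
    induction w with
    | zero => simp
    | add u v hu hv => simp only [map_add, TensorProduct.add_tmul, hu, hv]
    | tmul r s =>
      simp only [LinearMap.lTensor_tmul, sliceΔ_apply, LinearMap.mulRight_apply, slice_tmul]
      rw [← T₃_mul, slice_T₃, TensorProduct.tmul_smul, TensorProduct.smul_tmul']

/-- `A` is a left module over `B`. -/
lemma act_mul (b b' : G.Dual) (x : A) : G.act (b * b') x = G.act b (G.act b' x) := by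
  obtain ⟨c, rfl⟩ := G.toDual_surjective b
  obtain ⟨d, rfl⟩ := G.toDual_surjective b'
  rw [toDual_mul, act_toDual' G _ x, act_toDual, act_toDual', ← iter_tmul]
  obtain ⟨t, ht⟩ := G.T₃.surjective (c ⊗ₜ d)
  rw [← ht, LinearEquiv.symm_apply_apply, iter_T₃]
  clear ht
  induction t with
  | zero => simp
  | add u v hu hv => simp only [map_add, LinearMap.add_apply, hu, hv]
  | tmul p q => simp

instance : NonUnitalRing G.Dual where
  left_distrib b c d := by
    apply G.eval_injective; ext a; simp
  right_distrib b c d := by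
    apply G.eval_injective; ext a; simp
  zero_mul b := by
    apply G.eval_injective; ext a; simp
  mul_zero b := by
    apply G.eval_injective; ext a; simp
  mul_assoc b c d := by
    apply G.eval_injective; ext a; simp [act_mul]

instance : IsScalarTower ℂ G.Dual G.Dual := ⟨fun r b c => by
  apply G.eval_injective; ext a
  simp only [smul_eq_mul, eval_mul, map_smul, LinearMap.smul_apply]⟩

instance : SMulCommClass ℂ G.Dual G.Dual := ⟨fun r b c => by
  apply G.eval_injective; ext a
  simp only [smul_eq_mul, eval_mul, map_smul, LinearMap.smul_apply]⟩

/-! ### The coproduct of the dual -/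

/-- The tensor product pairing of `B ⊗ B` with `A ⊗ A`. -/
def eval₂ : G.Dual ⊗[ℂ] G.Dual →ₗ[ℂ] Module.Dual ℂ (A ⊗[ℂ] A) :=
  TensorProduct.dualDistrib ℂ A A ∘ₗ TensorProduct.map G.eval G.eval

@[simp] lemma eval₂_tmul (b b' : G.Dual) (a a' : A) :
    G.eval₂ (b ⊗ₜ b') (a ⊗ₜ a') = G.eval b a * G.eval b' a' := rfl

lemma eval₂_injective : Function.Injective G.eval₂ := by
  rw [injective_iff_map_eq_zero]
  intro t ht
  apply rTensor_jointly_injective (fun a : A => G.eval.flip a)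
    (fun b hb => G.eval_injective (by ext a; simpa using hb a))
  intro a
  apply lTensor_jointly_injective (fun a : A => G.eval.flip a)
    (fun b hb => G.eval_injective (by ext a; simpa using hb a))
  intro a'
  have key : ∀ s : G.Dual ⊗[ℂ] G.Dual, (G.eval.flip a').lTensor ℂ ((G.eval.flip a).rTensor G.Dual s)
      = G.eval₂ s (a ⊗ₜ a') • ((1 : ℂ) ⊗ₜ[ℂ] (1 : ℂ)) := by
    intro s
    induction s with
    | zero => simp
    | add x y hx hy => simp only [map_add, LinearMap.add_apply, hx, hy, add_smul]
    | tmul x y =>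
      simp only [LinearMap.rTensor_tmul, LinearMap.lTensor_tmul, LinearMap.flip_apply, eval₂_tmul,
        TensorProduct.smul_tmul']
      rw [mul_comm, ← smul_smul, TensorProduct.smul_tmul]
      simp
  rw [key, ht]; simp

lemma eval₂_toDual (z s : A ⊗[ℂ] A) :
    G.eval₂ (TensorProduct.map G.toDual G.toDual s) z = G.φ (G.slice (z * s)) := by
  induction s with
  | zero => simp
  | add x y hx hy => simp only [map_add, LinearMap.add_apply, mul_add, hx, hy]
  | tmul c d =>
    induction z with
    | zero => simp
    | add x y hx hy => simp only [map_add, add_mul, hx, hy]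
    | tmul x y => simp [mul_comm]

lemma eval₂_T₂ (t : A ⊗[ℂ] A) :
    G.eval₂ (TensorProduct.map G.toDual G.toDual (G.T₃ t)) ∘ₗ G.T₂.toLinearMap =
      G.eval₂ (TensorProduct.map G.toDual G.toDual (TensorProduct.comm ℂ A A t)) := by
  apply TensorProduct.ext'
  intro x y
  rw [LinearMap.comp_apply, LinearEquiv.coe_coe, eval₂_toDual, T₂_mul, ← mul_slice]
  induction t with
  | zero => simp
  | add u v hu hv => simp only [map_add, LinearMap.add_apply, mul_add, hu, hv]
  | tmul p q =>
    rw [← T₃_mul, slice_T₃]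
    simp [mul_comm, mul_smul_comm]

lemma map_toDual_surjective :
    Function.Surjective (TensorProduct.map G.toDual G.toDual) :=
  TensorProduct.map_surjective G.toDual_surjective G.toDual_surjective

lemma eval₂_T₂_mem (s : G.Dual ⊗[ℂ] G.Dual) :
    G.eval₂ s ∘ₗ G.T₂.toLinearMap ∈ LinearMap.range G.eval₂ := by
  obtain ⟨s, rfl⟩ := G.map_toDual_surjective s
  obtain ⟨t, rfl⟩ := G.T₃.surjective s
  rw [eval₂_T₂]
  exact ⟨_, rfl⟩

/-- The map `b ⊗ b' ↦ Δ(b)(1 ⊗ b')` of `B ⊗ B`, where the coproduct of `B` is dual to the product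
of `A`. As `⟨a, x b'⟩ = ⟨b' ▷ a, x⟩`, it is given by
`⟨a ⊗ a', Δ(b)(1 ⊗ b')⟩ = ⟨a (b' ▷ a'), b⟩ = ⟨(a ⊗ 1)Δ(a'), b ⊗ b'⟩`. -/
def dualT₁ : G.Dual ⊗[ℂ] G.Dual →ₗ[ℂ] G.Dual ⊗[ℂ] G.Dual :=
  (LinearEquiv.ofInjective G.eval₂ G.eval₂_injective).symm.toLinearMap ∘ₗ
    LinearMap.codRestrict (LinearMap.range G.eval₂)
      (LinearMap.lcomp ℂ ℂ G.T₂.toLinearMap ∘ₗ G.eval₂) G.eval₂_T₂_mem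

lemma eval₂_dualT₁ (s : G.Dual ⊗[ℂ] G.Dual) (z : A ⊗[ℂ] A) :
    G.eval₂ (G.dualT₁ s) z = G.eval₂ s (G.T₂ z) := by
  have := LinearEquiv.apply_symm_apply (LinearEquiv.ofInjective G.eval₂ G.eval₂_injective)
    (LinearMap.codRestrict (LinearMap.range G.eval₂)
      (LinearMap.lcomp ℂ ℂ G.T₂.toLinearMap ∘ₗ G.eval₂) G.eval₂_T₂_mem s)
  exact congrArg (fun f => f.1 z) this

lemma dualT₁_T₃ (t : A ⊗[ℂ] A) : G.dualT₁ (TensorProduct.map G.toDual G.toDual (G.T₃ t)) =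
    TensorProduct.map G.toDual G.toDual (TensorProduct.comm ℂ A A t) := by
  apply G.eval₂_injective
  rw [← eval₂_T₂]
  ext1
  ext x y
  exact G.eval₂_dualT₁ _ _

/-! ### The Heisenberg algebra -/

/-- Left multiplication by `a ∈ A` on the Heisenberg algebra `A ⊗ B`:
`a (a' ⊗ b') = a a' ⊗ b'`. -/
def heisLeftA : A →ₗ[ℂ] Module.End ℂ (A ⊗[ℂ] G.Dual) :=
  LinearMap.rTensorHom G.Dual ∘ₗ LinearMap.mul ℂ A

/-- Left multiplication by `b ∈ B` on the Heisenberg algebra `A ⊗ B`: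
`b (a' ⊗ b') = ∑ ⟨a'₍₂₎, b₍₁₎⟩ a'₍₁₎ ⊗ b₍₂₎ b' = ∑ (b₍₁₎ ▷ a') ⊗ b₍₂₎ b'`. -/
def heisLeftB : G.Dual →ₗ[ℂ] Module.End ℂ (A ⊗[ℂ] G.Dual) where
  toFun b := TensorProduct.lift
    ((LinearMap.rTensorHom G.Dual ∘ₗ G.act.flip).compl₂ (G.dualT₁ ∘ₗ TensorProduct.mk ℂ _ _ b))
  map_add' b c := by
    apply TensorProduct.ext'; intro x y
    simp
  map_smul' r b := by
    apply TensorProduct.ext'; intro x y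
    simp

@[simp] lemma heisLeftA_tmul (a a' : A) (b' : G.Dual) :
    G.heisLeftA a (a' ⊗ₜ b') = (a * a') ⊗ₜ b' := rfl

lemma heisLeftB_tmul (b : G.Dual) (a' : A) (b' : G.Dual) :
    G.heisLeftB b (a' ⊗ₜ b') = (G.act.flip a').rTensor G.Dual (G.dualT₁ (b ⊗ₜ b')) := rfl

/-- The product of the Heisenberg algebra,
`(a ⊗ b)(a' ⊗ b') = ∑ ⟨a'₍₂₎, b₍₁₎⟩ a a'₍₁₎ ⊗ b₍₂₎ b'`, written as `(a ⊗ b) h = a (b h)`. -/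
def heisMul : A ⊗[ℂ] G.Dual →ₗ[ℂ] Module.End ℂ (A ⊗[ℂ] G.Dual) :=
  TensorProduct.lift
    ((LinearMap.mul ℂ (Module.End ℂ (A ⊗[ℂ] G.Dual))).compl₁₂ G.heisLeftA G.heisLeftB)

lemma heisMul_tmul (a : A) (b : G.Dual) (h : A ⊗[ℂ] G.Dual) :
    G.heisMul (a ⊗ₜ b) h = G.heisLeftA a (G.heisLeftB b h) := rfl

/-- The action of the Heisenberg algebra on `A`: `(a ⊗ b) ▷ x = a (b ▷ x)`. -/
def heisAct : A ⊗[ℂ] G.Dual →ₗ[ℂ] Module.End ℂ A :=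
  TensorProduct.lift
    ((LinearMap.mul ℂ (Module.End ℂ A)).compl₁₂ (LinearMap.mul ℂ A) G.act)

lemma heisAct_tmul (a : A) (b : G.Dual) (x : A) :
    G.heisAct (a ⊗ₜ b) x = a * G.act b x := rfl

lemma heisAct_mul_right (h : A ⊗[ℂ] G.Dual) : ∃ E : A ⊗[ℂ] A →ₗ[ℂ] A,
    (∀ x y, G.heisAct h x * y = E (G.T₃ (x ⊗ₜ y))) ∧
    (∀ u v, E (u ⊗ₜ v) = TensorProduct.rid ℂ A ((G.eval.flip v).lTensor A h) * u) := by
  induction h with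
  | zero => exact ⟨0, by simp, by simp⟩
  | add h k hh hk =>
    obtain ⟨E, h1, h2⟩ := hh
    obtain ⟨F, k1, k2⟩ := hk
    exact ⟨E + F, by simp [add_mul, h1, k1], by simp [add_mul, h2, k2]⟩
  | tmul a b =>
    refine ⟨LinearMap.mulLeft ℂ a ∘ₗ (TensorProduct.rid ℂ A).toLinearMap ∘ₗ
      (G.eval b).lTensor A, fun x y => ?_, fun u v => ?_⟩
    · rw [heisAct_tmul, mul_assoc, act_mul_right]; rfl
    · simp [smul_mul_assoc]

lemma heisAct_injective : Function.Injective G.heisAct := by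
  rw [injective_iff_map_eq_zero]
  intro h hh
  obtain ⟨E, h1, h2⟩ := G.heisAct_mul_right h
  have hE : E = 0 := by
    have : E ∘ₗ G.T₃.toLinearMap = 0 := by
      apply TensorProduct.ext'
      intro x y
      rw [LinearMap.comp_apply, LinearEquiv.coe_coe, ← h1, hh]; simp
    apply LinearMap.ext
    intro s
    obtain ⟨t, rfl⟩ := G.T₃.surjective s
    exact congrArg (fun f => f t) this
  apply lTensor_jointly_injective (fun a : A => G.eval.flip a)
    (fun b hb => G.eval_injective (by ext a; simpa using hb a))
  intro v
  apply (TensorProduct.rid ℂ A).injective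
  rw [map_zero]
  apply G.nondegenerate.1
  intro u
  rw [← h2, hE]; simp

lemma heisAct_heisLeftA (a : A) (h : A ⊗[ℂ] G.Dual) (x : A) :
    G.heisAct (G.heisLeftA a h) x = a * G.heisAct h x := by
  induction h with
  | zero => simp
  | add h k hh hk => simp only [map_add, LinearMap.add_apply, mul_add, hh, hk]
  | tmul a' b => rw [heisLeftA_tmul, heisAct_tmul, heisAct_tmul, mul_assoc]

/-- `b ▷ (a' (b' ▷ x)) = ∑ (b₍₁₎ ▷ a') (b₍₂₎ b' ▷ x)`. -/
lemma act_mul_act (b b' : G.Dual) (a' x : A) :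
    G.heisAct ((G.act.flip a').rTensor G.Dual (G.dualT₁ (b ⊗ₜ b'))) x =
      G.act b (a' * G.act b' x) := by
  obtain ⟨c, rfl⟩ := G.toDual_surjective b
  obtain ⟨d, rfl⟩ := G.toDual_surjective b'
  rw [act_toDual, act_toDual', T₁_mul, ← iter_tmul, ← TensorProduct.map_tmul]
  obtain ⟨t, ht⟩ := G.T₃.surjective (c ⊗ₜ d)
  rw [← ht, iter_T₃, dualT₁_T₃]
  clear ht
  induction t with
  | zero => simp
  | add u v hu hv => simp only [map_add, LinearMap.add_apply, hu, hv]
  | tmul p q =>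
    simp only [TensorProduct.comm_tmul, TensorProduct.map_tmul, LinearMap.rTensor_tmul,
      LinearMap.flip_apply]
    rw [heisAct_tmul, act_toDual, act_toDual', ← T₁_mulRight, ← slice_mul]

lemma heisAct_heisMul (h k : A ⊗[ℂ] G.Dual) (x : A) :
    G.heisAct (G.heisMul h k) x = G.heisAct h (G.heisAct k x) := by
  induction h with
  | zero => simp
  | add h h' hh hk => simp only [map_add, LinearMap.add_apply, hh, hk]
  | tmul a b =>
    rw [heisMul_tmul, heisAct_heisLeftA, heisAct_tmul]
    congr 1
    induction k with
    | zero => simp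
    | add h k hh hk => simp only [map_add, LinearMap.add_apply, hh, hk]
    | tmul a' b' => rw [heisLeftB_tmul, act_mul_act, heisAct_tmul]

lemma heisMul_assoc (h k l : A ⊗[ℂ] G.Dual) :
    G.heisMul (G.heisMul h k) l = G.heisMul h (G.heisMul k l) := by
  apply G.heisAct_injective; ext x; simp [heisAct_heisMul]

/-- The Heisenberg algebra `AB`: the space `A ⊗ B` with the product `heisMul`. -/
def Heisenberg : Type _ := A ⊗[ℂ] G.Dual

instance : AddCommGroup G.Heisenberg := inferInstanceAs (AddCommGroup (A ⊗[ℂ] G.Dual))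

instance : Module ℂ G.Heisenberg := inferInstanceAs (Module ℂ (A ⊗[ℂ] G.Dual))

instance : Mul G.Heisenberg := ⟨fun h k => G.heisMul h k⟩

instance : NonUnitalRing G.Heisenberg where
  left_distrib h k l := map_add (G.heisMul h) k l
  right_distrib h k l := LinearMap.map_add₂ G.heisMul h k l
  zero_mul h := LinearMap.map_zero₂ G.heisMul h
  mul_zero h := map_zero (G.heisMul h)
  mul_assoc := G.heisMul_assoc

instance : IsScalarTower ℂ G.Heisenberg G.Heisenberg :=
  ⟨fun r h k => LinearMap.map_smul₂ G.heisMul r h k⟩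

instance : SMulCommClass ℂ G.Heisenberg G.Heisenberg :=
  ⟨fun r h k => (map_smul (G.heisMul h) r k).symm⟩

/-- The embedding `j_A` of `A` in the multiplier algebra of `AB`, as left multiplications. -/
def jA : A →ₗ[ℂ] Module.End ℂ G.Heisenberg := G.heisLeftA

/-- The embedding `j_B` of `B` in the multiplier algebra of `AB`, as left multiplications. -/
def jB : G.Dual →ₗ[ℂ] Module.End ℂ G.Heisenberg := G.heisLeftB

/-! ### The duality `V` -/

/-- The left action of `A` on `B`: `⟨a', a ▷ b⟩ = ⟨a' a, b⟩`. -/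
def actDual : A →ₗ[ℂ] Module.End ℂ G.Dual where
  toFun a :=
    { toFun := fun b => ⟨G.eval b ∘ₗ LinearMap.mulRight ℂ a, by
        obtain ⟨c, rfl⟩ := G.toDual_surjective b
        exact ⟨a * c, by ext x; simp [mul_assoc]⟩⟩
      map_add' := fun b b' => by apply G.eval_injective; ext x; rfl
      map_smul' := fun r b => by apply G.eval_injective; ext x; rfl }
  map_add' a a' := by
    ext b; apply G.eval_injective; ext x
    change G.eval b (x * (a + a')) = G.eval b (x * a) + G.eval b (x * a')
    rw [mul_add, map_add]
  map_smul' r a := by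
    ext b; apply G.eval_injective; ext x
    change G.eval b (x * (r • a)) = r • G.eval b (x * a)
    rw [mul_smul_comm, map_smul]

lemma eval_actDual (a a' : A) (b : G.Dual) : G.eval (G.actDual a b) a' = G.eval b (a' * a) := rfl

/-- The functional `a ⊗ b ↦ ⟨a, b⟩` on `A ⊗ B`. -/
def pairing : Module.Dual ℂ (A ⊗[ℂ] G.Dual) := TensorProduct.lift G.eval.flip

/-- The tensor product pairing of `B ⊗ A` with `A ⊗ B`: `⟨b ⊗ a, a' ⊗ b'⟩ = ⟨a', b⟩ ⟨a, b'⟩`. -/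
def pairing₂ : G.Dual ⊗[ℂ] A →ₗ[ℂ] Module.Dual ℂ (A ⊗[ℂ] G.Dual) :=
  TensorProduct.dualDistrib ℂ A G.Dual ∘ₗ TensorProduct.map G.eval G.eval.flip

/-- The left action of `B ⊗ A` on `A ⊗ B`: `(b ⊗ a) ▷ (a' ⊗ b') = (b ▷ a') ⊗ (a ▷ b')`. It
satisfies `⟨c', c ▷ d⟩ = ⟨c' c, d⟩` for `c, c' ∈ B ⊗ A` and `d ∈ A ⊗ B`. -/
def actPairing : G.Dual ⊗[ℂ] A →ₗ[ℂ] Module.End ℂ (A ⊗[ℂ] G.Dual) :=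
  TensorProduct.homTensorHomMap (RingHom.id ℂ) A G.Dual A G.Dual ∘ₗ TensorProduct.map G.act G.actDual

lemma pairing₂_actPairing (c' c : G.Dual ⊗[ℂ] A) (d : A ⊗[ℂ] G.Dual) :
    G.pairing₂ c' (G.actPairing c d) = G.pairing₂ (c' * c) d := by
  induction c' with
  | zero => simp
  | add x y hx hy => simp only [map_add, LinearMap.add_apply, add_mul, hx, hy]
  | tmul b' a' =>
    induction c with
    | zero => simp
    | add x y hx hy => simp only [map_add, LinearMap.add_apply, mul_add, hx, hy]
    | tmul b a =>
      induction d with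
      | zero => simp
      | add x y hx hy => simp only [map_add, hx, hy]
      | tmul x y => rw [Algebra.TensorProduct.tmul_mul_tmul]; rfl

/-- `f` is the functional `⟨m, · ⟩` on `A ⊗ B` given by the extension to `M(B ⊗ A) × (A ⊗ B)` of
the pairing of `B ⊗ A` with `A ⊗ B`. As the action of `B ⊗ A` on `A ⊗ B` is unital, the
extension is determined by `⟨m, c ▷ d⟩ = ⟨m c, d⟩`. -/
def IsExtendedPairing (m : Multiplier (G.Dual ⊗[ℂ] A)) (f : Module.Dual ℂ (A ⊗[ℂ] G.Dual)) :
    Prop :=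
  ∀ c d, f (G.actPairing c d) = G.pairing₂ (m.lmul c) d

/-- `V` is the duality: `⟨V, a ⊗ b⟩ = ⟨a, b⟩` for all `a ∈ A` and `b ∈ B`. -/
def IsDuality (V : Multiplier (G.Dual ⊗[ℂ] A)) : Prop := G.IsExtendedPairing V G.pairing

/-! ### The actions of `B ⊗ A` -/

/-- The action of `B ⊗ A` on `A ⊗ A`: `(b ⊗ a) ▷ (x ⊗ x') = (b ▷ x) ⊗ a x'`. -/
def actTensor : G.Dual ⊗[ℂ] A →ₗ[ℂ] Module.End ℂ (A ⊗[ℂ] A) :=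
  TensorProduct.homTensorHomMap (RingHom.id ℂ) A A A A ∘ₗ TensorProduct.map G.act (LinearMap.mul ℂ A)

/-- Left multiplication by `b ⊗ j_A(a) ⊗ 1` on `B ⊗ AB ⊗ A`. -/
def leg₁₂ : G.Dual ⊗[ℂ] A →ₗ[ℂ] Module.End ℂ (G.Dual ⊗[ℂ] (G.Heisenberg ⊗[ℂ] A)) :=
  TensorProduct.homTensorHomMap (RingHom.id ℂ) G.Dual (G.Heisenberg ⊗[ℂ] A) G.Dual (G.Heisenberg ⊗[ℂ] A) ∘ₗ
    TensorProduct.map (LinearMap.mul ℂ G.Dual) (LinearMap.rTensorHom A ∘ₗ G.jA)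

/-- Left multiplication by `b ⊗ 1 ⊗ a` on `B ⊗ AB ⊗ A`. -/
def leg₁₃ : G.Dual ⊗[ℂ] A →ₗ[ℂ] Module.End ℂ (G.Dual ⊗[ℂ] (G.Heisenberg ⊗[ℂ] A)) :=
  TensorProduct.homTensorHomMap (RingHom.id ℂ) G.Dual (G.Heisenberg ⊗[ℂ] A) G.Dual (G.Heisenberg ⊗[ℂ] A) ∘ₗ
    TensorProduct.map (LinearMap.mul ℂ G.Dual)
      (LinearMap.lTensorHom G.Heisenberg ∘ₗ LinearMap.mul ℂ A)

/-- Left multiplication by `1 ⊗ j_B(b) ⊗ a` on `B ⊗ AB ⊗ A`. -/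
def leg₂₃ : G.Dual ⊗[ℂ] A →ₗ[ℂ] Module.End ℂ (G.Dual ⊗[ℂ] (G.Heisenberg ⊗[ℂ] A)) :=
  LinearMap.lTensorHom G.Dual ∘ₗ
    TensorProduct.homTensorHomMap (RingHom.id ℂ) G.Heisenberg A G.Heisenberg A ∘ₗ
      TensorProduct.map G.jB (LinearMap.mul ℂ A)

end AlgebraicQuantumGroup

section Extensions

variable {C X D : Type*} [NonUnitalRing C] [Module ℂ C] [IsScalarTower ℂ C C] [SMulCommClass ℂ C C]
  [AddCommGroup X] [Module ℂ X]
  [NonUnitalRing D] [Module ℂ D] [IsScalarTower ℂ D D] [SMulCommClass ℂ D D]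

/-- `σ` is an extension of the action `ρ` of `C` on `X` to a unital action of `M(C)`. -/
def ExtendsAction (ρ : C →ₗ[ℂ] Module.End ℂ X) (σ : Multiplier C →ₐ[ℂ] Module.End ℂ X) : Prop :=
  ∀ c, σ (.of c) = ρ c

/-- `θ : M(C) → M(D)` is a unital homomorphism extending the homomorphism `C → M(D)` for which
`c ∈ C` is sent to the multiplier of `D` whose left multiplication is `ρ c`. -/
def ExtendsHom (ρ : C →ₗ[ℂ] Module.End ℂ D) (θ : Multiplier C →ₐ[ℂ] Multiplier D) : Prop :=
  ∀ c, (θ (.of c)).lmul = ρ c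

end Extensions

end

noncomputable section

set_option linter.unusedSectionVars false

/-! ## Slice maps and one-leg multiplications -/

section Slices

variable {X Y X' Y' : Type*} [AddCommGroup X] [Module ℂ X] [AddCommGroup Y] [Module ℂ Y]
  [AddCommGroup X'] [Module ℂ X'] [AddCommGroup Y'] [Module ℂ Y']

/-! The pentagon equation is reduced to an identity between endomorphisms of `A ⊗ A ⊗ A`. The
algebra `B ⊗ AB ⊗ A` acts there faithfully (`legsRep_injective`): `B` by `▷` on the first leg, `AB`
by its standard representation on the second, `A` by left multiplication on the third. Each leg of
`V` acts as the canonical map `T` on the corresponding two factors (`legsRep_lmul₁₂`,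
`legsRep_lmul₁₃`, `legsRep_lmul₂₃`), because `V` itself acts as `T` on `A ⊗ A`
(`actTensor_duality`). What remains is `T_pentagon`: both sides send `x ⊗ y ⊗ z` to `(ι ⊗ Δ)(Δ(x))
(1 ⊗ Δ(y)(1 ⊗ z))`, one by coassociativity, the other by multiplicativity of `Δ`.

The multiplier `V` is explicit. Left multiplication by it sends `φ( · c) ⊗ a` to `∑ φ( · p) ⊗ q`,
where `∑ p ⊗ q` is the preimage of `a ⊗ c` under `T₃`. That it acts as `T` is `iter_T₃` (see
`actL_dualityL`), and applying the counit to the first leg, with `ε(b ▷ z) = ⟨z, b⟩`, gives the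
defining pairing. Right multiplication has the mirror formula in terms of functionals `ψ(s · )`,
with `ψ` the right integral.

The effort lies in making this legitimate. The map `c ↦ φ( · c)` has to be injective and `B` has to
separate `A`, which is faithfulness of `φ` (`eq_zero_of_φ_mul`). Moreover the functionals `φ(a · )`,
`φ( · a)`, `ψ(a · )` must form one and the same space (`exists_right_of_left`,
`exists_left_of_right`, `exists_φ_mul_eq_of_ψ`). To get there the counit and the antipode are
extracted from the integral: with `Q(a ⊗ c) = (ι ⊗ φ)(Δ(a)(1 ⊗ c))` and `P(a ⊗ c) = (ι ⊗ φ)((1 ⊗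
a)Δ(c))`, one has `ε(Q(a ⊗ c)) = φ(ac)` and `S ∘ Q = P`. Then `ψ = φ ∘ S` is a right integral, and
strong invariance on both sides compares the functionals. Below, `Q` and `P` stand for `sliceT₁` and
`sliceT₄`.

Existence and uniqueness of the extensions to multiplier algebras is a general fact about
non-degenerate homomorphisms (`IsNondegenerateHom.existsUnique_extendsHom`), which applies to the
legs because the embeddings of `A` and `B` in `M(AB)` are non-degenerate. -/

/-- The slice map `ι ⊗ f`. -/
def sliceR (f : Module.Dual ℂ Y) : X ⊗[ℂ] Y →ₗ[ℂ] X :=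
  (TensorProduct.rid ℂ X).toLinearMap ∘ₗ f.lTensor X

/-- The slice map `f ⊗ ι`. -/
def sliceL (f : Module.Dual ℂ X) : X ⊗[ℂ] Y →ₗ[ℂ] Y :=
  (TensorProduct.lid ℂ Y).toLinearMap ∘ₗ f.rTensor Y

@[simp] lemma sliceR_tmul (f : Module.Dual ℂ Y) (x : X) (y : Y) :
    sliceR f (x ⊗ₜ y) = f y • x := by simp [sliceR]

@[simp] lemma sliceL_tmul (f : Module.Dual ℂ X) (x : X) (y : Y) :
    sliceL f (x ⊗ₜ y) = f x • y := by simp [sliceL]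

lemma sliceR_lTensor (f : Module.Dual ℂ Y') (g : Y →ₗ[ℂ] Y') (t : X ⊗[ℂ] Y) :
    sliceR f (g.lTensor X t) = sliceR (f ∘ₗ g) t := by
  induction t with
  | zero => simp
  | add x y hx hy => simp only [map_add, hx, hy]
  | tmul x y => simp

lemma sliceL_rTensor (f : Module.Dual ℂ X') (g : X →ₗ[ℂ] X') (t : X ⊗[ℂ] Y) :
    sliceL f (g.rTensor Y t) = sliceL (f ∘ₗ g) t := by
  induction t with
  | zero => simp
  | add x y hx hy => simp only [map_add, hx, hy]
  | tmul x y => simp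

lemma sliceR_rTensor (f : Module.Dual ℂ Y) (g : X →ₗ[ℂ] X') (t : X ⊗[ℂ] Y) :
    sliceR f (g.rTensor Y t) = g (sliceR f t) := by
  induction t with
  | zero => simp
  | add x y hx hy => simp only [map_add, hx, hy]
  | tmul x y => simp

lemma sliceL_lTensor (f : Module.Dual ℂ X) (g : Y →ₗ[ℂ] Y') (t : X ⊗[ℂ] Y) :
    sliceL f (g.lTensor X t) = g (sliceL f t) := by
  induction t with
  | zero => simp
  | add x y hx hy => simp only [map_add, hx, hy]
  | tmul x y => simp

lemma apply_sliceR (f : Module.Dual ℂ Y) (g : Module.Dual ℂ X) (t : X ⊗[ℂ] Y) :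
    g (sliceR f t) = f (sliceL g t) := by
  induction t with
  | zero => simp
  | add x y hx hy => simp only [map_add, hx, hy]
  | tmul x y => simp [mul_comm]

lemma exists_apply_ne_zero {f : Module.Dual ℂ Y} (hf : f ≠ 0) : ∃ y, f y ≠ 0 := by
  by_contra! h
  exact hf (LinearMap.ext h)

lemma sliceR_surjective {f : Module.Dual ℂ Y} (hf : f ≠ 0) :
    Function.Surjective (sliceR f : X ⊗[ℂ] Y →ₗ[ℂ] X) := by
  obtain ⟨y, hy⟩ := exists_apply_ne_zero hf
  exact fun x => ⟨(f y)⁻¹ • x ⊗ₜ y, by simp [hy]⟩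

lemma sliceL_surjective {f : Module.Dual ℂ X} (hf : f ≠ 0) :
    Function.Surjective (sliceL f : X ⊗[ℂ] Y →ₗ[ℂ] Y) := by
  obtain ⟨x, hx⟩ := exists_apply_ne_zero hf
  exact fun y => ⟨(f x)⁻¹ • x ⊗ₜ y, by simp [hx]⟩

/-- A linear map which vanishes on the kernel of a surjection factors through it. -/
lemma exists_comp_eq_of_ker_le {f : X →ₗ[ℂ] Y} (hf : Function.Surjective f) (h : X →ₗ[ℂ] X')
    (hk : ∀ x, f x = 0 → h x = 0) : ∃ k : Y →ₗ[ℂ] X', ∀ x, k (f x) = h x := by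
  obtain ⟨g, hg⟩ := f.exists_rightInverse_of_surjective (LinearMap.range_eq_top.2 hf)
  refine ⟨h ∘ₗ g, fun x => ?_⟩
  rw [LinearMap.comp_apply, ← sub_eq_zero, ← map_sub]
  apply hk
  rw [map_sub, sub_eq_zero]
  exact congrArg (fun k => k (f x)) hg

lemma tmul_right_cancel {y : Y} (hy : y ≠ 0) {x x' : X} (h : x ⊗ₜ[ℂ] y = x' ⊗ₜ y) : x = x' := by
  obtain ⟨f, hf⟩ : ∃ f : Module.Dual ℂ Y, f y ≠ 0 := by
    by_contra! h0
    exact hy ((Module.forall_dual_apply_eq_zero_iff ℂ y).1 h0)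
  have := congrArg (sliceR f) h
  simp only [sliceR_tmul] at this
  exact smul_right_injective X hf this

end Slices

section Legs

variable {A : Type*} [NonUnitalRing A] [Module ℂ A] [IsScalarTower ℂ A A] [SMulCommClass ℂ A A]

/-- Left multiplication by `c ⊗ 1`. -/
abbrev mulL₁ (c : A) : A ⊗[ℂ] A →ₗ[ℂ] A ⊗[ℂ] A := (LinearMap.mulLeft ℂ c).rTensor A

/-- Left multiplication by `1 ⊗ c`. -/
abbrev mulL₂ (c : A) : A ⊗[ℂ] A →ₗ[ℂ] A ⊗[ℂ] A := (LinearMap.mulLeft ℂ c).lTensor A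

/-- Right multiplication by `c ⊗ 1`. -/
abbrev mulR₁ (c : A) : A ⊗[ℂ] A →ₗ[ℂ] A ⊗[ℂ] A := (LinearMap.mulRight ℂ c).rTensor A

/-- Right multiplication by `1 ⊗ c`. -/
abbrev mulR₂ (c : A) : A ⊗[ℂ] A →ₗ[ℂ] A ⊗[ℂ] A := (LinearMap.mulRight ℂ c).lTensor A

lemma sliceR_mulL₁ (f : Module.Dual ℂ A) (c : A) (t : A ⊗[ℂ] A) :
    sliceR f (mulL₁ c t) = c * sliceR f t := sliceR_rTensor _ _ _

lemma sliceR_mulR₁ (f : Module.Dual ℂ A) (c : A) (t : A ⊗[ℂ] A) :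
    sliceR f (mulR₁ c t) = sliceR f t * c := sliceR_rTensor _ _ _

lemma sliceL_mulL₂ (f : Module.Dual ℂ A) (c : A) (t : A ⊗[ℂ] A) :
    sliceL f (mulL₂ c t) = c * sliceL f t := sliceL_lTensor _ _ _

lemma sliceL_mulR₂ (f : Module.Dual ℂ A) (c : A) (t : A ⊗[ℂ] A) :
    sliceL f (mulR₂ c t) = sliceL f t * c := sliceL_lTensor _ _ _

lemma mulL₁_mul (c : A) (t s : A ⊗[ℂ] A) : mulL₁ c (t * s) = mulL₁ c t * s := by
  induction s with
  | zero => simp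
  | add x y hx hy => simp only [map_add, mul_add, hx, hy]
  | tmul u v =>
    induction t with
    | zero => simp
    | add x y hx hy => simp only [map_add, add_mul, hx, hy]
    | tmul x y => simp [mul_assoc]

lemma mulL₂_mul (c : A) (t s : A ⊗[ℂ] A) : mulL₂ c (t * s) = mulL₂ c t * s := by
  induction s with
  | zero => simp
  | add x y hx hy => simp only [map_add, mul_add, hx, hy]
  | tmul u v =>
    induction t with
    | zero => simp
    | add x y hx hy => simp only [map_add, add_mul, hx, hy]
    | tmul x y => simp [mul_assoc]

lemma mulR₂_mul_eq (c : A) (t s : A ⊗[ℂ] A) : mulR₂ c t * s = t * mulL₂ c s := by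
  induction s with
  | zero => simp
  | add x y hx hy => simp only [map_add, mul_add, hx, hy]
  | tmul u v =>
    induction t with
    | zero => simp
    | add x y hx hy => simp only [map_add, add_mul, hx, hy]
    | tmul x y => simp [mul_assoc]

lemma mulR₁_mul_eq (c : A) (t s : A ⊗[ℂ] A) : mulR₁ c t * s = t * mulL₁ c s := by
  induction s with
  | zero => simp
  | add x y hx hy => simp only [map_add, mul_add, hx, hy]
  | tmul u v =>
    induction t with
    | zero => simp
    | add x y hx hy => simp only [map_add, add_mul, hx, hy]
    | tmul x y => simp [mul_assoc]

lemma mulL₁_mulL₂ (c d : A) (t : A ⊗[ℂ] A) : mulL₁ c (mulL₂ d t) = mulL₂ d (mulL₁ c t) := by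
  induction t with
  | zero => simp
  | add x y hx hy => simp only [map_add, hx, hy]
  | tmul x y => simp

end Legs

namespace AlgebraicQuantumGroup

variable {A : Type*} [NonUnitalRing A] [Module ℂ A] [IsScalarTower ℂ A A] [SMulCommClass ℂ A A]
variable (G : AlgebraicQuantumGroup A)

open Multiplier

/-! ### Cancellation from the non-degeneracy of the product -/

lemma mul_left_ext (G : AlgebraicQuantumGroup A) {a b : A} (h : ∀ c, c * a = c * b) : a = b := by
  rw [← sub_eq_zero]
  exact G.nondegenerate.2 _ fun c => by rw [mul_sub, h, sub_self]

lemma mul_right_ext (G : AlgebraicQuantumGroup A) {a b : A} (h : ∀ c, a * c = b * c) : a = b := by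
  rw [← sub_eq_zero]
  exact G.nondegenerate.1 _ fun c => by rw [sub_mul, h, sub_self]

lemma mul_right_ext₂ (G : AlgebraicQuantumGroup A) {s t : A ⊗[ℂ] A} (h : ∀ c, s * c = t * c) :
    s = t := by
  rw [← sub_eq_zero]
  exact G.nondegenerate₂.1 _ fun c => by rw [sub_mul, h, sub_self]

lemma mulL₁_ext (G : AlgebraicQuantumGroup A) {s t : A ⊗[ℂ] A} (h : ∀ c, mulL₁ c s = mulL₁ c t) :
    s = t := by
  rw [← sub_eq_zero]
  apply rTensor_jointly_injective (fun a : A => LinearMap.mulLeft ℂ a)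
    (fun x hx => G.nondegenerate.2 x hx)
  intro c
  rw [map_sub, sub_eq_zero]; exact h c

lemma mulR₂_ext (G : AlgebraicQuantumGroup A) {s t : A ⊗[ℂ] A} (h : ∀ c, mulR₂ c s = mulR₂ c t) :
    s = t := by
  rw [← sub_eq_zero]
  apply lTensor_jointly_injective (fun a : A => LinearMap.mulRight ℂ a)
    (fun x hx => G.nondegenerate.1 x hx)
  intro c
  rw [map_sub, sub_eq_zero]; exact h c

/-! ### Relations between the four canonical maps -/

/-- Multiplying by an arbitrary tensor on the right turns each canonical map into left
multiplication by a value of `Δ` with one extra factor. Relations between the four maps are checked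
in this form, and non-degeneracy of `A ⊗ A` then removes the tensor. -/
lemma T₁_mul_eq (a b : A) (t : A ⊗[ℂ] A) :
    G.T₁ (a ⊗ₜ b) * t = (G.Δ a).lmul (mulL₂ b t) := by
  have := congrArg (fun m => m.lmul t) (G.T₁_spec a b)
  simp only [lmul_mul, lmul_of, lmul_tmul] at this
  rw [← this]; rfl

lemma T₃_mul_eq (a b : A) (t : A ⊗[ℂ] A) :
    G.T₃ (a ⊗ₜ b) * t = (G.Δ a).lmul (mulL₁ b t) := by
  have := congrArg (fun m => m.lmul t) (G.T₃_spec a b)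
  simp only [lmul_mul, lmul_of, lmul_tmul] at this
  rw [← this]; rfl

lemma T₄_mul_eq (a b : A) (t : A ⊗[ℂ] A) :
    G.T₄ (a ⊗ₜ b) * t = mulL₂ a ((G.Δ b).lmul t) := by
  have := congrArg (fun m => m.lmul t) (G.T₄_spec a b)
  simp only [lmul_mul, lmul_of, lmul_tmul] at this
  rw [← this]; rfl

/-- `(a ⊗ 1)Δ(b) · (1 ⊗ c) = (a ⊗ 1) · Δ(b)(1 ⊗ c)`. -/
lemma mulR₂_T₂ (a b c : A) : mulR₂ c (G.T₂ (a ⊗ₜ b)) = mulL₁ a (G.T₁ (b ⊗ₜ c)) := G.T₂_T₁ a b c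

lemma mulR₁_T₂ (a b c : A) : mulR₁ c (G.T₂ (a ⊗ₜ b)) = mulL₁ a (G.T₃ (b ⊗ₜ c)) := by
  apply G.mul_right_ext₂
  intro t
  rw [mulR₁_mul_eq, T₂_mul, ← mulL₁_mul, T₃_mul_eq]

lemma mulR₂_T₄ (a b c : A) : mulR₂ c (G.T₄ (a ⊗ₜ b)) = mulL₂ a (G.T₁ (b ⊗ₜ c)) := by
  apply G.mul_right_ext₂
  intro t
  rw [mulR₂_mul_eq, T₄_mul_eq, ← mulL₂_mul, T₁_mul_eq]

lemma mulR₁_T₄ (a b c : A) : mulR₁ c (G.T₄ (a ⊗ₜ b)) = mulL₂ a (G.T₃ (b ⊗ₜ c)) := by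
  apply G.mul_right_ext₂
  intro t
  rw [mulR₁_mul_eq, T₄_mul_eq, ← mulL₂_mul, T₃_mul_eq]

lemma mulL₁_T₄ (a b c : A) : mulL₁ c (G.T₄ (a ⊗ₜ b)) = mulL₂ a (G.T₂ (c ⊗ₜ b)) := by
  apply G.mul_right_ext₂
  intro t
  rw [← mulL₁_mul, ← mulL₂_mul, T₄_mul_eq, T₂_mul, mulL₁_mulL₂]

lemma mulL₂_T₂ (a b c : A) : mulL₂ c (G.T₂ (a ⊗ₜ b)) = (G.Δ b).rmul (a ⊗ₜ c) := by
  apply G.mul_right_ext₂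
  intro t
  rw [← mulL₂_mul, T₂_mul, ← compat, mul_tensor_eq]

lemma mulL₁_T₄' (a b c : A) : mulL₁ c (G.T₄ (a ⊗ₜ b)) = (G.Δ b).rmul (c ⊗ₜ a) := by
  rw [mulL₁_T₄, mulL₂_T₂]

lemma T₂_mul_right (a b c : A) : G.T₂ (a ⊗ₜ (b * c)) = (G.Δ c).rmul (G.T₂ (a ⊗ₜ b)) := by
  apply G.mul_right_ext₂
  intro t
  rw [T₂_mul, ← compat, T₂_mul, map_mul, lmul_mul]

lemma T₄_mul_right (a b c : A) : G.T₄ (a ⊗ₜ (b * c)) = (G.Δ c).rmul (G.T₄ (a ⊗ₜ b)) := by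
  apply G.mul_right_ext₂
  intro t
  rw [T₄_mul_eq, ← compat, T₄_mul_eq, map_mul, lmul_mul]

lemma T₂_mul_T₃ (a b x y : A) :
    G.T₂ (a ⊗ₜ b) * G.T₃ (x ⊗ₜ y) = mulL₁ a (G.T₃ ((b * x) ⊗ₜ y)) := by
  rw [T₂_mul, ← T₃_mul]

/-! ### Coassociativity -/

/-- `v ↦ (z ⊗ 1 ⊗ 1)(Δ ⊗ ι)(v)`. -/
def comulL (z : A) : A ⊗[ℂ] A →ₗ[ℂ] A ⊗[ℂ] (A ⊗[ℂ] A) :=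
  (TensorProduct.assoc ℂ A A A).toLinearMap ∘ₗ G.T₂.toLinearMap.rTensor A ∘ₗ
    (TensorProduct.assoc ℂ A A A).symm.toLinearMap ∘ₗ TensorProduct.mk ℂ _ _ z

lemma comulL_tmul (z a b : A) :
    G.comulL z (a ⊗ₜ b) = TensorProduct.assoc ℂ A A A (G.T₂ (z ⊗ₜ a) ⊗ₜ b) := rfl

lemma assoc_tmul_eq (t : A ⊗[ℂ] A) (b : A) : TensorProduct.assoc ℂ A A A (t ⊗ₜ b) =
    ((TensorProduct.mk ℂ A A).flip b).lTensor A t := by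
  induction t with
  | zero => simp
  | add x y hx hy => simp only [TensorProduct.add_tmul, map_add, hx, hy]
  | tmul x y => simp

lemma comulL_tmul' (z a b : A) :
    G.comulL z (a ⊗ₜ b) = ((TensorProduct.mk ℂ A A).flip b).lTensor A (G.T₂ (z ⊗ₜ a)) := by
  rw [comulL_tmul, assoc_tmul_eq]

/-- The map `x ↦ T₁ (x ⊗ d)`. -/
def T₁at (d : A) : A →ₗ[ℂ] A ⊗[ℂ] A := G.T₁.toLinearMap ∘ₗ (TensorProduct.mk ℂ A A).flip d

/-- The map `x ↦ T₄ (a ⊗ x)`. -/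
def T₄at (a : A) : A →ₗ[ℂ] A ⊗[ℂ] A := G.T₄.toLinearMap ∘ₗ TensorProduct.mk ℂ A A a

/-- The map `x ↦ T₂ (a ⊗ x)`. -/
def T₂at (a : A) : A →ₗ[ℂ] A ⊗[ℂ] A := G.T₂.toLinearMap ∘ₗ TensorProduct.mk ℂ A A a

@[simp] lemma T₁at_apply (d x : A) : G.T₁at d x = G.T₁ (x ⊗ₜ d) := rfl
@[simp] lemma T₄at_apply (a x : A) : G.T₄at a x = G.T₄ (a ⊗ₜ x) := rfl
@[simp] lemma T₂at_apply (a x : A) : G.T₂at a x = G.T₂ (a ⊗ₜ x) := rfl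

/-- The axiom `coassoc` in the form used from here on: the right-hand side becomes a linear map
applied to the second leg of `(z ⊗ 1)Δ(c)`. -/
lemma comulL_T₁ (z c d : A) :
    G.comulL z (G.T₁ (c ⊗ₜ d)) = (G.T₁at d).lTensor A (G.T₂ (z ⊗ₜ c)) := by
  refine (G.coassoc z c d).trans ?_
  rw [assoc_tmul_eq, ← LinearMap.comp_apply, ← LinearMap.lTensor_comp]; rfl

lemma comulL_lTensor (z : A) (f : A →ₗ[ℂ] A) (v : A ⊗[ℂ] A) :
    G.comulL z (f.lTensor A v) = (f.lTensor A).lTensor A (G.comulL z v) := by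
  induction v with
  | zero => simp
  | add x y hx hy => simp only [map_add, hx, hy]
  | tmul a b =>
    rw [LinearMap.lTensor_tmul, comulL_tmul', comulL_tmul', ← LinearMap.comp_apply (LinearMap.lTensor A _),
      ← LinearMap.lTensor_comp]
    congr 2

/-- Multiplying the last leg on the right by `d` replaces `(1 ⊗ a)Δ(c)` by `(1 ⊗ a)(Δ(c)(1 ⊗ d))`,
which reduces the claim to `comulL_T₁`. -/
lemma comulL_T₄ (z a c : A) :
    G.comulL z (G.T₄ (a ⊗ₜ c)) = (G.T₄at a).lTensor A (G.T₂ (z ⊗ₜ c)) := by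
  rw [← sub_eq_zero]
  apply lTensor_jointly_injective (fun d : A => mulR₂ d)
    (fun x hx => G.mulR₂_ext (t := 0) fun c => by rw [hx, map_zero])
  intro d
  rw [map_sub, sub_eq_zero, ← comulL_lTensor, mulR₂_T₄, comulL_lTensor, comulL_T₁,
    ← LinearMap.comp_apply, ← LinearMap.comp_apply, ← LinearMap.lTensor_comp,
    ← LinearMap.lTensor_comp]
  congr 2
  ext x
  exact (G.mulR₂_T₄ a x d).symm

lemma T₂_sliceR (z : A) (f : Module.Dual ℂ A) (v : A ⊗[ℂ] A) :
    G.T₂ (z ⊗ₜ sliceR f v) = (sliceR f).lTensor A (G.comulL z v) := by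
  induction v with
  | zero => simp
  | add x y hx hy => simp only [map_add, TensorProduct.tmul_add, hx, hy]
  | tmul a b =>
    rw [comulL_tmul', ← LinearMap.comp_apply, ← LinearMap.lTensor_comp]
    have : sliceR f ∘ₗ (TensorProduct.mk ℂ A A).flip b = f b • LinearMap.id := by ext; simp
    rw [this]; simp

lemma comulL_sliceL (z : A) (f : Module.Dual ℂ A) (v : A ⊗[ℂ] A) :
    sliceL f (G.comulL z v) = (sliceL f ∘ₗ G.T₂at z).rTensor A v := by
  induction v with
  | zero => simp
  | add x y hx hy => simp only [map_add, hx, hy]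
  | tmul a b =>
    rw [comulL_tmul', sliceL_lTensor]; simp

/-! ### The slices `Q` and `P` of the canonical maps by the left integral -/

lemma slice_eq (t : A ⊗[ℂ] A) : G.slice t = sliceR G.φ t := rfl

/-- `a ⊗ c ↦ (ι ⊗ φ)(Δ(a)(1 ⊗ c))`. -/
def sliceT₁ : A ⊗[ℂ] A →ₗ[ℂ] A := G.slice ∘ₗ G.T₁.toLinearMap

/-- `a ⊗ c ↦ (ι ⊗ φ)((1 ⊗ a)Δ(c))`. -/
def sliceT₄ : A ⊗[ℂ] A →ₗ[ℂ] A := G.slice ∘ₗ G.T₄.toLinearMap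

lemma sliceT₁_tmul (a c : A) : G.sliceT₁ (a ⊗ₜ c) = sliceR G.φ (G.T₁ (a ⊗ₜ c)) := rfl

lemma sliceT₄_tmul (a c : A) : G.sliceT₄ (a ⊗ₜ c) = sliceR G.φ (G.T₄ (a ⊗ₜ c)) := rfl

lemma sliceT₁_surjective : Function.Surjective G.sliceT₁ :=
  (sliceR_surjective G.φ_ne_zero).comp G.T₁.surjective

lemma sliceT₄_surjective : Function.Surjective G.sliceT₄ :=
  (sliceR_surjective G.φ_ne_zero).comp G.T₄.surjective

/-- The map `x ↦ (ι ⊗ φ)((1 ⊗ a)Δ(x))`. -/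
def sliceT₄at (a : A) : A →ₗ[ℂ] A := G.sliceT₄ ∘ₗ TensorProduct.mk ℂ A A a

@[simp] lemma sliceT₄at_apply (a x : A) : G.sliceT₄at a x = G.sliceT₄ (a ⊗ₜ x) := rfl

lemma T₂_sliceT₄ (z a c : A) :
    G.T₂ (z ⊗ₜ G.sliceT₄ (a ⊗ₜ c)) = (G.sliceT₄at a).lTensor A (G.T₂ (z ⊗ₜ c)) := by
  rw [sliceT₄_tmul, T₂_sliceR, comulL_T₄, ← LinearMap.comp_apply, ← LinearMap.lTensor_comp]
  rfl

/-- `(f ⊗ ι)((z ⊗ 1)Δ(x))` has coproduct `(f ⊗ ι ⊗ ι)((z ⊗ 1 ⊗ 1)(ι ⊗ Δ)Δ(x))`. -/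
lemma T₁_sliceL (f : Module.Dual ℂ A) (z c d : A) :
    G.T₁ (sliceL f (G.T₂ (z ⊗ₜ c)) ⊗ₜ d) =
      (sliceL f ∘ₗ G.T₂at z).rTensor A (G.T₁ (c ⊗ₜ d)) := by
  rw [← comulL_sliceL, comulL_T₁, sliceL_lTensor]; rfl

lemma slice_T₂ (y x : A) : sliceR G.φ (G.T₂ (y ⊗ₜ x)) = G.φ x • y := by
  apply G.mul_right_ext
  intro w
  rw [← sliceR_mulR₁, mulR₁_T₂, sliceR_mulL₁, ← slice_eq, slice_T₃]
  simp [mul_smul_comm, smul_mul_assoc]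

/-- Covering the first leg by `y` makes visible that `Q(a ⊗ c)` depends on `c` only through the
functional `φ( · c)`; the proof that `φ` is faithful relies on this. -/
lemma mul_sliceT₁ (a c y : A) :
    y * G.sliceT₁ (a ⊗ₜ c) = sliceR (G.dualMap c) (G.T₂ (y ⊗ₜ a)) := by
  rw [sliceT₁_tmul, ← sliceR_mulL₁, ← mulR₂_T₂, sliceR_lTensor]; rfl

lemma sliceT₄_mul (a c y : A) :
    G.sliceT₄ (a ⊗ₜ c) * y = sliceR (G.φ ∘ₗ LinearMap.mulLeft ℂ a) (G.T₃ (c ⊗ₜ y)) := by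
  rw [sliceT₄_tmul, ← sliceR_mulR₁, mulR₁_T₄, sliceR_lTensor]

lemma mul_sliceT₄ (a c y : A) :
    y * G.sliceT₄ (a ⊗ₜ c) = sliceR (G.φ ∘ₗ LinearMap.mulLeft ℂ a) (G.T₂ (y ⊗ₜ c)) := by
  rw [sliceT₄_tmul, ← sliceR_mulL₁, mulL₁_T₄, sliceR_lTensor]

/-! ### The counit -/

/-- The map `x ↦ (ι ⊗ φ)(Δ(a)(1 ⊗ x))`. -/
def sliceT₁at (a : A) : A →ₗ[ℂ] A := G.sliceT₁ ∘ₗ TensorProduct.mk ℂ A A a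

@[simp] lemma sliceT₁at_apply (a x : A) : G.sliceT₁at a x = G.sliceT₁ (a ⊗ₜ x) := rfl

lemma T₁_sliceT₁ (a c y : A) (s : A ⊗[ℂ] A) (hs : G.T₃ s = y ⊗ₜ c) :
    G.T₁ (G.sliceT₁ (a ⊗ₜ c) ⊗ₜ y) = (G.sliceT₁at a).rTensor A s := by
  have := G.iter_T₃ a s
  rw [hs, iter_tmul] at this
  exact this

/-- This is `iter_T₃` read as a formula for the inverse of the canonical map. Since `Q` is onto it
describes the inverse completely; composing it with the multiplication yields the counit, and
composing it with `ε ⊗ ι` yields the antipode. -/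
lemma T₁_symm_sliceT₁ (a c y : A) : G.T₁.symm (G.sliceT₁ (a ⊗ₜ c) ⊗ₜ y) =
    (G.sliceT₁at a).rTensor A (TensorProduct.comm ℂ A A (G.T₃ (c ⊗ₜ y))) := by
  rw [LinearEquiv.symm_apply_eq]
  have : ∀ s : A ⊗[ℂ] A, G.T₁ ((G.sliceT₁at a).rTensor A (TensorProduct.comm ℂ A A s)) =
      G.iter a s := by
    intro s
    induction s with
    | zero => simp
    | add x y hx hy => simp only [map_add, hx, hy]
    | tmul x y => rfl
  rw [this, iter_T₃]; rfl

/-- With `Δ(c)(y ⊗ 1) = ∑ u ⊗ v` the left side is `∑ Q(a ⊗ v) u = (ι ⊗ φ)(Δ(ac)(y ⊗ 1))`, and left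
invariance applies. -/
lemma mul'_T₁_symm_sliceT₁ (a c y : A) :
    LinearMap.mul' ℂ A (G.T₁.symm (G.sliceT₁ (a ⊗ₜ c) ⊗ₜ y)) = G.φ (a * c) • y := by
  rw [T₁_symm_sliceT₁, ← slice_T₃, T₃_mul]
  generalize G.T₃ (c ⊗ₜ y) = s
  induction s with
  | zero => simp
  | add u v hx hy => simp only [map_add, hx, hy]
  | tmul u v =>
    rw [← T₁_mulRight, slice_eq, sliceR_mulR₁]; simp [sliceT₁_tmul]

lemma mul'_T₁_symm_sliceT₁' (t : A ⊗[ℂ] A) (y : A) :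
    LinearMap.mul' ℂ A (G.T₁.symm (G.sliceT₁ t ⊗ₜ y)) = G.φ (LinearMap.mul' ℂ A t) • y := by
  induction t with
  | zero => simp
  | add u v hx hy => simp only [map_add, TensorProduct.add_tmul, add_smul, hx, hy]
  | tmul a c => simpa using G.mul'_T₁_symm_sliceT₁ a c y

lemma exists_counit : ∃ ε : Module.Dual ℂ A, ∀ x y,
    LinearMap.mul' ℂ A (G.T₁.symm (x ⊗ₜ y)) = ε x • y := by
  obtain ⟨g, hg⟩ := G.sliceT₁.exists_rightInverse_of_surjective
    (LinearMap.range_eq_top.2 G.sliceT₁_surjective)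
  -- The formula `ε(Q(t)) = φ(m(t))` dictates this choice, made along a linear section `g` of `Q`.
  refine ⟨G.φ ∘ₗ LinearMap.mul' ℂ A ∘ₗ g, fun x y => ?_⟩
  have hx : G.sliceT₁ (g x) = x := congrArg (fun k => k x) hg
  conv_lhs => rw [← hx]
  exact G.mul'_T₁_symm_sliceT₁' _ _

/-- The counit. -/
def counit : Module.Dual ℂ A := G.exists_counit.choose

lemma mul'_T₁_symm (x y : A) :
    LinearMap.mul' ℂ A (G.T₁.symm (x ⊗ₜ y)) = G.counit x • y := G.exists_counit.choose_spec x y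

/-- `(ε ⊗ ι)(Δ(a)(1 ⊗ b)) = ab`. -/
lemma sliceL_counit_T₁ (t : A ⊗[ℂ] A) : sliceL G.counit (G.T₁ t) = LinearMap.mul' ℂ A t := by
  obtain ⟨s, rfl⟩ := G.T₁.symm.surjective t
  rw [LinearEquiv.apply_symm_apply]
  induction s with
  | zero => simp
  | add u v hx hy => simp only [map_add, hx, hy]
  | tmul a c => rw [mul'_T₁_symm, sliceL_tmul]

lemma sliceL_counit_T₄ (a c : A) : sliceL G.counit (G.T₄ (a ⊗ₜ c)) = a * c := by
  apply G.mul_right_ext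
  intro d
  rw [← sliceL_mulR₂, mulR₂_T₄, sliceL_mulL₂, sliceL_counit_T₁]; simp [mul_assoc]

lemma counit_sliceT₁ (a c : A) : G.counit (G.sliceT₁ (a ⊗ₜ c)) = G.φ (a * c) := by
  rw [sliceT₁_tmul, apply_sliceR, sliceL_counit_T₁]; simp

lemma counit_sliceT₄ (a c : A) : G.counit (G.sliceT₄ (a ⊗ₜ c)) = G.φ (a * c) := by
  rw [sliceT₄_tmul, apply_sliceR, sliceL_counit_T₄]

lemma exists_ne_zero (G : AlgebraicQuantumGroup A) : ∃ a : A, G.φ a ≠ 0 :=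
  exists_apply_ne_zero G.φ_ne_zero

/-- `(ι ⊗ ε)((z ⊗ 1)Δ(c)) = zc`. -/
lemma sliceR_counit_T₂ (z c : A) : sliceR G.counit (G.T₂ (z ⊗ₜ c)) = z * c := by
  -- The counit is applied to the middle leg of `(z ⊗ 1 ⊗ 1)(Δ ⊗ ι)(v)`. On `v = Δ(c)(1 ⊗ d)`
  -- coassociativity turns this into `ε ⊗ ι` on a value of `T₁`, which is already known, and such
  -- `v` span `A ⊗ A`.
  have key : ∀ v : A ⊗[ℂ] A, (sliceL G.counit).lTensor A (G.comulL z v) =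
      (sliceR G.counit ∘ₗ G.T₂at z).rTensor A v := by
    intro v
    induction v with
    | zero => simp
    | add x y hx hy => simp only [map_add, hx, hy]
    | tmul a b =>
      rw [comulL_tmul']
      simp only [LinearMap.rTensor_tmul, LinearMap.comp_apply, T₂at_apply]
      generalize G.T₂ (z ⊗ₜ a) = t
      induction t with
      | zero => simp
      | add x y hx hy => simp only [map_add, TensorProduct.add_tmul, hx, hy]
      | tmul x y => simp [TensorProduct.smul_tmul]
  have h2 : ∀ v : A ⊗[ℂ] A, (sliceR G.counit ∘ₗ G.T₂at z).rTensor A v = mulL₁ z v := by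
    intro v
    obtain ⟨w, rfl⟩ := G.T₁.surjective v
    induction w with
    | zero => simp
    | add x y hx hy => simp only [map_add, hx, hy]
    | tmul c d =>
      rw [← key, comulL_T₁, ← mulR₂_T₂, ← LinearMap.comp_apply, ← LinearMap.lTensor_comp]
      congr 2
      ext x
      simp [sliceL_counit_T₁]
  obtain ⟨a, ha⟩ := G.exists_ne_zero
  have ha' : a ≠ 0 := fun h => ha (by rw [h, map_zero])
  exact tmul_right_cancel ha' (h2 (c ⊗ₜ a))

lemma sliceR_counit_T₃ (t : A ⊗[ℂ] A) : sliceR G.counit (G.T₃ t) = LinearMap.mul' ℂ A t := by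
  induction t with
  | zero => simp
  | add x y hx hy => simp only [map_add, hx, hy]
  | tmul a y =>
    apply G.mul_left_ext
    intro z
    rw [← sliceR_mulL₁, ← mulR₁_T₂, sliceR_mulR₁, sliceR_counit_T₂]; simp [mul_assoc]

/-- If `b ⊗ y = T₁ s` then `Δ(p)(b ⊗ y)` is the image under `T₁` of `(p ⊗ 1)s`, and `ε ⊗ ι` composed
with `T₁` is the multiplication. Hence right multiplication by `b ⊗ 1` changes `ε ⊗ ι` by the scalar
`ε(b)`. -/
lemma counit_mul (a b : A) : G.counit (a * b) = G.counit a * G.counit b := by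
  have key : ∀ t : A ⊗[ℂ] A, sliceL G.counit (mulR₁ b t) = G.counit b • sliceL G.counit t := by
    intro t
    obtain ⟨w, rfl⟩ := G.T₁.surjective t
    induction w with
    | zero => simp
    | add x y hx hy => simp only [map_add, smul_add, hx, hy]
    | tmul p y =>
      obtain ⟨s, hs⟩ := G.T₁.surjective (b ⊗ₜ y)
      rw [T₁_mulRight, sliceL_counit_T₁, ← hs]
      have h1 : sliceL G.counit ((G.Δ p).lmul (G.T₁ s)) = p * sliceL G.counit (G.T₁ s) := by
        clear hs
        induction s with
        | zero => simp
        | add x y hx hy => simp only [map_add, mul_add, hx, hy]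
        | tmul x y => rw [← T₁_mul, sliceL_counit_T₁, sliceL_counit_T₁]; simp [mul_assoc]
      rw [h1, hs]
      simp [mul_smul_comm]
  obtain ⟨c, hc⟩ := G.exists_ne_zero
  have h := key (a ⊗ₜ c)
  simp only [LinearMap.rTensor_tmul, sliceL_tmul, LinearMap.mulRight_apply, smul_smul] at h
  have hc' : c ≠ 0 := fun h => hc (by rw [h, map_zero])
  rw [smul_left_injective ℂ hc' h, mul_comm]

/-! ### The antipode -/

/-- The identity `ε(Q(a ⊗ v)) = φ(av)` turns the inverse formula into the slice of `Δ(c)(y ⊗ 1)` by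
`φ(a · )`. As the left side sees `t` only through `Q(t)`, the map `P` vanishes on the kernel of `Q`,
so that `S ∘ Q = P` defines `S`. -/
lemma sliceL_counit_T₁_symm_sliceT₁ (t : A ⊗[ℂ] A) (y : A) :
    sliceL G.counit (G.T₁.symm (G.sliceT₁ t ⊗ₜ y)) = G.sliceT₄ t * y := by
  induction t with
  | zero => simp
  | add u v hx hy => simp only [map_add, TensorProduct.add_tmul, add_mul, hx, hy]
  | tmul a c =>
    rw [T₁_symm_sliceT₁, sliceT₄_mul]
    generalize G.T₃ (c ⊗ₜ y) = s
    induction s with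
    | zero => simp
    | add u v hx hy => simp only [map_add, hx, hy]
    | tmul u v => simp [counit_sliceT₁]

lemma exists_antipode : ∃ S : A →ₗ[ℂ] A, ∀ t, S (G.sliceT₁ t) = G.sliceT₄ t :=
  exists_comp_eq_of_ker_le G.sliceT₁_surjective _ fun t ht => by
    apply G.mul_right_ext
    intro y
    rw [← sliceL_counit_T₁_symm_sliceT₁, ht]; simp

/-- The antipode, characterized by strong left invariance. -/
def antipode : A →ₗ[ℂ] A := G.exists_antipode.choose

lemma antipode_sliceT₁ (t : A ⊗[ℂ] A) : G.antipode (G.sliceT₁ t) = G.sliceT₄ t :=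
  G.exists_antipode.choose_spec t

/-- The description of the antipode through the inverse canonical map, free of the integral. -/
lemma antipode_mul_eq (x y : A) :
    G.antipode x * y = sliceL G.counit (G.T₁.symm (x ⊗ₜ y)) := by
  obtain ⟨t, rfl⟩ := G.sliceT₁_surjective x
  rw [antipode_sliceT₁, sliceL_counit_T₁_symm_sliceT₁]

lemma antipode_surjective : Function.Surjective G.antipode := fun x => by
  obtain ⟨t, rfl⟩ := G.sliceT₄_surjective x
  exact ⟨_, G.antipode_sliceT₁ t⟩

/-- With `T₁ t = a ⊗ y`, the tensor `ab ⊗ y` is `T₁(t)(b ⊗ 1)`. For `t = p ⊗ q` its preimage under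
`T₁` is `(p ⊗ 1)w` with `T₁ w = b ⊗ q`, and multiplicativity of `ε` gives `ε(p) S(b) q`. -/
lemma antipode_mul (a b : A) : G.antipode (a * b) = G.antipode b * G.antipode a := by
  apply G.mul_right_ext
  intro y
  rw [mul_assoc, antipode_mul_eq, antipode_mul_eq G a]
  have key : ∀ t : A ⊗[ℂ] A, ∀ y, G.T₁ t = a ⊗ₜ y →
      sliceL G.counit (G.T₁.symm ((a * b) ⊗ₜ y)) = G.antipode b * sliceL G.counit t := by
    intro t y ht
    have h1 : (a * b) ⊗ₜ[ℂ] y = mulR₁ b (G.T₁ t) := by rw [ht]; simp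
    have h2 : ∀ s : A ⊗[ℂ] A, sliceL G.counit (G.T₁.symm (mulR₁ b (G.T₁ s))) =
        G.antipode b * sliceL G.counit s := by
      intro s
      induction s with
      | zero => simp
      | add u v hx hy => simp only [map_add, mul_add, hx, hy]
      | tmul p q =>
        rw [T₁_mulRight, sliceL_tmul, mul_smul_comm, antipode_mul_eq]
        obtain ⟨w, hw⟩ := G.T₁.surjective (b ⊗ₜ q)
        rw [← hw, LinearEquiv.symm_apply_apply]
        clear hw
        induction w with
        | zero => simp
        | add u v hx hy => simp only [map_add, smul_add, hx, hy]
        | tmul u v =>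
          rw [← T₁_mul, LinearEquiv.symm_apply_apply]
          simp [counit_mul, mul_smul]
    rw [h1, h2]
  exact key _ y (G.T₁.apply_symm_apply _)

/-- The mirror image of `T₁_symm_sliceT₁`: a formula for the inverse of `T₄` in terms of `P`. -/
lemma T₄_sliceT₄ (a c y : A) :
    G.T₄ ((G.sliceT₄ ∘ₗ (TensorProduct.mk ℂ A A).flip c).lTensor A (G.T₂ (y ⊗ₜ a))) =
      G.sliceT₄ (a ⊗ₜ c) ⊗ₜ y := by
  apply G.mulL₁_ext
  intro z
  -- both sides as a function of `(z ⊗ 1)Δ(c)`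
  let E : A ⊗[ℂ] A →ₗ[ℂ] A →ₗ[ℂ] A :=
    TensorProduct.lift (LinearMap.mk₂ ℂ (fun u v => LinearMap.mulLeft ℂ u ∘ₗ G.sliceT₄at v)
      (fun u u' v => by ext; simp [add_mul])
      (fun r u v => by ext; simp [smul_mul_assoc])
      (fun u v v' => by ext; simp [TensorProduct.add_tmul, mul_add])
      (fun r u v => by ext; simp [← TensorProduct.smul_tmul']))
  have hE : ∀ u v s, E (u ⊗ₜ v) s = u * G.sliceT₄ (v ⊗ₜ s) := fun u v s => rfl
  have hE' : ∀ t s, E t s = G.slice ((G.Δ s).rmul t) := by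
    intro t s
    induction t with
    | zero => simp
    | add u v hx hy => simp only [map_add, LinearMap.add_apply, hx, hy]
    | tmul u v => rw [hE, sliceT₄_tmul, ← sliceR_mulL₁, mulL₁_T₄']; rfl
  have h2 : ∀ t : A ⊗[ℂ] A,
      mulL₁ z (G.T₄ ((G.sliceT₄ ∘ₗ (TensorProduct.mk ℂ A A).flip c).lTensor A t)) =
      (E t).lTensor A (G.T₂ (z ⊗ₜ c)) := by
    intro t
    induction t with
    | zero => simp
    | add u v hx hy => simp only [map_add, LinearMap.lTensor_add, LinearMap.add_apply, hx, hy]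
    | tmul u v =>
      rw [LinearMap.lTensor_tmul, mulL₁_T₄]
      change mulL₂ u (G.T₂ (z ⊗ₜ G.sliceT₄ (v ⊗ₜ c))) = _
      rw [T₂_sliceT₄, ← LinearMap.comp_apply, ← LinearMap.lTensor_comp]
      congr 2
  -- Since `E t s = (ι ⊗ φ)(t Δ(s))`, taking `t = (y ⊗ 1)Δ(a)` produces `Δ(as)`, and left invariance
  -- collapses it to `φ(as) y`.
  have h3 : E (G.T₂ (y ⊗ₜ a)) = (LinearMap.toSpanSingleton ℂ A y) ∘ₗ G.φ ∘ₗ LinearMap.mulLeft ℂ a := by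
    ext s
    rw [hE', ← T₂_mul_right, slice_eq, slice_T₂]; simp
  rw [h2, h3, LinearMap.rTensor_tmul, LinearMap.mulLeft_apply, mul_sliceT₄]
  generalize G.T₂ (z ⊗ₜ c) = t
  induction t with
  | zero => simp
  | add u v hx hy => simp only [map_add, TensorProduct.add_tmul, hx, hy]
  | tmul u v => simp [TensorProduct.smul_tmul]

/-- This recovers `Q(t)` from `P(t)`, just as the inverse of `T₁` recovered `P(t)` from `Q(t)`.
Injectivity of the antipode follows. -/
lemma mul_sliceT₁_eq (t : A ⊗[ℂ] A) (y : A) :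
    y * G.sliceT₁ t = sliceR G.counit (G.T₄.symm (G.sliceT₄ t ⊗ₜ y)) := by
  induction t with
  | zero => simp
  | add u v hx hy => simp only [map_add, TensorProduct.add_tmul, mul_add, hx, hy]
  | tmul a c =>
    rw [← T₄_sliceT₄, LinearEquiv.symm_apply_apply, sliceR_lTensor, mul_sliceT₁]
    congr 1
    congr 1
    ext v
    simp [counit_sliceT₄]

lemma antipode_injective : Function.Injective G.antipode := by
  rw [injective_iff_map_eq_zero]
  intro x hx
  obtain ⟨t, rfl⟩ := G.sliceT₁_surjective x
  rw [antipode_sliceT₁] at hx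
  apply G.mul_left_ext
  intro y
  rw [mul_sliceT₁_eq, hx]; simp

/-- The antipode as a linear equivalence. -/
def antipodeEquiv : A ≃ₗ[ℂ] A :=
  LinearEquiv.ofBijective G.antipode ⟨G.antipode_injective, G.antipode_surjective⟩

@[simp] lemma antipodeEquiv_symm_antipode (x : A) : G.antipodeEquiv.symm (G.antipode x) = x :=
  G.antipodeEquiv.symm_apply_apply x

/-- `m(ι ⊗ S)((z ⊗ 1)Δ(x)) = ε(x) z`. -/
lemma mul'_antipode_T₂ (z x : A) :
    LinearMap.mul' ℂ A (G.antipode.lTensor A (G.T₂ (z ⊗ₜ x))) = G.counit x • z := by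
  -- `Λ` is `x ⊗ y ↦ S(x)y`. Applying `m(ι ⊗ Λ)` to `(z ⊗ 1 ⊗ 1)(Δ ⊗ ι)(v)` directly gives the
  -- wanted expression; after coassociativity `Λ` meets `T₁` and cancels it, leaving only counits.
  let Λ : A ⊗[ℂ] A →ₗ[ℂ] A := sliceL G.counit ∘ₗ G.T₁.symm.toLinearMap
  have hΛ : ∀ x y, Λ (x ⊗ₜ y) = G.antipode x * y := fun x y => (G.antipode_mul_eq x y).symm
  have h1 : ∀ v : A ⊗[ℂ] A, LinearMap.mul' ℂ A (Λ.lTensor A (G.comulL z v)) =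
      LinearMap.mul' ℂ A ((LinearMap.mul' ℂ A ∘ₗ G.antipode.lTensor A ∘ₗ G.T₂at z).rTensor A v) := by
    intro v
    induction v with
    | zero => simp
    | add u v hx hy => simp only [map_add, hx, hy]
    | tmul a b =>
      rw [comulL_tmul']
      simp only [LinearMap.rTensor_tmul, LinearMap.comp_apply, T₂at_apply]
      generalize G.T₂ (z ⊗ₜ a) = t
      induction t with
      | zero => simp
      | add x y hx hy => simp only [map_add, TensorProduct.add_tmul, hx, hy]
      | tmul x y => simp [hΛ, mul_assoc]
  have h2 : ∀ w : A ⊗[ℂ] A, LinearMap.mul' ℂ A (Λ.lTensor A (G.comulL z (G.T₁ w))) =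
      z * sliceL G.counit (G.T₁ w) := by
    intro w
    induction w with
    | zero => simp
    | add u v hx hy => simp only [map_add, mul_add, hx, hy]
    | tmul e f =>
      have : Λ ∘ₗ G.T₁at f = LinearMap.toSpanSingleton ℂ A f ∘ₗ G.counit := by
        ext v; simp [Λ]
      rw [comulL_T₁, ← LinearMap.comp_apply (LinearMap.lTensor A _), ← LinearMap.lTensor_comp, this,
        sliceL_counit_T₁, LinearMap.mul'_apply, ← mul_assoc, ← G.sliceR_counit_T₂ z e]
      generalize G.T₂ (z ⊗ₜ e) = t
      induction t with
      | zero => simp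
      | add x y hx hy => simp only [map_add, add_mul, hx, hy]
      | tmul x y => simp [smul_mul_assoc]
  apply G.mul_right_ext
  intro y
  obtain ⟨w, hw⟩ := G.T₁.surjective (x ⊗ₜ y)
  have h3 := h2 w
  rw [hw, h1] at h3
  simpa [mul_smul_comm, smul_mul_assoc] using h3

lemma mul'_antipode_T₂' (w : A ⊗[ℂ] A) :
    LinearMap.mul' ℂ A (G.antipode.lTensor A (G.T₂ w)) = sliceR G.counit w := by
  induction w with
  | zero => simp
  | add x y hx hy => simp only [map_add, hx, hy]
  | tmul z x => rw [mul'_antipode_T₂, sliceR_tmul]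

/-! ### The right integral -/

/-- The right integral `φ ∘ S`. -/
def ψ : Module.Dual ℂ A := G.φ ∘ₗ G.antipode

lemma ψ_apply (x : A) : G.ψ x = G.φ (G.antipode x) := rfl

lemma ψ_ne_zero : G.ψ ≠ 0 := by
  obtain ⟨a, ha⟩ := G.exists_ne_zero
  obtain ⟨b, rfl⟩ := G.antipode_surjective a
  intro h
  exact ha (congrArg (fun f => f b) h)

/-- `φ ∘ P(a ⊗ · )` is left invariant. -/
lemma sliceR_φ_sliceT₄ (a : A) (t : A ⊗[ℂ] A) :
    sliceR (G.φ ∘ₗ G.sliceT₄at a) (G.T₃ t) = sliceL (G.φ ∘ₗ G.sliceT₄at a) t := by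
  have h1 : ∀ z p, sliceR (G.φ ∘ₗ G.sliceT₄at a) (G.T₂ (z ⊗ₜ p)) =
      G.φ (G.sliceT₄ (a ⊗ₜ p)) • z := by
    intro z p
    rw [← sliceR_lTensor, ← T₂_sliceT₄, slice_T₂]
  induction t with
  | zero => simp
  | add x y hx hy => simp only [map_add, hx, hy]
  | tmul p q =>
    apply G.mul_left_ext
    intro z
    rw [← sliceR_mulL₁, ← mulR₁_T₂, sliceR_mulR₁, h1]
    simp [smul_mul_assoc, mul_smul_comm]

/-- For `x = Q(a ⊗ c)` the formula `T₁_sliceT₁` rewrites the left side as a slice by `ψ ∘ Q(a ⊗ ·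
)`, which is `φ ∘ P(a ⊗ · )`. Left invariance of the latter functional then gives right invariance
of `ψ`. -/
lemma sliceL_ψ_T₁ (x y : A) : sliceL G.ψ (G.T₁ (x ⊗ₜ y)) = G.ψ x • y := by
  obtain ⟨t, rfl⟩ := G.sliceT₁_surjective x
  induction t with
  | zero => simp
  | add u v hx hy => simp only [map_add, TensorProduct.add_tmul, add_smul, hx, hy]
  | tmul a c =>
    obtain ⟨s, hs⟩ := G.T₃.surjective (y ⊗ₜ c)
    have h := G.sliceR_φ_sliceT₄ a s
    rw [hs] at h
    rw [G.T₁_sliceT₁ a c y s hs, sliceL_rTensor]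
    have h2 : G.ψ ∘ₗ G.sliceT₁at a = G.φ ∘ₗ G.sliceT₄at a := by
      ext v; simp [ψ_apply, antipode_sliceT₁]
    rw [h2, ← h, sliceR_tmul, ψ_apply, antipode_sliceT₁]; rfl

lemma sliceL_ψ_T₄ (y x : A) : sliceL G.ψ (G.T₄ (y ⊗ₜ x)) = G.ψ x • y := by
  apply G.mul_right_ext
  intro d
  rw [← sliceL_mulR₂, mulR₂_T₄, sliceL_mulL₂, sliceL_ψ_T₁]
  simp [smul_mul_assoc, mul_smul_comm]

/-- Strong right invariance: `S((ψ ⊗ ι)((p ⊗ 1)Δ(x))) = (ψ ⊗ ι)(Δ(p)(x ⊗ 1))`. -/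
lemma antipode_sliceL_ψ_T₂ (p x : A) :
    G.antipode (sliceL G.ψ (G.T₂ (p ⊗ₜ x))) = sliceL G.ψ (G.T₃ (p ⊗ₜ x)) := by
  apply G.mul_left_ext
  intro y
  let R : A →ₗ[ℂ] A := sliceL G.ψ ∘ₗ G.T₂.toLinearMap ∘ₗ (TensorProduct.mk ℂ A A).flip x
  have hR : ∀ v, R v = sliceL G.ψ (G.T₂ (v ⊗ₜ x)) := fun _ => rfl
  let E : A ⊗[ℂ] A →ₗ[ℂ] A →ₗ[ℂ] A :=
    TensorProduct.lift (LinearMap.mk₂ ℂ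
      (fun v u => LinearMap.mulLeft ℂ u ∘ₗ sliceL G.ψ ∘ₗ G.T₂at v)
      (fun u u' v => by ext; simp [TensorProduct.add_tmul, mul_add])
      (fun r u v => by ext; simp [← TensorProduct.smul_tmul'])
      (fun u v v' => by ext; simp [add_mul])
      (fun r u v => by ext; simp [smul_mul_assoc]))
  have hE : ∀ v u s, E (v ⊗ₜ u) s = u * sliceL G.ψ (G.T₂ (v ⊗ₜ s)) := fun u v s => rfl
  have hE' : ∀ t s, E t s = sliceL G.ψ ((G.Δ s).rmul t) := by
    intro t s
    induction t with
    | zero => simp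
    | add u v hx hy => simp only [map_add, LinearMap.add_apply, hx, hy]
    | tmul u v => rw [hE, ← sliceL_mulL₂, mulL₂_T₂]
  have h1 : ∀ (d : A) (t : A ⊗[ℂ] A),
      mulR₂ d (G.T₂ (R.lTensor A (TensorProduct.comm ℂ A A t))) =
        (E t).rTensor A (G.T₁ (x ⊗ₜ d)) := by
    intro d t
    induction t with
    | zero => simp
    | add u v hx hy => simp only [map_add, LinearMap.rTensor_add, LinearMap.add_apply, hx, hy]
    | tmul v u =>
      rw [TensorProduct.comm_tmul, LinearMap.lTensor_tmul, mulR₂_T₂, hR, T₁_sliceL,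
        ← LinearMap.comp_apply, ← LinearMap.rTensor_comp]
      congr 2
  -- A preimage of `y ⊗ R(p)` under `T₂`, obtained from right invariance. The identity `m(ι ⊗ S)T₂ =
  -- ι ⊗ ε` then evaluates `y S(R(p))`, with `ε(R(v)) = ψ(vx)`.
  have h2 : G.T₂ (R.lTensor A (TensorProduct.comm ℂ A A (G.T₄ (y ⊗ₜ p)))) = y ⊗ₜ R p := by
    apply G.mulR₂_ext
    intro d
    have h3 : E (G.T₄ (y ⊗ₜ p)) =
        LinearMap.toSpanSingleton ℂ A y ∘ₗ G.ψ ∘ₗ LinearMap.mulLeft ℂ p := by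
      ext s
      rw [hE', ← T₄_mul_right, sliceL_ψ_T₄]; simp
    rw [h1, h3, LinearMap.lTensor_tmul, hR, LinearMap.mulRight_apply, ← sliceL_mulR₂, mulR₂_T₂,
      sliceL_rTensor]
    generalize G.T₁ (x ⊗ₜ d) = t
    induction t with
    | zero => simp
    | add u v hx hy => simp only [map_add, TensorProduct.tmul_add, hx, hy]
    | tmul u v => simp [TensorProduct.smul_tmul]
  have h4 := G.mul'_antipode_T₂' (R.lTensor A (TensorProduct.comm ℂ A A (G.T₄ (y ⊗ₜ p))))
  rw [h2, LinearMap.lTensor_tmul, LinearMap.mul'_apply, sliceR_lTensor] at h4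
  rw [← hR, h4, ← sliceL_mulL₂, ← mulR₁_T₄, sliceL_rTensor]
  have h5 : G.counit ∘ₗ R = G.ψ ∘ₗ LinearMap.mulRight ℂ x := by
    ext v
    rw [LinearMap.comp_apply, hR, ← apply_sliceR, sliceR_counit_T₂]; simp
  rw [h5]
  generalize G.T₄ (y ⊗ₜ p) = t
  induction t with
  | zero => simp
  | add u v hx hy => simp only [map_add, hx, hy]
  | tmul u v => simp

/-! ### The functionals in the dual -/

/-- For suitable linear bijections of `A ⊗ A`, one has `ψ(s · ) = φ( · r)`. -/
lemma ψ_mul_eq_φ_mul (p q x : A) :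
    G.ψ (sliceR (G.φ ∘ₗ G.antipodeEquiv.symm) (G.T₄ (G.antipode q ⊗ₜ p)) * x) =
      G.φ (x * sliceL G.φ (G.T₃ (q ⊗ₜ G.antipode p))) := by
  -- The number `ψ(p Q(x ⊗ q))` is computed in two ways: here by strong left invariance, then by
  -- slicing with `ψ` and strong right invariance, writing `φ = (φ ∘ S⁻¹) ∘ S`.
  have h1 : G.ψ (p * G.sliceT₁ (x ⊗ₜ q)) =
      G.φ (x * sliceL G.φ (G.T₃ (q ⊗ₜ G.antipode p))) := by
    rw [ψ_apply, antipode_mul, antipode_sliceT₁, sliceT₄_mul, apply_sliceR, LinearMap.comp_apply]; rfl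
  have h2 : G.ψ (p * G.sliceT₁ (x ⊗ₜ q)) = G.φ (sliceL G.ψ (G.T₂ (p ⊗ₜ x)) * q) := by
    rw [mul_sliceT₁, apply_sliceR]; rfl
  rw [← h1, h2]
  have h3 : ∀ z, G.φ z = (G.φ ∘ₗ G.antipodeEquiv.symm) (G.antipode z) := by
    intro z
    simp
  rw [h3, antipode_mul, antipode_sliceL_ψ_T₂, ← sliceL_mulL₂, ← apply_sliceR, ← mulR₁_T₄,
    sliceR_mulR₁]

/-- The elements multiplied into `ψ` in `ψ_mul_eq_φ_mul` exhaust `A`, because `T₄` and `S` are onto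
and `φ ∘ S⁻¹` is non-zero. -/
lemma exists_φ_mul_eq_of_ψ (s : A) : ∃ r, ∀ x, G.ψ (s * x) = G.φ (x * r) := by
  let F : A ⊗[ℂ] A →ₗ[ℂ] A := sliceR (G.φ ∘ₗ G.antipodeEquiv.symm) ∘ₗ G.T₄.toLinearMap
  have hF : Function.Surjective F := (sliceR_surjective (by
    intro h
    obtain ⟨a, ha⟩ := G.exists_ne_zero
    exact ha (by simpa using congrArg (fun f => f (G.antipode a)) h))).comp G.T₄.surjective
  obtain ⟨t, rfl⟩ := hF s
  induction t with
  | zero => exact ⟨0, by simp⟩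
  | add u v hu hv =>
    obtain ⟨r, hr⟩ := hu
    obtain ⟨r', hr'⟩ := hv
    exact ⟨r + r', fun x => by simp only [map_add, add_mul, mul_add, hr, hr']⟩
  | tmul q p =>
    obtain ⟨q, rfl⟩ := G.antipode_surjective q
    exact ⟨_, fun x => G.ψ_mul_eq_φ_mul p q x⟩

lemma exists_ψ_mul_eq_of_φ (r : A) : ∃ s, ∀ x, G.ψ (s * x) = G.φ (x * r) := by
  let F : A ⊗[ℂ] A →ₗ[ℂ] A := sliceL G.φ ∘ₗ G.T₃.toLinearMap
  have hF : Function.Surjective F := (sliceL_surjective G.φ_ne_zero).comp G.T₃.surjective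
  obtain ⟨t, rfl⟩ := hF r
  induction t with
  | zero => exact ⟨0, by simp⟩
  | add u v hu hv =>
    obtain ⟨r, hr⟩ := hu
    obtain ⟨r', hr'⟩ := hv
    exact ⟨r + r', fun x => by simp only [map_add, add_mul, mul_add, hr, hr']⟩
  | tmul q p =>
    obtain ⟨p, rfl⟩ := G.antipode_surjective p
    exact ⟨_, fun x => G.ψ_mul_eq_φ_mul p q x⟩

/-- Both this lemma and its companion evaluate `ψ ⊗ φ` on a covered coproduct times `Δ(x)`: the
cover by `T₂` calls for left invariance of `φ`, the cover by `T₄` for right invariance of `ψ`. -/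
lemma ψ_φ_rmul_T₂ (t : A ⊗[ℂ] A) (x : A) :
    G.ψ (sliceR G.φ ((G.Δ x).rmul (G.T₂ t))) = G.ψ (sliceR (G.φ ∘ₗ LinearMap.mulRight ℂ x) t) := by
  induction t with
  | zero => simp
  | add u v hu hv => simp only [map_add, hu, hv]
  | tmul a b => rw [← T₂_mul_right, slice_T₂]; simp

lemma ψ_φ_rmul_T₄ (t : A ⊗[ℂ] A) (x : A) :
    G.φ (sliceL G.ψ ((G.Δ x).rmul (G.T₄ t))) = G.φ (sliceR (G.ψ ∘ₗ LinearMap.mulRight ℂ x) t) := by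
  induction t with
  | zero => simp
  | add u v hu hv => simp only [map_add, hu, hv]
  | tmul a b => rw [← T₄_mul_right, sliceL_ψ_T₄]; simp

lemma sliceR_mulRight (f g : Module.Dual ℂ A) (x : A) (t : A ⊗[ℂ] A) :
    g (sliceR (f ∘ₗ LinearMap.mulRight ℂ x) t) = f (sliceL g t * x) := by
  rw [apply_sliceR]; rfl

/-- One tensor is written both as `T₂ t` and as `T₄(q ⊗ p)`, with `q` scaled so that `φ(q) = 1`. The
two evaluations of `ψ ⊗ φ` on its product with `Δ(x)` are the two sides, with `s = (ψ ⊗ ι)(t)`. -/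
lemma exists_φ_left_eq_of_ψ (p : A) : ∃ s, ∀ x, G.ψ (p * x) = G.φ (s * x) := by
  obtain ⟨q, hq⟩ := G.exists_ne_zero
  obtain ⟨t, ht⟩ := G.T₂.surjective (G.T₄ (((G.φ q)⁻¹ • q) ⊗ₜ p))
  refine ⟨sliceL G.ψ t, fun x => ?_⟩
  have h1 := G.ψ_φ_rmul_T₂ t x
  have h2 := G.ψ_φ_rmul_T₄ (((G.φ q)⁻¹ • q) ⊗ₜ p) x
  rw [ht, apply_sliceR, h2, sliceR_mulRight, sliceR_mulRight] at h1
  rw [← h1]; simp [hq]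

lemma exists_ψ_left_eq_of_φ (p : A) : ∃ s, ∀ x, G.φ (p * x) = G.ψ (s * x) := by
  obtain ⟨q, hq⟩ := exists_apply_ne_zero G.ψ_ne_zero
  obtain ⟨t, ht⟩ := G.T₄.surjective (G.T₂ (((G.ψ q)⁻¹ • q) ⊗ₜ p))
  refine ⟨sliceL G.φ t, fun x => ?_⟩
  have h1 := G.ψ_φ_rmul_T₄ t x
  have h2 := G.ψ_φ_rmul_T₂ (((G.ψ q)⁻¹ • q) ⊗ₜ p) x
  rw [ht, ← apply_sliceR, h2, sliceR_mulRight, sliceR_mulRight] at h1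
  rw [← h1]; simp [hq]

/-- The passage is through `ψ`: `φ(p · ) = ψ(s · ) = φ( · r)`. This is the existence part of a
modular automorphism of `φ`; uniqueness would need faithfulness, which is deduced from it below. -/
lemma exists_right_of_left (p : A) : ∃ r, ∀ x, G.φ (p * x) = G.φ (x * r) := by
  obtain ⟨s, hs⟩ := G.exists_ψ_left_eq_of_φ p
  obtain ⟨r, hr⟩ := G.exists_φ_mul_eq_of_ψ s
  exact ⟨r, fun x => by rw [hs, hr]⟩

lemma exists_left_of_right (r : A) : ∃ p, ∀ x, G.φ (p * x) = G.φ (x * r) := by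
  obtain ⟨s, hs⟩ := G.exists_ψ_mul_eq_of_φ r
  obtain ⟨p, hp⟩ := G.exists_φ_left_eq_of_ψ s
  exact ⟨p, fun x => by rw [← hp, hs]⟩

end AlgebraicQuantumGroup

/-! ### Bilinear maps with spanning range, and tensors determined by their slices -/

section Span

variable {X Y Z W : Type*} [AddCommGroup X] [Module ℂ X] [AddCommGroup Y] [Module ℂ Y]
  [AddCommGroup Z] [Module ℂ Z] [AddCommGroup W] [Module ℂ W]

/-- Linear maps which agree on the values of a bilinear map with spanning range are equal. -/
lemma ext_of_map₂_eq_top {f : X →ₗ[ℂ] Y →ₗ[ℂ] Z} (hf : Submodule.map₂ f ⊤ ⊤ = ⊤)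
    {k l : Z →ₗ[ℂ] W} (h : ∀ x y, k (f x y) = l (f x y)) : k = l := by
  apply LinearMap.ext
  intro z
  have : Submodule.map₂ f ⊤ ⊤ ≤ LinearMap.eqLocus k l :=
    Submodule.map₂_le.2 fun x _ y _ => h x y
  rw [hf] at this
  exact this Submodule.mem_top

lemma map₂_eq_top_of_forall {f : X →ₗ[ℂ] Y →ₗ[ℂ] Z}
    (h : ∀ S : Submodule ℂ Z, (∀ x y, f x y ∈ S) → S = ⊤) : Submodule.map₂ f ⊤ ⊤ = ⊤ :=
  h _ fun _ _ => Submodule.apply_mem_map₂ f Submodule.mem_top Submodule.mem_top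

lemma eq_top_of_map₂_eq_top {f : X →ₗ[ℂ] Y →ₗ[ℂ] Z} (hf : Submodule.map₂ f ⊤ ⊤ = ⊤)
    {S : Submodule ℂ Z} (h : ∀ x y, f x y ∈ S) : S = ⊤ :=
  top_le_iff.1 (hf ▸ Submodule.map₂_le.2 fun x _ y _ => h x y)

lemma sliceL_ext {t s : X ⊗[ℂ] Y} {ι : Type*} (f : ι → Module.Dual ℂ X)
    (hf : ∀ x, (∀ i, f i x = 0) → x = 0) (h : ∀ i, sliceL (f i) t = sliceL (f i) s) : t = s := by
  rw [← sub_eq_zero]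
  apply rTensor_jointly_injective f hf
  intro i
  apply (TensorProduct.lid ℂ Y).injective
  rw [map_zero, map_sub, map_sub, sub_eq_zero]
  exact h i

/-- `t` is a sum of tensors `p ⊗ q` with `p` in `N` if all its slices belong to `N`. -/
lemma exists_finsupp_of_sliceR_mem {N : Submodule ℂ X} (t : X ⊗[ℂ] Y)
    (h : ∀ f : Module.Dual ℂ Y, sliceR f t ∈ N) :
    t ∈ LinearMap.range (N.subtype.rTensor Y) := by
  classical
  let b := Module.Basis.ofVectorSpace ℂ Y
  obtain ⟨p, rfl⟩ := TensorProduct.eq_repr_basis_right b t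
  apply Submodule.sum_mem
  intro i hi
  have h1 := h (b.coord i)
  have h2 : sliceR (b.coord i) (p.sum fun i m => m ⊗ₜ[ℂ] b i) = p i := by
    rw [Finsupp.sum, map_sum]
    simp only [sliceR_tmul, Module.Basis.coord_apply, Module.Basis.repr_self]
    rw [Finset.sum_eq_single_of_mem i hi fun j _ hj => by simp [hj]]
    simp
  rw [h2] at h1
  exact ⟨⟨p i, h1⟩ ⊗ₜ b i, rfl⟩

end Span

namespace AlgebraicQuantumGroup

variable {A : Type*} [NonUnitalRing A] [Module ℂ A] [IsScalarTower ℂ A A] [SMulCommClass ℂ A A]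
variable (G : AlgebraicQuantumGroup A)

open Multiplier

/-! ### Faithfulness of the integral -/

/-- `A` is idempotent. -/
lemma map₂_mul_eq_top (G : AlgebraicQuantumGroup A) :
    Submodule.map₂ (LinearMap.mul ℂ A) ⊤ ⊤ = ⊤ := by
  by_contra hne
  obtain ⟨f, hf, hle⟩ := Submodule.exists_le_ker_of_lt_top _ (lt_top_iff_ne_top.2 hne)
  have hmul : ∀ a, f ∘ₗ LinearMap.mulLeft ℂ a = 0 := fun a => LinearMap.ext fun b =>
    hle (Submodule.apply_mem_map₂ (LinearMap.mul ℂ A) (Submodule.mem_top (x := a))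
      (Submodule.mem_top (x := b)))
  -- A functional `f` vanishing on all products kills the first leg of `(a ⊗ 1)(Δ(b)(1 ⊗ d))`, hence
  -- of `(a ⊗ 1)Δ(b)`. Surjectivity of `T₂` then contradicts `f ≠ 0`.
  have h0 : ∀ t : A ⊗[ℂ] A, sliceL f (G.T₂ t) = 0 := by
    intro t
    induction t with
    | zero => simp
    | add u v hu hv => simp only [map_add, hu, hv, add_zero]
    | tmul a b =>
      apply G.mul_right_ext
      intro d
      rw [← sliceL_mulR₂, mulR₂_T₂, sliceL_rTensor, hmul, zero_mul]
      simp [sliceL]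
  obtain ⟨a, ha⟩ := exists_apply_ne_zero hf
  obtain ⟨c, hc⟩ := G.exists_ne_zero
  obtain ⟨t, ht⟩ := G.T₂.surjective (a ⊗ₜ c)
  have h1 := h0 t
  rw [ht, sliceL_tmul] at h1
  have hc' : c ≠ 0 := fun h => hc (by rw [h, map_zero])
  exact (smul_ne_zero ha hc') h1

/-- By the comparison of `φ(a · )` with `φ( · a)`, the left and right kernels of the form `φ(xy)`
agree and form a two-sided ideal `N`. The counit vanishes on `N`, and `N` absorbs the slices `(ω ⊗
ι)((y ⊗ 1)Δ(a))` for `a` in `N`; applying `ε` to these shows `ya = 0`. -/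
lemma eq_zero_of_φ_mul (a : A) (ha : ∀ c, G.φ (a * c) = 0) : a = 0 := by
  have ha' : ∀ c, G.φ (c * a) = 0 := fun c => by
    obtain ⟨r, hr⟩ := G.exists_right_of_left c
    rw [hr, ha]
  let N : Submodule ℂ A :=
    { carrier := {x | ∀ b, G.φ (b * x) = 0}
      add_mem' := fun hx hy b => by rw [mul_add, map_add, hx, hy, add_zero]
      zero_mem' := fun b => by simp
      smul_mem' := fun r x hx b => by rw [mul_smul_comm, map_smul, hx, smul_zero] }
  have hN : ∀ x ∈ N, ∀ b c, G.φ (b * (x * c)) = 0 := by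
    intro x hx b c
    obtain ⟨p, hp⟩ := G.exists_left_of_right c
    rw [← mul_assoc, ← hp, ← mul_assoc]
    exact hx _
  have hε : ∀ a ∈ N, G.counit a = 0 := by
    intro a ha
    by_contra hne
    have hQ : ∀ b, G.sliceT₁ (b ⊗ₜ a) = 0 := fun b => by
      apply G.mul_left_ext
      intro y
      have : G.dualMap a = 0 := LinearMap.ext ha
      rw [mul_sliceT₁, this, mul_zero]; simp [sliceR]
    have hφ : ∀ b y, G.φ (b * y) = 0 := by
      intro b y
      -- All slices of `t` by `φ(b · )` on the first leg equal `Q(b ⊗ a) y = 0`, so `t` lies in `N ⊗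
      -- A` and `m(t)` is in `N`. But `m(t) = (ι ⊗ ε)(T₃ t) = ε(a) y`, so `ε(a) ≠ 0` would make `φ`
      -- vanish on all products.
      obtain ⟨t, ht⟩ := G.T₃.surjective (y ⊗ₜ a)
      have h1 : ∀ b, sliceL (G.φ ∘ₗ LinearMap.mulLeft ℂ b) t = 0 := by
        intro b
        have h2 : ∀ t : A ⊗[ℂ] A, sliceL (G.φ ∘ₗ LinearMap.mulLeft ℂ b) t =
            G.slice ((G.Δ b).lmul (G.T₃ t)) := by
          intro t
          induction t with
          | zero => simp
          | add u v hu hv => simp only [map_add, hu, hv]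
          | tmul p q => rw [← T₃_mul, slice_T₃]; simp
        rw [h2, ht, ← T₁_mulRight, slice_eq, sliceR_mulR₁, ← sliceT₁_tmul, hQ, zero_mul]
      have h3 : t ∈ LinearMap.range (N.subtype.rTensor A) := by
        apply exists_finsupp_of_sliceR_mem
        intro f b
        have := apply_sliceR f (G.φ ∘ₗ LinearMap.mulLeft ℂ b) t
        rw [h1, map_zero] at this
        exact this
      have h4 : G.φ (b * LinearMap.mul' ℂ A t) = 0 := by
        obtain ⟨s, rfl⟩ := h3
        clear ht h1
        induction s with
        | zero => simp
        | add u v hu hv => simp only [map_add, mul_add, hu, hv, add_zero]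
        | tmul p q => simpa using hN p.1 p.2 b q
      rw [← sliceR_counit_T₃, ht, sliceR_tmul, mul_smul_comm, map_smul] at h4
      exact (smul_eq_zero.1 h4).resolve_left hne
    exact G.φ_ne_zero (ext_of_map₂_eq_top G.map₂_mul_eq_top fun x y => hφ x y)
  have hQ : ∀ c, G.sliceT₁ (a ⊗ₜ c) = 0 := fun c => by
    apply G.antipode_injective
    rw [antipode_sliceT₁, map_zero]
    apply G.mul_right_ext
    intro y
    have : G.φ ∘ₗ LinearMap.mulLeft ℂ a = 0 := LinearMap.ext ha
    rw [sliceT₄_mul, this, zero_mul]; simp [sliceR]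
  apply G.mul_left_ext
  intro y
  rw [← sliceR_counit_T₂, mul_zero]
  apply (Module.forall_dual_apply_eq_zero_iff ℂ _).1
  intro ω
  rw [apply_sliceR]
  apply hε
  intro b
  -- Moving `b` to the right as `r` turns the pairing with the slice into `ω(y Q(a ⊗ r))`, which
  -- vanishes.
  obtain ⟨r, hr⟩ := G.exists_right_of_left b
  rw [hr]
  change (G.dualMap r) _ = 0
  rw [← apply_sliceR, ← mul_sliceT₁, hQ, mul_zero, map_zero]

lemma toDual_injective : Function.Injective G.toDual := by
  rw [injective_iff_map_eq_zero]
  intro c hc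
  apply G.eq_zero_of_φ_mul
  intro x
  obtain ⟨p, hp⟩ := G.exists_left_of_right x
  rw [← hp, ← eval_toDual, hc]; simp

lemma eq_zero_of_eval (a : A) (ha : ∀ b, G.eval b a = 0) : a = 0 :=
  G.eq_zero_of_φ_mul a fun c => ha (G.toDual c)

lemma dual_eq_zero_of_eval (b : G.Dual) (hb : ∀ a, G.eval b a = 0) : b = 0 :=
  G.eval_injective (LinearMap.ext fun a => by rw [hb, map_zero]; rfl)

/-! ### The dual -/

lemma act_toDual_eq (c x : A) : G.act (G.toDual c) x = G.sliceT₁ (x ⊗ₜ c) := G.act_toDual c x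

lemma map₂_act_eq_top : Submodule.map₂ G.act ⊤ ⊤ = ⊤ := by
  apply map₂_eq_top_of_forall
  intro S hS
  rw [eq_top_iff]
  rintro x -
  obtain ⟨t, rfl⟩ := G.sliceT₁_surjective x
  induction t with
  | zero => simp
  | add u v hu hv => rw [map_add]; exact S.add_mem hu hv
  | tmul x c => rw [← act_toDual_eq]; exact hS _ _

lemma act_mul_right' (b : G.Dual) (x y : A) :
    G.act b x * y = sliceR (G.eval b) (G.T₃ (x ⊗ₜ y)) := G.act_mul_right b x y

/-- All slices of `Δ(x)(y ⊗ 1)` by elements of `B` vanish. As `B` separates `A` and `T₃` is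
injective, `x ⊗ y = 0`. -/
lemma eq_zero_of_act (x : A) (hx : ∀ b, G.act b x = 0) : x = 0 := by
  obtain ⟨y, hy⟩ := G.exists_ne_zero
  have hy' : y ≠ 0 := fun h => hy (by rw [h, map_zero])
  have h : G.T₃ (x ⊗ₜ y) = 0 := by
    apply lTensor_jointly_injective (fun b => G.eval b) (fun a => G.eq_zero_of_eval a)
    intro b
    apply (TensorProduct.rid ℂ A).injective
    rw [map_zero, ← act_mul_right, hx, zero_mul]
  have h' : x ⊗ₜ[ℂ] y = (0 : A) ⊗ₜ y := by
    rw [TensorProduct.zero_tmul]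
    exact G.T₃.injective (h.trans (map_zero _).symm)
  exact tmul_right_cancel hy' h'

lemma dual_eq_zero_of_act (b : G.Dual) (hb : ∀ x, G.act b x = 0) : b = 0 := by
  apply G.dual_eq_zero_of_eval
  intro a
  obtain ⟨y, hy⟩ := G.exists_ne_zero
  have hy' : y ≠ 0 := fun h => hy (by rw [h, map_zero])
  have h : ∀ t : A ⊗[ℂ] A, sliceR (G.eval b) (G.T₃ t) = 0 := by
    intro t
    induction t with
    | zero => simp
    | add u v hu hv => simp only [map_add, hu, hv, add_zero]
    | tmul x y => rw [← act_mul_right', hb, zero_mul]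
  have h1 := h (G.T₃.symm (y ⊗ₜ a))
  rw [LinearEquiv.apply_symm_apply, sliceR_tmul] at h1
  exact (smul_eq_zero.1 h1).resolve_right hy'

/-- Through `⟨x, bc⟩ = ⟨c ▷ x, b⟩`, one half says that `B ▷ A` spans `A`, the other that `B`
separates `A` and acts faithfully on it. -/
lemma dual_nondegenerate : IsNondegenerateProduct G.Dual := by
  constructor
  · intro b hb
    apply G.eval_injective
    rw [map_zero]
    refine ext_of_map₂_eq_top G.map₂_act_eq_top fun c x => ?_
    rw [← eval_mul, hb]; simp
  · intro b hb
    apply G.dual_eq_zero_of_act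
    intro x
    apply G.eq_zero_of_eval
    intro c
    rw [← eval_mul, hb]; simp

lemma map₂_dual_mul_eq_top : Submodule.map₂ (LinearMap.mul ℂ G.Dual) ⊤ ⊤ = ⊤ := by
  apply map₂_eq_top_of_forall
  intro S hS
  rw [eq_top_iff]
  rintro x -
  obtain ⟨c, rfl⟩ := G.toDual_surjective x
  obtain ⟨t, rfl⟩ : ∃ t, G.slice (G.T₃.symm t) = c :=
    ((sliceR_surjective G.φ_ne_zero).comp G.T₃.symm.surjective) c
  induction t with
  | zero => simp
  | add u v hu hv => rw [map_add, map_add, map_add]; exact S.add_mem hu hv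
  | tmul c d =>
    have := hS (G.toDual c) (G.toDual d)
    rwa [LinearMap.mul_apply', toDual_mul] at this

/-- The right action of `A` on `B`: `⟨x, b ◁ v⟩ = ⟨v x, b⟩`. -/
def actDualR : A →ₗ[ℂ] Module.End ℂ G.Dual where
  toFun a :=
    { toFun := fun b => ⟨G.eval b ∘ₗ LinearMap.mulLeft ℂ a, by
        obtain ⟨c, rfl⟩ := G.toDual_surjective b
        obtain ⟨r, hr⟩ := G.exists_right_of_left a
        exact ⟨c * r, by ext x; simp [mul_assoc, hr]⟩⟩
      map_add' := fun b b' => by apply G.eval_injective; ext x; rfl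
      map_smul' := fun r b => by apply G.eval_injective; ext x; rfl }
  map_add' a a' := by
    ext b; apply G.eval_injective; ext x
    change G.eval b ((a + a') * x) = G.eval b (a * x) + G.eval b (a' * x)
    rw [add_mul, map_add]
  map_smul' r a := by
    ext b; apply G.eval_injective; ext x
    change G.eval b ((r • a) * x) = r • G.eval b (a * x)
    rw [smul_mul_assoc, map_smul]

lemma eval_actDualR (v x : A) (b : G.Dual) : G.eval (G.actDualR v b) x = G.eval b (v * x) := rfl

/-- Since `A` is idempotent, the functionals `φ( · cd)` suffice; if `φ( · d) = φ(v · )`, such a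
functional is `φ( · c) ◁ v`. -/
lemma map₂_actDualR_eq_top : Submodule.map₂ G.actDualR ⊤ ⊤ = ⊤ := by
  apply map₂_eq_top_of_forall
  intro S hS
  have h : ∀ c, G.toDual c ∈ S := by
    intro c
    have : S.comap G.toDual = ⊤ := by
      apply eq_top_of_map₂_eq_top G.map₂_mul_eq_top
      intro c d
      obtain ⟨v, hv⟩ := G.exists_left_of_right d
      rw [Submodule.mem_comap]
      convert hS v (G.toDual c) using 1
      apply G.eval_injective
      ext x
      rw [eval_actDualR, eval_toDual, LinearMap.mul_apply', eval_toDual, mul_assoc, hv, mul_assoc]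
    have hc : c ∈ S.comap G.toDual := by rw [this]; exact Submodule.mem_top
    exact hc
  rw [eq_top_iff]
  rintro x -
  obtain ⟨c, rfl⟩ := G.toDual_surjective x
  exact h c

/-! ### The duality as a multiplier -/

/-- The linear identification of `A` with `B`. -/
def dualEquiv : A ≃ₗ[ℂ] G.Dual :=
  LinearEquiv.ofBijective G.toDual ⟨G.toDual_injective, G.toDual_surjective⟩

@[simp] lemma dualEquiv_symm_toDual (c : A) : G.dualEquiv.symm (G.toDual c) = c :=
  G.dualEquiv.symm_apply_apply c

/-- The map sending `s` to `ψ(s · )`. -/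
def toDualψ : A →ₗ[ℂ] G.Dual where
  toFun s := ⟨G.ψ ∘ₗ LinearMap.mulLeft ℂ s, by
    obtain ⟨r, hr⟩ := G.exists_φ_mul_eq_of_ψ s
    exact ⟨r, by ext x; simp [hr]⟩⟩
  map_add' s s' := by
    apply G.eval_injective; ext x
    change G.ψ ((s + s') * x) = G.ψ (s * x) + G.ψ (s' * x)
    rw [add_mul, map_add]
  map_smul' r s := by
    apply G.eval_injective; ext x
    change G.ψ ((r • s) * x) = r • G.ψ (s * x)
    rw [smul_mul_assoc, map_smul]

lemma eval_toDualψ (s x : A) : G.eval (G.toDualψ s) x = G.ψ (s * x) := rfl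

lemma toDualψ_surjective : Function.Surjective G.toDualψ := by
  intro b
  obtain ⟨c, rfl⟩ := G.toDual_surjective b
  obtain ⟨s, hs⟩ := G.exists_ψ_mul_eq_of_φ c
  exact ⟨s, by apply G.eval_injective; ext x; rw [eval_toDualψ, hs, eval_toDual]⟩

/-- Evaluation of the first leg of an element of `B ⊗ A`. -/
def evalL (z : A) : G.Dual ⊗[ℂ] A →ₗ[ℂ] A := sliceL (G.eval.flip z)

@[simp] lemma evalL_tmul (z : A) (b : G.Dual) (a : A) : G.evalL z (b ⊗ₜ a) = G.eval b z • a := by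
  simp [evalL]

lemma evalL_ext {s t : G.Dual ⊗[ℂ] A} (h : ∀ z, G.evalL z s = G.evalL z t) : s = t :=
  sliceL_ext (fun z => G.eval.flip z) (fun b hb => G.dual_eq_zero_of_eval b hb) h

/-- `c ↦ c ▷ (z ⊗ · )` as a map `B ⊗ A → A ⊗ A`. -/
def actL (z : A) : G.Dual ⊗[ℂ] A →ₗ[ℂ] A ⊗[ℂ] A := (G.act.flip z).rTensor A

@[simp] lemma actL_tmul (z : A) (b : G.Dual) (a : A) : G.actL z (b ⊗ₜ a) = G.act b z ⊗ₜ a := rfl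

lemma counit_act (b : G.Dual) (z : A) : G.counit (G.act b z) = G.eval b z := by
  obtain ⟨c, rfl⟩ := G.toDual_surjective b
  rw [act_toDual_eq, counit_sliceT₁, eval_toDual]

lemma sliceL_counit_actL (z : A) (t : G.Dual ⊗[ℂ] A) :
    sliceL G.counit (G.actL z t) = G.evalL z t := by
  induction t with
  | zero => simp
  | add u v hu hv => simp only [map_add, hu, hv]
  | tmul b a => rw [actL_tmul, sliceL_tmul, counit_act, evalL_tmul]

/-- Left multiplication by `V`. -/
def dualityL : G.Dual ⊗[ℂ] A →ₗ[ℂ] G.Dual ⊗[ℂ] A :=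
  G.toDual.rTensor A ∘ₗ G.T₃.symm.toLinearMap ∘ₗ (TensorProduct.comm ℂ A A).toLinearMap ∘ₗ
    G.dualEquiv.symm.toLinearMap.rTensor A

lemma dualityL_toDual (c a : A) :
    G.dualityL (G.toDual c ⊗ₜ a) = G.toDual.rTensor A (G.T₃.symm (a ⊗ₜ c)) := by
  simp [dualityL]

/-- The definition of `dualityL` is made for this: with `b = φ( · c)` the assertion is `iter_T₃` at
the preimage of `a ⊗ c`. -/
lemma actL_dualityL_tmul (z : A) (b : G.Dual) (a : A) :
    G.actL z (G.dualityL (b ⊗ₜ a)) = G.T₁ (G.act b z ⊗ₜ a) := by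
  obtain ⟨c, rfl⟩ := G.toDual_surjective b
  rw [dualityL_toDual, act_toDual']
  have h := G.iter_T₃ z (G.T₃.symm (a ⊗ₜ c))
  rw [LinearEquiv.apply_symm_apply, iter_tmul] at h
  rw [h]
  generalize G.T₃.symm (a ⊗ₜ c) = t
  induction t with
  | zero => simp
  | add u v hu hv => simp only [map_add, hu, hv]
  | tmul p q =>
    rw [LinearMap.rTensor_tmul, actL_tmul, act_toDual']; rfl

lemma actL_dualityL (z : A) (t : G.Dual ⊗[ℂ] A) :
    G.actL z (G.dualityL t) = G.T₁ (G.actL z t) := by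
  induction t with
  | zero => simp
  | add u v hu hv => simp only [map_add, hu, hv]
  | tmul b a => rw [actL_dualityL_tmul, actL_tmul]

lemma evalL_dualityL (z : A) (b : G.Dual) (a : A) :
    G.evalL z (G.dualityL (b ⊗ₜ a)) = G.act b z * a := by
  rw [← sliceL_counit_actL, actL_dualityL, sliceL_counit_T₁]; simp

/-- For `b = ψ(s · )` write `s ⊗ a = ∑ (1 ⊗ p)Δ(q)`. Right invariance turns `(ψ ⊗ ι)((s ⊗ a)Δ(z))`
into `∑ ψ(qz) p`, so right multiplication by `V` sends `b ⊗ a` to `∑ ψ(q · ) ⊗ p`. -/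
lemma exists_dualityR : ∃ R : G.Dual ⊗[ℂ] A →ₗ[ℂ] G.Dual ⊗[ℂ] A, ∀ z b a,
    G.evalL z (R (b ⊗ₜ a)) = sliceL (G.eval b) (G.T₄ (a ⊗ₜ z)) := by
  obtain ⟨g, hg⟩ := G.toDualψ.exists_rightInverse_of_surjective
    (LinearMap.range_eq_top.2 G.toDualψ_surjective)
  refine ⟨G.toDualψ.rTensor A ∘ₗ (TensorProduct.comm ℂ A A).toLinearMap ∘ₗ
    G.T₄.symm.toLinearMap ∘ₗ g.rTensor A, fun z b a => ?_⟩
  have hb : G.toDualψ (g b) = b := congrArg (fun k => k b) hg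
  have h1 : G.eval b = G.ψ ∘ₗ LinearMap.mulLeft ℂ (g b) := by
    rw [← hb]; ext x; rw [eval_toDualψ, hb]; rfl
  obtain ⟨s, hs⟩ := G.T₄.surjective (g b ⊗ₜ a)
  rw [h1, ← sliceL_rTensor, mulL₁_T₄', ← hs]
  simp only [LinearMap.comp_apply, LinearMap.rTensor_tmul, LinearEquiv.coe_coe]
  rw [← hs, LinearEquiv.symm_apply_apply]
  clear hs
  induction s with
  | zero => simp
  | add u v hu hv => simp only [map_add, hu, hv]
  | tmul p q =>
    rw [← T₄_mul_right, sliceL_ψ_T₄]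
    simp [eval_toDualψ]

lemma evalL_tmul_mul (z : A) (b : G.Dual) (a : A) (t : G.Dual ⊗[ℂ] A) :
    G.evalL z ((b ⊗ₜ a) * t) = a * sliceL (G.eval b) (G.actL z t) := by
  induction t with
  | zero => simp
  | add u v hu hv => simp only [map_add, mul_add, hu, hv]
  | tmul b' a' => simp [mul_smul_comm]

lemma evalL_mul_tmul (z : A) (b : G.Dual) (a : A) (t : G.Dual ⊗[ℂ] A) :
    G.evalL z (t * (b ⊗ₜ a)) = G.evalL (G.act b z) t * a := by
  induction t with
  | zero => simp
  | add u v hu hv => simp only [map_add, add_mul, hu, hv]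
  | tmul b' a' => simp [smul_mul_assoc]

/-- The duality `V` as a multiplier of `B ⊗ A`. -/
def duality : Multiplier (G.Dual ⊗[ℂ] A) :=
  Multiplier.mk' G.dualityL G.exists_dualityR.choose (by
    have hR := G.exists_dualityR.choose_spec
    generalize G.exists_dualityR.choose = R at hR ⊢
    intro s t
    induction s with
    | zero => simp
    | add u v hu hv => simp only [map_add, add_mul, hu, hv]
    | tmul b a =>
      induction t with
      | zero => simp
      | add u v hu hv => simp only [map_add, mul_add, hu, hv]
      | tmul b' a' =>
        -- Evaluated at `z`, both sides are the slice by `b` of `(1 ⊗ a)Δ(b' ▷ z)(1 ⊗ a')`.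
        apply G.evalL_ext
        intro z
        rw [evalL_tmul_mul, actL_dualityL_tmul, evalL_mul_tmul, hR, ← sliceL_mulL₂,
          ← sliceL_mulR₂, mulR₂_T₄])

lemma pairing₂_tmul (t : G.Dual ⊗[ℂ] A) (x : A) (b : G.Dual) :
    G.pairing₂ t (x ⊗ₜ b) = G.eval b (G.evalL x t) := by
  induction t with
  | zero => simp
  | add u v hu hv => simp only [map_add, LinearMap.add_apply, hu, hv]
  | tmul b' a => rw [evalL_tmul, map_smul]; rfl

/-- Because `B` separates `A`, the element of `B` in the pairing can be dropped. What is left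
determines `V(b ⊗ a)`, whence uniqueness. -/
lemma isDuality_iff (V : Multiplier (G.Dual ⊗[ℂ] A)) :
    G.IsDuality V ↔ ∀ z b a, G.evalL z (V.lmul (b ⊗ₜ a)) = G.act b z * a := by
  have key : ∀ z b a (b' : G.Dual), G.pairing (G.actPairing (b ⊗ₜ a) (z ⊗ₜ b')) =
      G.eval b' (G.act b z * a) := fun z b a b' => rfl
  constructor
  · intro h z b a
    rw [← sub_eq_zero]
    apply G.eq_zero_of_eval
    intro b'
    have := h (b ⊗ₜ a) (z ⊗ₜ b')
    rw [key, pairing₂_tmul] at this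
    rw [map_sub, this, sub_self]
  · intro h c d
    induction c with
    | zero => simp
    | add u v hu hv => simp only [map_add, LinearMap.add_apply, hu, hv]
    | tmul b a =>
      induction d with
      | zero => simp
      | add u v hu hv => simp only [map_add, hu, hv]
      | tmul z b' => rw [key, pairing₂_tmul, h]

lemma isDuality_duality : G.IsDuality G.duality :=
  (G.isDuality_iff _).2 fun z b a => G.evalL_dualityL z b a

lemma nondegenerate_dual_tensor : IsNondegenerateProduct (G.Dual ⊗[ℂ] A) :=
  G.dual_nondegenerate.tensor G.nondegenerate

end AlgebraicQuantumGroup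

lemma Multiplier.ext_lmul {D : Type*} [NonUnitalRing D] [Module ℂ D] [IsScalarTower ℂ D D]
    [SMulCommClass ℂ D D] (hD : IsNondegenerateProduct D) {m n : Multiplier D}
    (h : m.lmul = n.lmul) : m = n := by
  apply Multiplier.ext' h
  ext a
  rw [← sub_eq_zero]
  apply hD.1
  intro b
  rw [sub_mul, ← compat, ← compat, h, sub_self]

namespace AlgebraicQuantumGroup

variable {A : Type*} [NonUnitalRing A] [Module ℂ A] [IsScalarTower ℂ A A] [SMulCommClass ℂ A A]
variable (G : AlgebraicQuantumGroup A)

lemma IsDuality.eq {V : Multiplier (G.Dual ⊗[ℂ] A)} (hV : G.IsDuality V) : V = G.duality := by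
  apply Multiplier.ext_lmul G.nondegenerate_dual_tensor
  apply TensorProduct.ext'
  intro b a
  apply G.evalL_ext
  intro z
  rw [(G.isDuality_iff V).1 hV]
  exact (G.evalL_dualityL z b a).symm

lemma existsUnique_isDuality : ∃! V : Multiplier (G.Dual ⊗[ℂ] A), G.IsDuality V :=
  ⟨G.duality, G.isDuality_duality, fun _ hV => hV.eq⟩

lemma lmul_duality (t : G.Dual ⊗[ℂ] A) : G.duality.lmul t = G.dualityL t := rfl

end AlgebraicQuantumGroup

/-! ## Extension of actions and homomorphisms to multiplier algebras -/

section Extend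

variable {C X D : Type*} [NonUnitalRing C] [Module ℂ C] [IsScalarTower ℂ C C] [SMulCommClass ℂ C C]
  [AddCommGroup X] [Module ℂ X]
  [NonUnitalRing D] [Module ℂ D] [IsScalarTower ℂ D D] [SMulCommClass ℂ D D]

open Multiplier

lemma lift_surjective_of_map₂_eq_top {ρ : C →ₗ[ℂ] Module.End ℂ X}
    (h : Submodule.map₂ ρ ⊤ ⊤ = ⊤) : Function.Surjective (TensorProduct.lift ρ) :=
  LinearMap.range_eq_top.1 (eq_top_of_map₂_eq_top h fun c x => ⟨c ⊗ₜ x, rfl⟩)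

/-- A linear map on `C` induces one on `X` along a surjection `C ⊗ X → X`. -/
lemma exists_lift_of_forall {ρ : C →ₗ[ℂ] Module.End ℂ X} (hspan : Submodule.map₂ ρ ⊤ ⊤ = ⊤)
    (f : C →ₗ[ℂ] C)
    (hk : ∀ t, TensorProduct.lift ρ t = 0 → TensorProduct.lift (ρ ∘ₗ f) t = 0) :
    ∃ L : Module.End ℂ X, ∀ c x, L (ρ c x) = ρ (f c) x := by
  obtain ⟨L, hL⟩ := exists_comp_eq_of_ker_le (lift_surjective_of_map₂_eq_top hspan) _ hk
  exact ⟨L, fun c x => hL (c ⊗ₜ x)⟩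

/-- The value of `m` on `∑ ρ(c) x` must be `∑ ρ(mc) x`. It is well defined because `ρ(c')` maps it
to `ρ(c'm)` of the original sum, and the `ρ(c')` are jointly injective. -/
lemma exists_extendsAction {ρ : C →ₗ[ℂ] Module.End ℂ X}
    (hmul : ∀ c c' x, ρ (c * c') x = ρ c (ρ c' x))
    (hspan : Submodule.map₂ ρ ⊤ ⊤ = ⊤) (hfaith : ∀ x, (∀ c, ρ c x = 0) → x = 0) :
    ∃ σ : Multiplier C →ₐ[ℂ] Module.End ℂ X, ∀ m c x, σ m (ρ c x) = ρ (m.lmul c) x := by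
  have hex : ∀ m : Multiplier C, ∃ L : Module.End ℂ X, ∀ c x, L (ρ c x) = ρ (m.lmul c) x := by
    intro m
    apply exists_lift_of_forall hspan
    intro t ht
    apply hfaith
    intro c
    have : ∀ t, ρ c (TensorProduct.lift (ρ ∘ₗ m.lmul) t) =
        ρ (m.rmul c) (TensorProduct.lift ρ t) := by
      intro t
      induction t with
      | zero => simp
      | add u v hu hv => simp only [map_add, hu, hv]
      | tmul c' x => simp [← hmul, compat]
    rw [this, ht, map_zero]
  choose L hL using hex
  refine ⟨AlgHom.ofLinearMap
    { toFun := L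
      map_add' := fun m n => ext_of_map₂_eq_top hspan fun c x => by
        simp [hL]
      map_smul' := fun r m => ext_of_map₂_eq_top hspan fun c x => by
        simp [hL] } ?_ ?_, fun m c x => hL m c x⟩
  · exact ext_of_map₂_eq_top hspan fun c x => (hL 1 c x).trans rfl
  · intro m n
    refine ext_of_map₂_eq_top hspan fun c x => ?_
    change L (m * n) (ρ c x) = L m (L n (ρ c x))
    rw [hL, hL, hL, lmul_mul]

lemma ExtendsAction.apply (hC : IsNondegenerateProduct C) {ρ : C →ₗ[ℂ] Module.End ℂ X}
    {σ : Multiplier C →ₐ[ℂ] Module.End ℂ X} (hσ : ExtendsAction ρ σ) (m : Multiplier C) (c : C)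
    (x : X) : σ m (ρ c x) = ρ (m.lmul c) x := by
  rw [← hσ, ← hσ, ← mul_of hC, map_mul]; rfl

lemma existsUnique_extendsAction (hC : IsNondegenerateProduct C) {ρ : C →ₗ[ℂ] Module.End ℂ X}
    (hmul : ∀ c c' x, ρ (c * c') x = ρ c (ρ c' x))
    (hspan : Submodule.map₂ ρ ⊤ ⊤ = ⊤) (hfaith : ∀ x, (∀ c, ρ c x = 0) → x = 0) :
    ∃! σ : Multiplier C →ₐ[ℂ] Module.End ℂ X, ExtendsAction ρ σ := by
  obtain ⟨σ, hσ⟩ := exists_extendsAction hmul hspan hfaith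
  refine ⟨σ, fun c => ext_of_map₂_eq_top hspan fun c' x => ?_, fun τ hτ => ?_⟩
  · rw [hσ, lmul_of, hmul]
  · ext1 m
    refine ext_of_map₂_eq_top hspan fun c x => ?_
    rw [hσ, hτ.apply hC]

/-- `ρ` and `ρ'` are the left and right multiplications of a non-degenerate homomorphism
`C → M(D)`. -/
structure IsNondegenerateHom (ρ ρ' : C →ₗ[ℂ] Module.End ℂ D) : Prop where
  map_mul : ∀ c c' d, ρ (c * c') d = ρ c (ρ c' d)
  adjoint : ∀ c d d', d * ρ c d' = ρ' c d * d'
  span_left : Submodule.map₂ ρ ⊤ ⊤ = ⊤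
  span_right : Submodule.map₂ ρ' ⊤ ⊤ = ⊤

lemma eq_zero_of_mul_span {ρ : C →ₗ[ℂ] Module.End ℂ D} (hD : IsNondegenerateProduct D)
    (hspan : Submodule.map₂ ρ ⊤ ⊤ = ⊤) {d : D} (h : ∀ c d', d * ρ c d' = 0) : d = 0 := by
  have : LinearMap.mulLeft ℂ d = 0 := ext_of_map₂_eq_top hspan fun c d' => h c d'
  exact hD.1 d fun b => congrArg (fun k => k b) this

lemma eq_zero_of_span_mul {ρ : C →ₗ[ℂ] Module.End ℂ D} (hD : IsNondegenerateProduct D)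
    (hspan : Submodule.map₂ ρ ⊤ ⊤ = ⊤) {d : D} (h : ∀ c d', ρ c d' * d = 0) : d = 0 := by
  have : LinearMap.mulRight ℂ d = 0 := ext_of_map₂_eq_top hspan fun c d' => h c d'
  exact hD.2 d fun b => congrArg (fun k => k b) this

/-- Left and right multiplications are extended separately. Their well-definedness comes from
pairing each with the opposite side, where `adjoint` moves `c` across the product and spanning with
non-degeneracy of `D` concludes. -/
lemma IsNondegenerateHom.exists_extension (hD : IsNondegenerateProduct D)
    {ρ ρ' : C →ₗ[ℂ] Module.End ℂ D} (h : IsNondegenerateHom ρ ρ') :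
    ∃ θ : Multiplier C →ₐ[ℂ] Multiplier D, ∀ m c d, (θ m).lmul (ρ c d) = ρ (m.lmul c) d := by
  obtain ⟨σ, hσ⟩ := exists_extendsAction h.map_mul h.span_left fun x hx =>
    eq_zero_of_span_mul hD h.span_right fun c d => by rw [← h.adjoint, hx, mul_zero]
  have hex : ∀ m : Multiplier C, ∃ R : Module.End ℂ D, ∀ c x, R (ρ' c x) = ρ' (m.rmul c) x := by
    intro m
    apply exists_lift_of_forall h.span_right
    intro t ht
    apply eq_zero_of_mul_span hD h.span_left
    intro c d
    have : ∀ t, TensorProduct.lift (ρ' ∘ₗ m.rmul) t * ρ c d =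
        TensorProduct.lift ρ' t * ρ (m.lmul c) d := by
      intro t
      induction t with
      | zero => simp
      | add u v hu hv => simp only [map_add, add_mul, hu, hv]
      | tmul c' x => simp [← h.adjoint, ← h.map_mul, compat]
    rw [this, ht, zero_mul]
  choose R hR using hex
  have hcompat : ∀ m a b, a * σ m b = R m a * b := by
    intro m a b
    have h1 : ∀ c d, a * σ m (ρ c d) = R m a * ρ c d := by
      intro c d
      rw [hσ]
      have : LinearMap.mulRight ℂ (ρ (m.lmul c) d) = LinearMap.mulRight ℂ (ρ c d) ∘ₗ R m :=
        ext_of_map₂_eq_top h.span_right fun c' d' => by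
          simp [hR, ← h.adjoint, ← h.map_mul, compat]
      exact congrArg (fun k => k a) this
    have : LinearMap.mulLeft ℂ a ∘ₗ σ m = LinearMap.mulLeft ℂ (R m a) :=
      ext_of_map₂_eq_top h.span_left h1
    exact congrArg (fun k => k b) this
  refine ⟨AlgHom.ofLinearMap
    { toFun := fun m => Multiplier.mk' (σ m) (R m) (hcompat m)
      map_add' := fun m n => Multiplier.ext_lmul hD <| by
        ext d; simp
      map_smul' := fun r m => Multiplier.ext_lmul hD <| by
        ext d; simp } ?_ ?_, fun m c d => hσ m c d⟩
  · exact Multiplier.ext_lmul hD <| by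
      ext d
      change σ 1 d = d
      simp
  · intro m n
    refine Multiplier.ext_lmul hD ?_
    ext d
    change σ (m * n) d = σ m (σ n d)
    simp

lemma ExtendsHom.lmul_apply (hC : IsNondegenerateProduct C) {ρ : C →ₗ[ℂ] Module.End ℂ D}
    {θ : Multiplier C →ₐ[ℂ] Multiplier D} (hθ : ExtendsHom ρ θ) (m : Multiplier C) (c : C)
    (d : D) : (θ m).lmul (ρ c d) = ρ (m.lmul c) d := by
  rw [← hθ, ← hθ, ← mul_of hC, map_mul]; rfl

lemma IsNondegenerateHom.existsUnique_extendsHom (hC : IsNondegenerateProduct C)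
    (hD : IsNondegenerateProduct D) {ρ ρ' : C →ₗ[ℂ] Module.End ℂ D}
    (h : IsNondegenerateHom ρ ρ') :
    ∃! θ : Multiplier C →ₐ[ℂ] Multiplier D, ExtendsHom ρ θ := by
  obtain ⟨θ, hθ⟩ := h.exists_extension hD
  refine ⟨θ, fun c => ext_of_map₂_eq_top h.span_left fun c' x => ?_, fun τ hτ => ?_⟩
  · rw [hθ, lmul_of, h.map_mul]
  · ext1 m
    refine Multiplier.ext_lmul hD (ext_of_map₂_eq_top h.span_left fun c x => ?_)
    rw [hθ, hτ.lmul_apply hC]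

lemma isNondegenerateHom_mul (hspan : Submodule.map₂ (LinearMap.mul ℂ C) ⊤ ⊤ = ⊤) :
    IsNondegenerateHom (LinearMap.mul ℂ C) (LinearMap.mul ℂ C).flip where
  map_mul c c' d := by simp [mul_assoc]
  adjoint c d d' := by simp [mul_assoc]
  span_left := hspan
  span_right := map₂_eq_top_of_forall fun _ hS => eq_top_of_map₂_eq_top hspan fun x y => hS y x

end Extend

/-! ### Tensor products and amplifications of non-degenerate homomorphisms -/

section TensorHom

variable {C₁ C₂ X₁ X₂ D₁ D₂ : Type*}
  [NonUnitalRing C₁] [Module ℂ C₁] [IsScalarTower ℂ C₁ C₁] [SMulCommClass ℂ C₁ C₁]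
  [NonUnitalRing C₂] [Module ℂ C₂] [IsScalarTower ℂ C₂ C₂] [SMulCommClass ℂ C₂ C₂]
  [NonUnitalRing D₁] [Module ℂ D₁] [IsScalarTower ℂ D₁ D₁] [SMulCommClass ℂ D₁ D₁]
  [NonUnitalRing D₂] [Module ℂ D₂] [IsScalarTower ℂ D₂ D₂] [SMulCommClass ℂ D₂ D₂]
  [AddCommGroup X₁] [Module ℂ X₁] [AddCommGroup X₂] [Module ℂ X₂]

/-- The tensor product of two representations. -/
abbrev tensorRep (ρ₁ : C₁ →ₗ[ℂ] Module.End ℂ X₁) (ρ₂ : C₂ →ₗ[ℂ] Module.End ℂ X₂) :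
    C₁ ⊗[ℂ] C₂ →ₗ[ℂ] Module.End ℂ (X₁ ⊗[ℂ] X₂) :=
  TensorProduct.homTensorHomMap (RingHom.id ℂ) X₁ X₂ X₁ X₂ ∘ₗ TensorProduct.map ρ₁ ρ₂

lemma tensorRep_tmul (ρ₁ : C₁ →ₗ[ℂ] Module.End ℂ X₁) (ρ₂ : C₂ →ₗ[ℂ] Module.End ℂ X₂)
    (c₁ : C₁) (c₂ : C₂) (x₁ : X₁) (x₂ : X₂) :
    tensorRep ρ₁ ρ₂ (c₁ ⊗ₜ c₂) (x₁ ⊗ₜ x₂) = ρ₁ c₁ x₁ ⊗ₜ ρ₂ c₂ x₂ := rfl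

lemma tensorRep_mul {ρ₁ : C₁ →ₗ[ℂ] Module.End ℂ X₁} {ρ₂ : C₂ →ₗ[ℂ] Module.End ℂ X₂}
    (h₁ : ∀ c c' x, ρ₁ (c * c') x = ρ₁ c (ρ₁ c' x))
    (h₂ : ∀ c c' x, ρ₂ (c * c') x = ρ₂ c (ρ₂ c' x)) (c c' : C₁ ⊗[ℂ] C₂) (x : X₁ ⊗[ℂ] X₂) :
    tensorRep ρ₁ ρ₂ (c * c') x = tensorRep ρ₁ ρ₂ c (tensorRep ρ₁ ρ₂ c' x) := by
  induction c with
  | zero => simp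
  | add u v hu hv => simp only [map_add, LinearMap.add_apply, add_mul, hu, hv]
  | tmul a b =>
    induction c' with
    | zero => simp
    | add u v hu hv => simp only [map_add, LinearMap.add_apply, mul_add, hu, hv]
    | tmul a' b' =>
      induction x with
      | zero => simp
      | add u v hu hv => simp only [map_add, hu, hv]
      | tmul x y =>
        rw [Algebra.TensorProduct.tmul_mul_tmul, tensorRep_tmul, tensorRep_tmul, tensorRep_tmul,
          h₁, h₂]

lemma tensorRep_span {ρ₁ : C₁ →ₗ[ℂ] Module.End ℂ X₁} {ρ₂ : C₂ →ₗ[ℂ] Module.End ℂ X₂}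
    (h₁ : Submodule.map₂ ρ₁ ⊤ ⊤ = ⊤) (h₂ : Submodule.map₂ ρ₂ ⊤ ⊤ = ⊤) :
    Submodule.map₂ (tensorRep ρ₁ ρ₂) ⊤ ⊤ = ⊤ := by
  apply map₂_eq_top_of_forall
  intro S hS
  have h : ∀ x y, x ⊗ₜ[ℂ] y ∈ S := by
    intro x y
    have hx : S.comap ((TensorProduct.mk ℂ X₁ X₂).flip y) = ⊤ := by
      apply eq_top_of_map₂_eq_top h₁
      intro c x
      have hy : S.comap (TensorProduct.mk ℂ X₁ X₂ (ρ₁ c x)) = ⊤ :=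
        eq_top_of_map₂_eq_top h₂ fun c' y => hS (c ⊗ₜ c') (x ⊗ₜ y)
      exact (hy ▸ Submodule.mem_top : y ∈ S.comap (TensorProduct.mk ℂ X₁ X₂ (ρ₁ c x)))
    exact (hx ▸ Submodule.mem_top : x ∈ S.comap ((TensorProduct.mk ℂ X₁ X₂).flip y))
  rw [eq_top_iff]
  rintro t -
  induction t with
  | zero => exact S.zero_mem
  | add u v hu hv => exact S.add_mem hu hv
  | tmul x y => exact h x y

lemma IsNondegenerateHom.tensor {ρ₁ ρ₁' : C₁ →ₗ[ℂ] Module.End ℂ D₁}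
    {ρ₂ ρ₂' : C₂ →ₗ[ℂ] Module.End ℂ D₂} (h₁ : IsNondegenerateHom ρ₁ ρ₁')
    (h₂ : IsNondegenerateHom ρ₂ ρ₂') :
    IsNondegenerateHom (tensorRep ρ₁ ρ₂) (tensorRep ρ₁' ρ₂') where
  map_mul := tensorRep_mul h₁.map_mul h₂.map_mul
  adjoint c d d' := by
    induction c with
    | zero => simp
    | add u v hu hv => simp only [map_add, LinearMap.add_apply, add_mul, mul_add, hu, hv]
    | tmul a b =>
      induction d with
      | zero => simp
      | add u v hu hv => simp only [map_add, add_mul, hu, hv]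
      | tmul x y =>
        induction d' with
        | zero => simp
        | add u v hu hv => simp only [map_add, mul_add, hu, hv]
        | tmul x' y' =>
          rw [tensorRep_tmul, tensorRep_tmul, Algebra.TensorProduct.tmul_mul_tmul,
            Algebra.TensorProduct.tmul_mul_tmul, h₁.adjoint, h₂.adjoint]
  span_left := tensorRep_span h₁.span_left h₂.span_left
  span_right := tensorRep_span h₁.span_right h₂.span_right

lemma rTensorHom_span {ρ : C₁ →ₗ[ℂ] Module.End ℂ X₁} (h : Submodule.map₂ ρ ⊤ ⊤ = ⊤) :
    Submodule.map₂ (LinearMap.rTensorHom X₂ ∘ₗ ρ) ⊤ ⊤ = ⊤ := by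
  apply map₂_eq_top_of_forall
  intro S hS
  rw [eq_top_iff]
  rintro t -
  induction t with
  | zero => exact S.zero_mem
  | add u v hu hv => exact S.add_mem hu hv
  | tmul x y =>
    have hx : S.comap ((TensorProduct.mk ℂ X₁ X₂).flip y) = ⊤ :=
      eq_top_of_map₂_eq_top h fun c x => hS c (x ⊗ₜ y)
    exact (hx ▸ Submodule.mem_top : x ∈ S.comap ((TensorProduct.mk ℂ X₁ X₂).flip y))

lemma lTensorHom_span {ρ : C₁ →ₗ[ℂ] Module.End ℂ X₁} (h : Submodule.map₂ ρ ⊤ ⊤ = ⊤) :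
    Submodule.map₂ (LinearMap.lTensorHom X₂ ∘ₗ ρ) ⊤ ⊤ = ⊤ := by
  apply map₂_eq_top_of_forall
  intro S hS
  rw [eq_top_iff]
  rintro t -
  induction t with
  | zero => exact S.zero_mem
  | add u v hu hv => exact S.add_mem hu hv
  | tmul y x =>
    have hx : S.comap (TensorProduct.mk ℂ X₂ X₁ y) = ⊤ :=
      eq_top_of_map₂_eq_top h fun c x => hS c (y ⊗ₜ x)
    exact (hx ▸ Submodule.mem_top : x ∈ S.comap (TensorProduct.mk ℂ X₂ X₁ y))

lemma IsNondegenerateHom.rTensor {ρ ρ' : C₁ →ₗ[ℂ] Module.End ℂ D₁}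
    (h : IsNondegenerateHom ρ ρ') :
    IsNondegenerateHom (LinearMap.rTensorHom D₂ ∘ₗ ρ) (LinearMap.rTensorHom D₂ ∘ₗ ρ') where
  map_mul c c' d := by
    induction d with
    | zero => simp
    | add u v hu hv => simp only [map_add, hu, hv]
    | tmul x y => simp [h.map_mul]
  adjoint c d d' := by
    induction d with
    | zero => simp
    | add u v hu hv => simp only [map_add, add_mul, hu, hv]
    | tmul x y =>
      induction d' with
      | zero => simp
      | add u v hu hv => simp only [map_add, mul_add, hu, hv]
      | tmul x' y' => simp [h.adjoint]
  span_left := rTensorHom_span h.span_left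
  span_right := rTensorHom_span h.span_right

lemma IsNondegenerateHom.lTensor {ρ ρ' : C₁ →ₗ[ℂ] Module.End ℂ D₁}
    (h : IsNondegenerateHom ρ ρ') :
    IsNondegenerateHom (LinearMap.lTensorHom D₂ ∘ₗ ρ) (LinearMap.lTensorHom D₂ ∘ₗ ρ') where
  map_mul c c' d := by
    induction d with
    | zero => simp
    | add u v hu hv => simp only [map_add, hu, hv]
    | tmul x y => simp [h.map_mul]
  adjoint c d d' := by
    induction d with
    | zero => simp
    | add u v hu hv => simp only [map_add, add_mul, hu, hv]
    | tmul x y =>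
      induction d' with
      | zero => simp
      | add u v hu hv => simp only [map_add, mul_add, hu, hv]
      | tmul x' y' => simp [h.adjoint]
  span_left := lTensorHom_span h.span_left
  span_right := lTensorHom_span h.span_right

end TensorHom

namespace AlgebraicQuantumGroup

variable {A : Type*} [NonUnitalRing A] [Module ℂ A] [IsScalarTower ℂ A A] [SMulCommClass ℂ A A]
variable (G : AlgebraicQuantumGroup A)

open Multiplier

/-! ### The Heisenberg algebra -/

/-- The representation of the Heisenberg algebra on `A`. -/
def heisRep : G.Heisenberg →ₗ[ℂ] Module.End ℂ A := G.heisAct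

lemma heisRep_tmul (a : A) (b : G.Dual) (x : A) :
    G.heisRep (a ⊗ₜ[ℂ] b : A ⊗[ℂ] G.Dual) x = a * G.act b x := rfl

lemma heisRep_injective : Function.Injective G.heisRep := G.heisAct_injective

lemma heisRep_mul (h k : G.Heisenberg) (x : A) :
    G.heisRep (h * k) x = G.heisRep h (G.heisRep k x) := G.heisAct_heisMul h k x

lemma heisenberg_induction {p : G.Heisenberg → Prop} (zero : p 0)
    (tmul : ∀ (a : A) (b : G.Dual), p (a ⊗ₜ[ℂ] b : A ⊗[ℂ] G.Dual))
    (add : ∀ h k, p h → p k → p (h + k)) (h : G.Heisenberg) : p h :=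
  TensorProduct.induction_on (motive := p) h zero tmul add

lemma heisRep_ext {h k : G.Heisenberg} (hk : ∀ x, G.heisRep h x = G.heisRep k x) : h = k :=
  G.heisRep_injective (LinearMap.ext hk)

lemma map₂_heisRep_eq_top : Submodule.map₂ G.heisRep ⊤ ⊤ = ⊤ := by
  apply map₂_eq_top_of_forall
  intro S hS
  apply eq_top_of_map₂_eq_top G.map₂_mul_eq_top
  intro a x
  have : S.comap (LinearMap.mul ℂ A a) = ⊤ :=
    eq_top_of_map₂_eq_top G.map₂_act_eq_top fun b x => hS (a ⊗ₜ[ℂ] b : A ⊗[ℂ] G.Dual) x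
  exact (this ▸ Submodule.mem_top : x ∈ S.comap (LinearMap.mul ℂ A a))

lemma heisenberg_nondegenerate : IsNondegenerateProduct G.Heisenberg := by
  constructor
  · intro h hh
    apply G.heisRep_injective
    rw [map_zero]
    refine ext_of_map₂_eq_top G.map₂_heisRep_eq_top fun k x => ?_
    rw [← heisRep_mul, hh]; simp
  · intro h hh
    apply G.heisRep_ext
    intro x
    rw [map_zero, LinearMap.zero_apply]
    apply G.eq_zero_of_act
    intro b
    apply G.mul_left_ext
    intro a
    have : ∀ k, G.heisRep k (G.heisRep h x) = 0 := fun k => by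
      rw [← heisRep_mul, hh]; simp
    rw [mul_zero]
    exact this (a ⊗ₜ[ℂ] b : A ⊗[ℂ] G.Dual)

lemma heisRep_jA (a : A) (h : G.Heisenberg) (x : A) :
    G.heisRep (G.jA a h) x = a * G.heisRep h x := G.heisAct_heisLeftA a h x

lemma heisRep_jB (b : G.Dual) (h : G.Heisenberg) (x : A) :
    G.heisRep (G.jB b h) x = G.act b (G.heisRep h x) := by
  induction h using heisenberg_induction with
  | zero => simp
  | add h k hh hk => simp only [map_add, LinearMap.add_apply, hh, hk]
  | tmul a' b' => exact G.act_mul_act b b' a' x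

/-- Right multiplication by `j_A(a)`: `(a' ⊗ b') j_A(a) = ∑ u ⊗ (b' ◁ v)` where
`∑ u ⊗ v = (a' ⊗ 1)Δ(a)`. -/
def jAR : A →ₗ[ℂ] Module.End ℂ G.Heisenberg where
  toFun a := (TensorProduct.lift (LinearMap.mk₂ ℂ
      (fun a' b' => (G.actDualR.flip b').lTensor A (G.T₂ (a' ⊗ₜ a)))
      (fun u u' b' => by simp [TensorProduct.add_tmul])
      (fun r u b' => by simp [← TensorProduct.smul_tmul'])
      (fun u b b' => by simp [LinearMap.lTensor_add])
      (fun r u b => by simp [LinearMap.lTensor_smul])) :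
    A ⊗[ℂ] G.Dual →ₗ[ℂ] A ⊗[ℂ] G.Dual)
  map_add' a a' := by
    refine TensorProduct.ext' (M := A) (N := G.Dual) fun x b => ?_
    change (G.actDualR.flip b).lTensor A (G.T₂ (x ⊗ₜ (a + a'))) =
      (G.actDualR.flip b).lTensor A (G.T₂ (x ⊗ₜ a)) + (G.actDualR.flip b).lTensor A (G.T₂ (x ⊗ₜ a'))
    rw [TensorProduct.tmul_add, map_add, map_add]
  map_smul' r a := by
    refine TensorProduct.ext' (M := A) (N := G.Dual) fun x b => ?_
    change (G.actDualR.flip b).lTensor A (G.T₂ (x ⊗ₜ (r • a))) =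
      r • (G.actDualR.flip b).lTensor A (G.T₂ (x ⊗ₜ a))
    rw [TensorProduct.tmul_smul, map_smul, map_smul]

lemma jAR_tmul (a a' : A) (b : G.Dual) :
    G.jAR a (a' ⊗ₜ[ℂ] b : A ⊗[ℂ] G.Dual) = (G.actDualR.flip b).lTensor A (G.T₂ (a' ⊗ₜ a)) := rfl

/-- Right multiplication by `j_B(b)`: `(a' ⊗ b') j_B(b) = a' ⊗ b'b`. -/
def jBR : G.Dual →ₗ[ℂ] Module.End ℂ G.Heisenberg :=
  (LinearMap.lTensorHom A ∘ₗ (LinearMap.mul ℂ G.Dual).flip :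
    G.Dual →ₗ[ℂ] Module.End ℂ (A ⊗[ℂ] G.Dual))

lemma jBR_tmul (a : A) (b b' : G.Dual) :
    G.jBR b (a ⊗ₜ[ℂ] b' : A ⊗[ℂ] G.Dual) = (a ⊗ₜ[ℂ] (b' * b) : A ⊗[ℂ] G.Dual) := rfl

lemma heisRep_jBR (b : G.Dual) (h : G.Heisenberg) (x : A) :
    G.heisRep (G.jBR b h) x = G.heisRep h (G.act b x) := by
  induction h using heisenberg_induction with
  | zero => simp
  | add h k hh hk => simp only [map_add, LinearMap.add_apply, hh, hk]
  | tmul a' b' => rw [jBR_tmul, heisRep_tmul, heisRep_tmul, act_mul]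

/-- This confirms the formula for `jAR`. Multiplicativity of `Δ` enters through `T₂_mul_T₃`, which
splits `Δ(ax)` covered on both sides into the product of two covered coproducts. -/
lemma heisRep_jAR (a : A) (h : G.Heisenberg) (x : A) :
    G.heisRep (G.jAR a h) x = G.heisRep h (a * x) := by
  induction h using heisenberg_induction with
  | zero => simp
  | add h k hh hk => simp only [map_add, LinearMap.add_apply, hh, hk]
  | tmul a' b =>
    apply G.mul_right_ext
    intro y
    rw [jAR_tmul, heisRep_tmul, mul_assoc, act_mul_right', ← sliceR_mulL₁, ← T₂_mul_T₃]
    generalize G.T₂ (a' ⊗ₜ a) = t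
    change G.heisAct _ x * y = _
    induction t with
    | zero => simp
    | add u v hu hv => simp only [map_add, LinearMap.add_apply, add_mul, hu, hv]
    | tmul u v =>
      rw [LinearMap.lTensor_tmul, heisAct_tmul, mul_assoc, LinearMap.flip_apply, act_mul_right',
        mul_tensor_eq, sliceR_lTensor, sliceR_rTensor]
      rfl

/-- The algebraic identities are read off in the faithful representation on `A`. For the right
multiplications, spanning follows from surjectivity of `T₂` and `B ◁ A = B`. -/
lemma isNondegenerateHom_jA : IsNondegenerateHom G.jA G.jAR where
  map_mul a a' h := G.heisRep_ext fun x => by simp only [heisRep_jA, mul_assoc]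
  adjoint a h k := G.heisRep_ext fun x => by simp only [heisRep_mul, heisRep_jA, heisRep_jAR]
  span_left := rTensorHom_span (X₂ := G.Dual) G.map₂_mul_eq_top
  span_right := by
    apply map₂_eq_top_of_forall
    intro S hS
    have h1 : ∀ (b : G.Dual) (t : A ⊗[ℂ] A), (G.actDualR.flip b).lTensor A t ∈ S := by
      intro b t
      obtain ⟨s, rfl⟩ := G.T₂.surjective t
      induction s with
      | zero => rw [map_zero, map_zero]; exact S.zero_mem
      | add u v hu hv => rw [map_add, map_add]; exact S.add_mem hu hv
      | tmul a' a => exact hS a (a' ⊗ₜ[ℂ] b : A ⊗[ℂ] G.Dual)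
    rw [eq_top_iff]
    rintro h -
    induction h using heisenberg_induction with
    | zero => exact S.zero_mem
    | add u v hu hv => exact S.add_mem hu hv
    | tmul a b =>
      have : Submodule.comap (TensorProduct.mk ℂ A G.Dual a) S = ⊤ :=
        eq_top_of_map₂_eq_top G.map₂_actDualR_eq_top fun v b => h1 b (a ⊗ₜ v)
      exact (this ▸ Submodule.mem_top : b ∈ Submodule.comap (TensorProduct.mk ℂ A G.Dual a) S)

lemma dualT₁_surjective : Function.Surjective G.dualT₁ := by
  intro s
  obtain ⟨t, rfl⟩ := G.map_toDual_surjective s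
  refine ⟨_, (G.dualT₁_T₃ ((TensorProduct.comm ℂ A A).symm t)).trans ?_⟩
  rw [LinearEquiv.apply_symm_apply]

/-- Here it is the left multiplications whose spanning needs an argument: surjectivity of the
canonical map of the dual together with `B ▷ A = A`. -/
lemma isNondegenerateHom_jB : IsNondegenerateHom G.jB G.jBR where
  map_mul b b' h := G.heisRep_ext fun x => by simp only [heisRep_jB, act_mul]
  adjoint b h k := G.heisRep_ext fun x => by simp only [heisRep_mul, heisRep_jB, heisRep_jBR]
  span_left := by
    apply map₂_eq_top_of_forall
    intro S hS
    have h1 : ∀ (a : A) (t : G.Dual ⊗[ℂ] G.Dual), (G.act.flip a).rTensor G.Dual t ∈ S := by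
      intro a t
      obtain ⟨s, rfl⟩ := G.dualT₁_surjective t
      induction s with
      | zero => rw [map_zero, map_zero]; exact S.zero_mem
      | add u v hu hv => rw [map_add, map_add]; exact S.add_mem hu hv
      | tmul b b' => exact hS b (a ⊗ₜ[ℂ] b' : A ⊗[ℂ] G.Dual)
    rw [eq_top_iff]
    rintro h -
    induction h using heisenberg_induction with
    | zero => exact S.zero_mem
    | add u v hu hv => exact S.add_mem hu hv
    | tmul a b =>
      have : Submodule.comap ((TensorProduct.mk ℂ A G.Dual).flip b) S = ⊤ :=
        eq_top_of_map₂_eq_top G.map₂_act_eq_top fun b' a => h1 a (b' ⊗ₜ b)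
      exact (this ▸ Submodule.mem_top :
        a ∈ Submodule.comap ((TensorProduct.mk ℂ A G.Dual).flip b) S)
  span_right := lTensorHom_span (X₂ := A)
    (isNondegenerateHom_mul G.map₂_dual_mul_eq_top).span_right

/-! ### The three legs -/

lemma isNondegenerateHom_mul_self (G : AlgebraicQuantumGroup A) :
    IsNondegenerateHom (LinearMap.mul ℂ A) (LinearMap.mul ℂ A).flip :=
  isNondegenerateHom_mul G.map₂_mul_eq_top

lemma isNondegenerateHom_leg₁₂ : ∃ ρ',
    IsNondegenerateHom (D := G.Dual ⊗[ℂ] (G.Heisenberg ⊗[ℂ] A)) G.leg₁₂ ρ' :=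
  ⟨_, (isNondegenerateHom_mul G.map₂_dual_mul_eq_top).tensor G.isNondegenerateHom_jA.rTensor⟩

lemma isNondegenerateHom_leg₁₃ : ∃ ρ',
    IsNondegenerateHom (D := G.Dual ⊗[ℂ] (G.Heisenberg ⊗[ℂ] A)) G.leg₁₃ ρ' :=
  ⟨_, (isNondegenerateHom_mul G.map₂_dual_mul_eq_top).tensor
    G.isNondegenerateHom_mul_self.lTensor⟩

lemma isNondegenerateHom_leg₂₃ : ∃ ρ',
    IsNondegenerateHom (D := G.Dual ⊗[ℂ] (G.Heisenberg ⊗[ℂ] A)) G.leg₂₃ ρ' :=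
  ⟨_, (G.isNondegenerateHom_jB.tensor G.isNondegenerateHom_mul_self).lTensor⟩

lemma nondegenerate_legs :
    IsNondegenerateProduct (G.Dual ⊗[ℂ] (G.Heisenberg ⊗[ℂ] A)) :=
  G.dual_nondegenerate.tensor (G.heisenberg_nondegenerate.tensor G.nondegenerate)

/-! ### The action on `A ⊗ A` -/

lemma actTensor_tmul (t : G.Dual ⊗[ℂ] A) (x x' : A) :
    G.actTensor t (x ⊗ₜ x') = mulR₂ x' (G.actL x t) := by
  induction t with
  | zero => simp
  | add u v hu hv => simp only [map_add, LinearMap.add_apply, hu, hv]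
  | tmul b a => rfl

lemma T₁_mulR₂ (d : A) (t : A ⊗[ℂ] A) : G.T₁ (mulR₂ d t) = mulR₂ d (G.T₁ t) := by
  induction t with
  | zero => simp
  | add u v hu hv => simp only [map_add, hu, hv]
  | tmul a b =>
    apply G.mul_right_ext₂
    intro t
    rw [mulR₂_mul_eq, LinearMap.lTensor_tmul, T₁_mul_eq, T₁_mul_eq, LinearMap.mulRight_apply,
      mulL₂, LinearMap.mulLeft_mul, LinearMap.lTensor_comp, LinearMap.comp_apply]

/-- Under the action of `B ⊗ A` on `A ⊗ A`, the duality acts as the canonical map. -/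
lemma actTensor_duality (t : G.Dual ⊗[ℂ] A) :
    G.actTensor (G.duality.lmul t) = G.T₁.toLinearMap ∘ₗ G.actTensor t := by
  apply TensorProduct.ext'
  intro x x'
  rw [LinearMap.comp_apply, actTensor_tmul, actTensor_tmul, LinearEquiv.coe_coe, T₁_mulR₂,
    lmul_duality, actL_dualityL]

lemma actTensor_span : Submodule.map₂ G.actTensor ⊤ ⊤ = ⊤ :=
  tensorRep_span G.map₂_act_eq_top G.map₂_mul_eq_top

lemma actTensor_faithful (x : A ⊗[ℂ] A) (hx : ∀ c, G.actTensor c x = 0) : x = 0 := by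
  apply rTensor_jointly_injective (fun b => G.act b) (fun x hx => G.eq_zero_of_act x hx)
  intro b
  apply lTensor_jointly_injective (fun a : A => LinearMap.mulLeft ℂ a)
    (fun x hx => G.nondegenerate.2 x hx)
  intro a
  have h := hx (b ⊗ₜ a)
  rw [← h]
  clear h hx
  induction x with
  | zero => simp
  | add u v hu hv => simp only [map_add, hu, hv]
  | tmul x y => rfl

lemma existsUnique_extendsAction_actTensor :
    ∃! σ : Multiplier (G.Dual ⊗[ℂ] A) →ₐ[ℂ] Module.End ℂ (A ⊗[ℂ] A),
      ExtendsAction G.actTensor σ :=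
  existsUnique_extendsAction G.nondegenerate_dual_tensor
    (tensorRep_mul G.act_mul (fun a b x => by simp [mul_assoc])) G.actTensor_span
    G.actTensor_faithful

lemma extension_duality {σ : Multiplier (G.Dual ⊗[ℂ] A) →ₐ[ℂ] Module.End ℂ (A ⊗[ℂ] A)}
    (hσ : ExtendsAction G.actTensor σ) : σ G.duality = G.T₁.toLinearMap :=
  ext_of_map₂_eq_top G.actTensor_span fun c x => by
    rw [hσ.apply G.nondegenerate_dual_tensor, actTensor_duality]; rfl

/-! ### The pentagon equation -/

/-- The canonical map on the first two legs of `A ⊗ A ⊗ A`. -/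
def T₁₂ : Module.End ℂ (A ⊗[ℂ] (A ⊗[ℂ] A)) :=
  (TensorProduct.assoc ℂ A A A).toLinearMap ∘ₗ G.T₁.toLinearMap.rTensor A ∘ₗ
    (TensorProduct.assoc ℂ A A A).symm.toLinearMap

/-- The canonical map on the first and the last leg of `A ⊗ A ⊗ A`. -/
def T₁₃ : Module.End ℂ (A ⊗[ℂ] (A ⊗[ℂ] A)) :=
  (TensorProduct.leftComm ℂ A A A).toLinearMap ∘ₗ G.T₁.toLinearMap.lTensor A ∘ₗ
    (TensorProduct.leftComm ℂ A A A).toLinearMap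

/-- The canonical map on the last two legs of `A ⊗ A ⊗ A`. -/
def T₂₃ : Module.End ℂ (A ⊗[ℂ] (A ⊗[ℂ] A)) := G.T₁.toLinearMap.lTensor A

/-- The map `x ↦ Δ(x) t`. -/
def comulMul (t : A ⊗[ℂ] A) : A →ₗ[ℂ] A ⊗[ℂ] A where
  toFun x := (G.Δ x).lmul t
  map_add' x y := by rw [map_add]; rfl
  map_smul' r x := by rw [map_smul]; rfl

lemma comulMul_apply (t : A ⊗[ℂ] A) (x : A) : G.comulMul t x = (G.Δ x).lmul t := rfl

lemma comulMul_zero : G.comulMul 0 = 0 := by ext x; exact map_zero (G.Δ x).lmul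

lemma comulMul_add (s t : A ⊗[ℂ] A) : G.comulMul (s + t) = G.comulMul s + G.comulMul t := by
  ext x; exact map_add (G.Δ x).lmul s t

/-- Coassociativity: `T₁₂ T₁₃` multiplies `1 ⊗ t` on the left by `(Δ ⊗ ι)Δ(x)`, while the right side
does so by `(ι ⊗ Δ)Δ(x)`. The factor `w` keeps everything inside the tensor product. -/
lemma mulLeft_T₁₂_T₁₃ (w x : A) (t : A ⊗[ℂ] A) :
    (LinearMap.mulLeft ℂ w).rTensor (A ⊗[ℂ] A) (G.T₁₂ (G.T₁₃ (x ⊗ₜ t))) =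
      (G.comulMul t).lTensor A (G.T₂ (w ⊗ₜ x)) := by
  induction t with
  | zero => simp [comulMul_zero]
  | add u v hu hv =>
    simp only [TensorProduct.tmul_add, map_add, comulMul_add, LinearMap.lTensor_add,
      LinearMap.add_apply, hu, hv]
  | tmul p q =>
    have h1 : ∀ s : A ⊗[ℂ] A, (LinearMap.mulLeft ℂ w).rTensor (A ⊗[ℂ] A)
        (G.T₁₂ (TensorProduct.leftComm ℂ A A A (p ⊗ₜ s))) =
          (mulR₁ p).lTensor A (G.comulL w s) := by
      intro s
      induction s with
      | zero => simp
      | add u v hu hv => simp only [TensorProduct.tmul_add, map_add, hu, hv]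
      | tmul e f =>
        have h2 : G.T₁₂ (TensorProduct.leftComm ℂ A A A (p ⊗ₜ (e ⊗ₜ f))) =
            ((TensorProduct.mk ℂ A A).flip f).lTensor A (G.T₁ (e ⊗ₜ p)) := by
          rw [← assoc_tmul_eq]; rfl
        rw [h2, comulL_tmul', ← LinearMap.comp_apply (LinearMap.lTensor A _),
          ← LinearMap.lTensor_comp, ← LinearMap.comp_apply, LinearMap.rTensor_comp_lTensor,
          ← LinearMap.lTensor_comp_rTensor, LinearMap.comp_apply, ← G.mulR₂_T₂,
          ← LinearMap.comp_apply, ← LinearMap.lTensor_comp]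
        congr 2
    have h3 : G.T₁₃ (x ⊗ₜ (p ⊗ₜ q)) =
        TensorProduct.leftComm ℂ A A A (p ⊗ₜ G.T₁ (x ⊗ₜ q)) := rfl
    rw [h3, h1, comulL_T₁, ← LinearMap.comp_apply, ← LinearMap.lTensor_comp]
    congr 2
    ext s
    rw [LinearMap.comp_apply, T₁at_apply, T₁_mulRight, comulMul_apply]

/-- Multiplicativity of `Δ`, in the form `Δ(sy)(1 ⊗ z) = Δ(s)T₁(y ⊗ z)`, applied to the second leg
of `(w ⊗ 1)Δ(x)`. -/
lemma mulLeft_T₂₃_T₁₂ (w x y z : A) :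
    (LinearMap.mulLeft ℂ w).rTensor (A ⊗[ℂ] A) (G.T₂₃ (G.T₁₂ (x ⊗ₜ (y ⊗ₜ z)))) =
      (G.comulMul (G.T₁ (y ⊗ₜ z))).lTensor A (G.T₂ (w ⊗ₜ x)) := by
  have h : G.T₁₂ (x ⊗ₜ (y ⊗ₜ z)) =
      ((TensorProduct.mk ℂ A A).flip z).lTensor A (G.T₁ (x ⊗ₜ y)) := by
    rw [← assoc_tmul_eq]; rfl
  rw [h, T₂₃, ← LinearMap.comp_apply (LinearMap.lTensor A _), ← LinearMap.lTensor_comp,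
    ← LinearMap.comp_apply, LinearMap.rTensor_comp_lTensor, ← LinearMap.lTensor_comp_rTensor,
    LinearMap.comp_apply, ← G.mulR₂_T₂, ← LinearMap.comp_apply, ← LinearMap.lTensor_comp]
  congr 2
  ext s
  exact G.T₁_mul s y z

lemma T_pentagon : G.T₁₂ * G.T₁₃ * G.T₂₃ = G.T₂₃ * G.T₁₂ := by
  apply TensorProduct.ext_threefold'
  intro x y z
  rw [← sub_eq_zero]
  apply rTensor_jointly_injective (fun a : A => LinearMap.mulLeft ℂ a)
    (fun x hx => G.nondegenerate.2 x hx)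
  intro w
  rw [map_sub, sub_eq_zero, Module.End.mul_apply, Module.End.mul_apply, Module.End.mul_apply,
    mulLeft_T₂₃_T₁₂, ← mulLeft_T₁₂_T₁₃]
  rfl

/-- The action of `B ⊗ AB ⊗ A` on `A ⊗ A ⊗ A`. -/
def legsRep : G.Dual ⊗[ℂ] (G.Heisenberg ⊗[ℂ] A) →ₗ[ℂ] Module.End ℂ (A ⊗[ℂ] (A ⊗[ℂ] A)) :=
  tensorRep G.act (tensorRep G.heisRep (LinearMap.mul ℂ A))

lemma legsRep_tmul (b : G.Dual) (h : G.Heisenberg) (a x y z : A) :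
    G.legsRep (b ⊗ₜ (h ⊗ₜ a)) (x ⊗ₜ (y ⊗ₜ z)) = G.act b x ⊗ₜ (G.heisRep h y ⊗ₜ (a * z)) := rfl

/-- Each tensor factor acts faithfully on its own leg, and joint injectivity passes to tensor
products one factor at a time. -/
lemma legsRep_injective : Function.Injective G.legsRep := by
  rw [injective_iff_map_eq_zero]
  intro t ht
  apply rTensor_jointly_injective (fun x => G.act.flip x) (fun b hb => G.dual_eq_zero_of_act b hb)
  intro x
  apply lTensor_jointly_injective (fun yz : A × A =>
    (LinearMap.mulRight ℂ yz.2).lTensor A ∘ₗ (G.heisRep.flip yz.1).rTensor A)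
  · intro s hs
    apply rTensor_jointly_injective (fun y => G.heisRep.flip y)
      (fun h hh => G.heisRep_ext fun y => by simpa using hh y)
    intro y
    apply lTensor_jointly_injective (fun z : A => LinearMap.mulRight ℂ z)
      (fun x hx => G.nondegenerate.1 x hx)
    intro z
    exact hs (y, z)
  · rintro ⟨y, z⟩
    have : ∀ t, ((LinearMap.mulRight ℂ z).lTensor A ∘ₗ (G.heisRep.flip y).rTensor A).lTensor A
        ((G.act.flip x).rTensor _ t) = G.legsRep t (x ⊗ₜ (y ⊗ₜ z)) := by
      intro t
      induction t with
      | zero => simp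
      | add u v hu hv => simp only [map_add, LinearMap.add_apply, hu, hv]
      | tmul b s =>
        induction s with
        | zero => simp
        | add u v hu hv => simp only [TensorProduct.tmul_add, map_add, LinearMap.add_apply, hu, hv]
        | tmul h a => rfl
    rw [this, ht]; rfl

lemma legsRep_ext₃ {P Q : G.Dual ⊗[ℂ] (G.Heisenberg ⊗[ℂ] A) →ₗ[ℂ]
    Module.End ℂ (A ⊗[ℂ] (A ⊗[ℂ] A))}
    (h : ∀ b k a x y z, P (b ⊗ₜ (k ⊗ₜ a)) (x ⊗ₜ (y ⊗ₜ z)) = Q (b ⊗ₜ (k ⊗ₜ a)) (x ⊗ₜ (y ⊗ₜ z)))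
    (d : G.Dual ⊗[ℂ] (G.Heisenberg ⊗[ℂ] A)) : P d = Q d := by
  have : P = Q := TensorProduct.ext_threefold' fun b k a =>
    TensorProduct.ext_threefold' fun x y z => h b k a x y z
  rw [this]

/-- If a leg of `M(B ⊗ A)` corresponds to the representation `γ` on `A ⊗ A ⊗ A`, and the duality
acts as `τ`, then its image in `M(B ⊗ AB ⊗ A)` acts as `τ`. -/
lemma legsRep_lmul {ρ : G.Dual ⊗[ℂ] A →ₗ[ℂ] Module.End ℂ (G.Dual ⊗[ℂ] (G.Heisenberg ⊗[ℂ] A))}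
    (hρ : Submodule.map₂ ρ ⊤ ⊤ = ⊤)
    {θ : Multiplier (G.Dual ⊗[ℂ] A) →ₐ[ℂ] Multiplier (G.Dual ⊗[ℂ] (G.Heisenberg ⊗[ℂ] A))}
    (hθ : ExtendsHom ρ θ)
    {γ : G.Dual ⊗[ℂ] A →ₗ[ℂ] Module.End ℂ (A ⊗[ℂ] (A ⊗[ℂ] A))}
    (hγ : ∀ c d, G.legsRep (ρ c d) = γ c * G.legsRep d)
    {τ : Module.End ℂ (A ⊗[ℂ] (A ⊗[ℂ] A))} (hτ : ∀ c, γ (G.duality.lmul c) = τ * γ c)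
    (d : G.Dual ⊗[ℂ] (G.Heisenberg ⊗[ℂ] A)) :
    G.legsRep ((θ G.duality).lmul d) = τ * G.legsRep d := by
  have : G.legsRep ∘ₗ (θ G.duality).lmul = LinearMap.mulLeft ℂ τ ∘ₗ G.legsRep :=
    ext_of_map₂_eq_top hρ fun c d => by
      simp only [LinearMap.comp_apply, LinearMap.mulLeft_apply]
      rw [hθ.lmul_apply G.nondegenerate_dual_tensor, hγ, hγ, hτ, mul_assoc]
  exact congrArg (fun k => k d) this

lemma legsRep_lmul₁₂
    {θ : Multiplier (G.Dual ⊗[ℂ] A) →ₐ[ℂ] Multiplier (G.Dual ⊗[ℂ] (G.Heisenberg ⊗[ℂ] A))}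
    (hθ : ExtendsHom G.leg₁₂ θ) (d : G.Dual ⊗[ℂ] (G.Heisenberg ⊗[ℂ] A)) :
    G.legsRep ((θ G.duality).lmul d) = G.T₁₂ * G.legsRep d := by
  obtain ⟨ρ', hρ⟩ := G.isNondegenerateHom_leg₁₂
  let γ : G.Dual ⊗[ℂ] A →ₗ[ℂ] Module.End ℂ (A ⊗[ℂ] (A ⊗[ℂ] A)) :=
    tensorRep G.act (LinearMap.rTensorHom A ∘ₗ LinearMap.mul ℂ A)
  have hγ' : ∀ c, γ c = (TensorProduct.assoc ℂ A A A).toLinearMap ∘ₗ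
      (G.actTensor c).rTensor A ∘ₗ (TensorProduct.assoc ℂ A A A).symm.toLinearMap := by
    intro c
    refine TensorProduct.ext_threefold' fun x y z => ?_
    induction c with
    | zero => simp
    | add u v hu hv =>
      simp only [map_add, LinearMap.add_apply, LinearMap.rTensor_add, LinearMap.comp_apply] at hu hv ⊢
      rw [hu, hv]
    | tmul b a => rfl
  refine G.legsRep_lmul (γ := γ) hρ.span_left hθ (fun c => ?_) (fun c => ?_) d
  · induction c with
    | zero => simp
    | add u v hu hv => intro d; simp only [map_add, LinearMap.add_apply, add_mul, hu, hv]
    | tmul b a =>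
      refine G.legsRep_ext₃ (P := G.legsRep ∘ₗ G.leg₁₂ (b ⊗ₜ a))
        (Q := LinearMap.mulLeft ℂ (γ (b ⊗ₜ a)) ∘ₗ G.legsRep) fun b' k a' x y z => ?_
      change G.legsRep ((b * b') ⊗ₜ (G.jA a k ⊗ₜ a')) (x ⊗ₜ (y ⊗ₜ z)) =
        γ (b ⊗ₜ a) (G.legsRep (b' ⊗ₜ (k ⊗ₜ a')) (x ⊗ₜ (y ⊗ₜ z)))
      rw [legsRep_tmul, legsRep_tmul, act_mul, heisRep_jA]; rfl
  · rw [hγ', hγ', actTensor_duality, LinearMap.rTensor_comp]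
    refine TensorProduct.ext_threefold' fun x y z => ?_
    simp [T₁₂]

lemma legsRep_lmul₁₃
    {θ : Multiplier (G.Dual ⊗[ℂ] A) →ₐ[ℂ] Multiplier (G.Dual ⊗[ℂ] (G.Heisenberg ⊗[ℂ] A))}
    (hθ : ExtendsHom G.leg₁₃ θ) (d : G.Dual ⊗[ℂ] (G.Heisenberg ⊗[ℂ] A)) :
    G.legsRep ((θ G.duality).lmul d) = G.T₁₃ * G.legsRep d := by
  obtain ⟨ρ', hρ⟩ := G.isNondegenerateHom_leg₁₃
  let γ : G.Dual ⊗[ℂ] A →ₗ[ℂ] Module.End ℂ (A ⊗[ℂ] (A ⊗[ℂ] A)) :=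
    tensorRep G.act (LinearMap.lTensorHom A ∘ₗ LinearMap.mul ℂ A)
  have hγ' : ∀ c, γ c = (TensorProduct.leftComm ℂ A A A).toLinearMap ∘ₗ
      (G.actTensor c).lTensor A ∘ₗ (TensorProduct.leftComm ℂ A A A).toLinearMap := by
    intro c
    refine TensorProduct.ext_threefold' fun x y z => ?_
    induction c with
    | zero => simp
    | add u v hu hv =>
      simp only [map_add, LinearMap.add_apply, LinearMap.lTensor_add, LinearMap.comp_apply] at hu hv ⊢
      rw [hu, hv]
    | tmul b a => rfl
  -- The flip is an involution, which lets conjugations by it compose.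
  have hcomm : ∀ t, TensorProduct.leftComm ℂ A A A (TensorProduct.leftComm ℂ A A A t) = t := by
    intro t
    have : (TensorProduct.leftComm ℂ A A A).toLinearMap ∘ₗ
        (TensorProduct.leftComm ℂ A A A).toLinearMap = LinearMap.id :=
      TensorProduct.ext_threefold' fun x y z => rfl
    exact congrArg (fun k => k t) this
  refine G.legsRep_lmul (γ := γ) hρ.span_left hθ (fun c => ?_) (fun c => ?_) d
  · induction c with
    | zero => simp
    | add u v hu hv => intro d; simp only [map_add, LinearMap.add_apply, add_mul, hu, hv]
    | tmul b a =>
      refine G.legsRep_ext₃ (P := G.legsRep ∘ₗ G.leg₁₃ (b ⊗ₜ a))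
        (Q := LinearMap.mulLeft ℂ (γ (b ⊗ₜ a)) ∘ₗ G.legsRep) fun b' k a' x y z => ?_
      change G.legsRep ((b * b') ⊗ₜ (k ⊗ₜ (a * a'))) (x ⊗ₜ (y ⊗ₜ z)) =
        γ (b ⊗ₜ a) (G.legsRep (b' ⊗ₜ (k ⊗ₜ a')) (x ⊗ₜ (y ⊗ₜ z)))
      rw [legsRep_tmul, legsRep_tmul, act_mul, mul_assoc]; rfl
  · rw [hγ', hγ', actTensor_duality, LinearMap.lTensor_comp]
    apply LinearMap.ext
    intro t
    simp [T₁₃, hcomm]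

lemma legsRep_lmul₂₃
    {θ : Multiplier (G.Dual ⊗[ℂ] A) →ₐ[ℂ] Multiplier (G.Dual ⊗[ℂ] (G.Heisenberg ⊗[ℂ] A))}
    (hθ : ExtendsHom G.leg₂₃ θ) (d : G.Dual ⊗[ℂ] (G.Heisenberg ⊗[ℂ] A)) :
    G.legsRep ((θ G.duality).lmul d) = G.T₂₃ * G.legsRep d := by
  obtain ⟨ρ', hρ⟩ := G.isNondegenerateHom_leg₂₃
  let γ : G.Dual ⊗[ℂ] A →ₗ[ℂ] Module.End ℂ (A ⊗[ℂ] (A ⊗[ℂ] A)) :=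
    LinearMap.lTensorHom A ∘ₗ G.actTensor
  refine G.legsRep_lmul (γ := γ) hρ.span_left hθ (fun c => ?_) (fun c => ?_) d
  · induction c with
    | zero => simp
    | add u v hu hv => intro d; simp only [map_add, LinearMap.add_apply, add_mul, hu, hv]
    | tmul b a =>
      refine G.legsRep_ext₃ (P := G.legsRep ∘ₗ G.leg₂₃ (b ⊗ₜ a))
        (Q := LinearMap.mulLeft ℂ (γ (b ⊗ₜ a)) ∘ₗ G.legsRep) fun b' k a' x y z => ?_
      change G.legsRep (b' ⊗ₜ (G.jB b k ⊗ₜ (a * a'))) (x ⊗ₜ (y ⊗ₜ z)) =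
        γ (b ⊗ₜ a) (G.legsRep (b' ⊗ₜ (k ⊗ₜ a')) (x ⊗ₜ (y ⊗ₜ z)))
      rw [legsRep_tmul, legsRep_tmul, heisRep_jB, mul_assoc]; rfl
  · change (G.actTensor _).lTensor A = _
    rw [actTensor_duality, LinearMap.lTensor_comp]; rfl

lemma duality_pentagon
    {θ₁₂ θ₁₃ θ₂₃ : Multiplier (G.Dual ⊗[ℂ] A) →ₐ[ℂ]
      Multiplier (G.Dual ⊗[ℂ] (G.Heisenberg ⊗[ℂ] A))}
    (h₁₂ : ExtendsHom G.leg₁₂ θ₁₂) (h₁₃ : ExtendsHom G.leg₁₃ θ₁₃)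
    (h₂₃ : ExtendsHom G.leg₂₃ θ₂₃) :
    θ₁₂ G.duality * θ₁₃ G.duality * θ₂₃ G.duality = θ₂₃ G.duality * θ₁₂ G.duality := by
  apply Multiplier.ext_lmul G.nondegenerate_legs
  apply LinearMap.ext
  intro d
  apply G.legsRep_injective
  rw [lmul_mul, lmul_mul, lmul_mul, G.legsRep_lmul₁₂ h₁₂, G.legsRep_lmul₁₃ h₁₃,
    G.legsRep_lmul₂₃ h₂₃, G.legsRep_lmul₂₃ h₂₃, G.legsRep_lmul₁₂ h₁₂, ← mul_assoc, ← mul_assoc,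
    ← mul_assoc, T_pentagon]

end AlgebraicQuantumGroup

end

theorem proposition3p17 {A : Type*} [NonUnitalRing A] [Module ℂ A] [IsScalarTower ℂ A A]
    [SMulCommClass ℂ A A] (G : AlgebraicQuantumGroup A) :
    (∃! V : Multiplier (G.Dual ⊗[ℂ] A), G.IsDuality V) ∧
    (∃! σ : Multiplier (G.Dual ⊗[ℂ] A) →ₐ[ℂ] Module.End ℂ (A ⊗[ℂ] A),
      ExtendsAction G.actTensor σ) ∧
    (∃! θ : Multiplier (G.Dual ⊗[ℂ] A) →ₐ[ℂ]
        Multiplier (G.Dual ⊗[ℂ] (G.Heisenberg ⊗[ℂ] A)), ExtendsHom G.leg₁₂ θ) ∧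
    (∃! θ : Multiplier (G.Dual ⊗[ℂ] A) →ₐ[ℂ]
        Multiplier (G.Dual ⊗[ℂ] (G.Heisenberg ⊗[ℂ] A)), ExtendsHom G.leg₁₃ θ) ∧
    (∃! θ : Multiplier (G.Dual ⊗[ℂ] A) →ₐ[ℂ]
        Multiplier (G.Dual ⊗[ℂ] (G.Heisenberg ⊗[ℂ] A)), ExtendsHom G.leg₂₃ θ) ∧
    ∀ V : Multiplier (G.Dual ⊗[ℂ] A), G.IsDuality V →
      (∀ σ : Multiplier (G.Dual ⊗[ℂ] A) →ₐ[ℂ] Module.End ℂ (A ⊗[ℂ] A),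
        ExtendsAction G.actTensor σ →
          ∀ x x' : A, Multiplier.of (σ V (x ⊗ₜ x')) =
            G.Δ x * Multiplier.tmul 1 (Multiplier.of x')) ∧
      (∀ θ₁₂ θ₁₃ θ₂₃ : Multiplier (G.Dual ⊗[ℂ] A) →ₐ[ℂ]
          Multiplier (G.Dual ⊗[ℂ] (G.Heisenberg ⊗[ℂ] A)),
        ExtendsHom G.leg₁₂ θ₁₂ → ExtendsHom G.leg₁₃ θ₁₃ → ExtendsHom G.leg₂₃ θ₂₃ →
          θ₁₂ V * θ₁₃ V * θ₂₃ V = θ₂₃ V * θ₁₂ V) := by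
  obtain ⟨ρ₁₂, h₁₂⟩ := G.isNondegenerateHom_leg₁₂
  obtain ⟨ρ₁₃, h₁₃⟩ := G.isNondegenerateHom_leg₁₃
  obtain ⟨ρ₂₃, h₂₃⟩ := G.isNondegenerateHom_leg₂₃
  refine ⟨G.existsUnique_isDuality, G.existsUnique_extendsAction_actTensor,
    h₁₂.existsUnique_extendsHom G.nondegenerate_dual_tensor G.nondegenerate_legs,
    h₁₃.existsUnique_extendsHom G.nondegenerate_dual_tensor G.nondegenerate_legs,
    h₂₃.existsUnique_extendsHom G.nondegenerate_dual_tensor G.nondegenerate_legs, ?_⟩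
  intro V hV
  rw [hV.eq]
  refine ⟨fun σ hσ x x' => ?_, fun θ₁₂ θ₁₃ θ₂₃ => G.duality_pentagon⟩
  rw [G.extension_duality hσ, G.T₁_spec]
  rfl
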